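/- **Setting.** Let $N\ge 1$, $D\ge1$, $\mathbb S=\{1,\dots,N\}$, $\bar{\mathbb S}=\{\bar1,\dots,\bar N\}$, $\mathcal S=\mathbb S\cup\bar{\mathbb S}$, with $\operatorname{sg}(a)=1$ on $\mathbb S$ and $-1$ on $\bar{\mathbb S}$; $\nu_a=1$ for $a\in\mathbb S\setminus\{1\}$ and $\nu_a=0$ otherwise. Parameters are $s\in\mathbb Z^{\mathcal S}$ with $\sum_a s_a=0$ and times $t_{ja}\in\mathbb C$ ($a\in\mathcal S$, $1\le j\le D$). $\Lambda$ is the shift $n\mapsto n+1$ on sequences of $N\times N$ matrices. All series in shift operators or in $z$ are formal. Let $$W_0=\sum_kE_{kk}\Lambda^{s_k}e^{\sum_jt_{jk}\Lambda^j},\quad \bar W_0=\sum_kE_{kk}\Lambda^{-s_{\bar k}}e^{\sum_jt_{j\bar k}\Lambda^{-j}},\quad W=SW_0,\quad \bar W=\bar S\bar W_0,$$ $S=1+\varphi_1(n)\Lambda^{-1}+\cdots$, $\bar S=\bar\varphi_0(n)+\bar\varphi_1(n)\Lambda+\cdots$ with $\bar\varphi_0(n)$ invertible, coefficients holomorphic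 in $t$, solve the factorization problem $Wg=\bar W$ with $g$ independent of $(s,t)$. As formal series this means $W(s',t)W(s,t)^{-1}=\bar W(s',t)\bar W(s,t)^{-1}$ and $\partial_{ja}W\cdot W^{-1}=\partial_{ja}\bar W\cdot\bar W^{-1}$. Put $L=W\Lambda W^{-1}$, $M=WnW^{-1}$, $C_{kk}=WE_{kk}W^{-1}$, and $\bar L,\bar M,\bar C_{kk}$ likewise from $\bar W$. Fix $n=n_0$. $T_{(a,b)}$ is the shift $s_a\mapsto s_a+1$, $s_b\mapsto s_b-1$. In the KP and Toda pictures fix $a_0\in\mathcal S\setminus\{1\}$ and let $\mathcal T_1=T_{(1,a_0)}$, $\mathcal T_a=T_{(a,1)}$ for $a\ne1$. In the alternative Toda picture let $\mathcal T_{\bar1}=T_{(\bar1,1)}$, $\mathcal T_a=T_{(a,\bar1)}$ for $a\ne\bar1$. Let $$\mathcal K_1=1+\varphi_{1,11}\mathcal T_1^{-1}+\cdots,\quad \mathcal K_k=\varphi_{1,1k}+\varphi_{2,1k}\mathcal T_k^{-1}+\cdots\ (k\ne1),\quad \mathcal K_{\bar k}=\bar\varphi_{0,1k}+\bar\varphi_{1,1k}\mathcal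 T_{\bar k}^{-1}+\cdots,$$ $$\mathcal L_a=\mathcal K_a\mathcal T_a\mathcal K_a^{-1},\qquad \mathcal M_a=n_0-\nu_a+\operatorname{sg}(a)\,\mathcal K_a\Big(s_a+\sum_jjt_{ja}\mathcal T_a^j\Big)\mathcal K_a^{-1}.$$ For $X=\sum_jX_j\mathcal T_a^j$ put $X_+=\sum_{j\ge0}X_j\mathcal T_1^j$ if $a=1$; $X_+=\sum_{j>0}X_j(\mathcal T_a^j-1)$ in the alternative Toda picture if $a\ne1,\bar1$; $X_+=\sum_{j>0}X_j\mathcal T_a^j$ otherwise. The wave functions $\Psi_k$, $\Psi_{\bar k}$ are the $(1,k)$ entries at $n=n_0$ of $W$ and $\bar W$ applied to $\{z^n\mathbb I_N\}_{n\in\mathbb Z}$. **Dispersionless limit.** Suppose the solution depends on $\epsilon\in(0,\epsilon_0)$, and denote from now on by $s,t$ the slow variables ($\epsilon$ times the old ones), restricted to an open set $U$ and to $\sum_as_a=0$. Suppose that $\Psi_a=e^{\mathscr S_a/\epsilon}$ with $$\mathscr S_a=\big(\epsilon(n_0-\nu_a)+\operatorname{sg}(a)s_a\big)\log z+\sum_jt_{ja}z^{\operatorname{sg}(a)j}+\sum_{i\ge0}\sigma_{a,i}\,z^{-\operatorname{sg}(a)i},\qquad\sigma_{1,0}=0,$$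 where the $\sigma_{a,i}$ are $C^\infty$ functions of $(\epsilon,s,t)\in[0,\epsilon_0)\times U$; let $\mathscr S_{a,0}$ be $\mathscr S_a$ at $\epsilon=0$. Limits $\epsilon\to0$ are taken coefficientwise in $z$, at fixed slow $t$, along lattice points converging to the slow point $s$ with $(s,t)\in U$, $\sum_as_a=0$. With the $\sigma$'s at $\epsilon=0$, put $$q_a=(\partial_{s_a}-\partial_{s_1})\sigma_{1,1},\qquad Q_a=q_a-q_{a_0},\qquad \rho_a=\exp\big((\partial_{s_1}-\partial_{s_a})\sigma_{\bar1,0}\big).$$ The dispersionless Lax functions $z_a$ (Laurent series in the local parameter at puncture $a$, with $z_a^{-\operatorname{sg}(a)}$ vanishing there) are defined by $p=\partial_{t_{11}}\mathscr S_{a,0}|_{z=z_a}$ (KP), $p=e^{(\partial_{s_1}-\partial_{s_{a_0}})\mathscr S_{a,0}}|_{z=z_a}$ (Toda), $p=e^{(\partial_{s_1}-\partial_{s_{\bar1}})\mathscr S_{a,0}}|_{z=z_a}$ (alternative Toda). The puncture $1$ is $p=\infty$ with parameter $1/p$; the puncture $a\ne1$ is $q_a$ (KP), $Q_a$ (Toda),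 and in the alternative Toda picture $0$ if $a=\bar1$ and $-\rho_a$ otherwise. Let $m_a=\partial_z\mathscr S_{a,0}|_{z=z_a}$ (KP), $m_a=z\,\partial_z\mathscr S_{a,0}|_{z=z_a}$ (Toda, alternative Toda). Let $$\begin{aligned}&\text{KP: }&&Z_1=p-q_{a_0},\quad Z_a=\tfrac1{p-q_a}\ (a\ne1);\\&\text{Toda: }&&Z_1=p,\quad Z_{a_0}=\tfrac1p,\quad Z_a=\tfrac1{p-Q_a}\ (a\ne1,a_0);\\&\text{alternative Toda: }&&Z_1=p,\quad Z_{\bar1}=\tfrac1p,\quad Z_a=\tfrac p{p+\rho_a}\ (a\ne1,\bar1).\end{aligned}$$ For coefficients $(c_j)$ vanishing for large $j$, put $\big(\sum_jc_jZ_a^j\big)_+=\sum_{j\ge0}c_jZ_1^j$ if $a=1$; $\sum_{j>0}c_j(Z_a^j-1)$ in the alternative Toda picture if $a\ne1,\bar1$; $\sum_{j>0}c_jZ_a^j$ otherwise. For an operator $X=\sum_j f_{aj}\mathcal T_a^j$ ($f_{aj}=0$ for large $j$) put $$X_{a,0}=\Big[\lim_{\epsilon\to0}\frac{X(\Psi_a)}{\Psi_a}\Big]_{z=z_a},\qquad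 X_{a,0+}=\Big[\lim_{\epsilon\to0}\frac{X_+(\Psi_a)}{\Psi_a}\Big]_{z=z_a},$$ the second being (the expansion at puncture $a$ of) a rational function of $p$. **Statement.** In each of the three pictures: 0. The functions $z_a$ exist and are unique. 1. Let $F_a(x,y)=\sum_{i\ge0,\,j\in\mathbb Z}F_{aij}x^iy^j$ ($a\in\mathcal S$), $F_{aij}=F_{aij,0}\epsilon^i+O(\epsilon^{i+1})$, where for every $m$ only finitely many $(i,j)$ with $iD+j\ge m$ have $F_{aij}\not\equiv0$. Then for $X=F_a(\mathcal M_a,\mathcal L_a)=\sum_j f_{aj}\mathcal T_a^j$ the coefficients $f_{aj}$ have limits as $\epsilon\to0$, the limits $F_{a,0}:=X_{a,0}$ and $F_{a,0+}:=X_{a,0+}$ exist, and $F_{a,0}$ is $F_{a,0}(z_a,m_a)=\sum F_{aij,0}z_a^{i+\operatorname{sg}(a)j}m_a^i$ (KP), respectively $\sum F_{aij,0}z_a^{\operatorname{sg}(a)j}m_a^i$ (Toda, alternative Toda). If moreover the string equation $$E_{11}\sum_{k=1}^NF_k(M,L)C_{kk}=E_{11}\sum_{k=1}^NF_{\bar k}(\bar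 M,\bar L^{-1})\bar C_{kk}$$ holds (for all $\epsilon\in(0,\epsilon_0)$ and all admitted parameters), then $$F_{a,0}(z_a,m_a)=\sum_{b\in\mathcal S}F_{b,0+}\qquad\text{for all }a\in\mathcal S,$$ as Laurent series at the puncture $a$. 2. For every family $X=\sum_{j\le d}f_{aj}\mathcal T_a^j$ with $f_{aj}\to f_{aj|0}$ as $\epsilon\to0$, one has $X_{a,0}=\sum_jf_{aj|0}Z_a^j$ and $X_{a,0+}=\big(\sum_jf_{aj|0}Z_a^j\big)_+$. 3. For all $a\in\mathcal S$, $1\le j\le D$ there is a rational function $\Omega_{ja}$ of $p$ with $\partial_{t_{ja}}\mathscr S_{b,0}|_{z=z_b}=\Omega_{ja}$ for all $b\in\mathcal S$; it is the limit $X_{a,0+}$ for $X=\mathcal L_a^j$, and $\Omega_{ja}=\big(z_a^{\operatorname{sg}(a)j}\big)_+$. -/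

import Mathlib

open Filter Topology
open scoped ContDiff

noncomputable section

namespace Whitham

/-! ## Formal series in a shift operator -/

/-- Formal two-sided series `∑_j X_j T^j` with coefficients `X_j : Γ → R`, where `T` is the shift
`(T f)(x) = f (x + v)` on functions on the abelian group `Γ`; `X j` is the coefficient of `T^j`. -/
abbrev Op (Γ R : Type*) := ℤ → Γ → R

namespace Op

variable {Γ R : Type*} [AddCommGroup Γ] [Ring R]

/-- The product `(X T^i) · (Y T^j) = X(x) Y(x + i v) T^(i+j)`, extended to series. All sums that
occur are finite when both factors are bounded above, or both bounded below, in powers of `T`. -/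
def mul (v : Γ) (X Y : Op Γ R) : Op Γ R :=
  fun m x => ∑ᶠ i : ℤ, X i x * Y (m - i) (x + i • v)

/-- `T^j`. -/
def shift (j : ℤ) : Op Γ R := fun m _ => if m = j then 1 else 0

/-- Natural powers. -/
def pow (v : Γ) (X : Op Γ R) : ℕ → Op Γ R
  | 0 => shift 0
  | k + 1 => mul v (pow v X k) X

/-- Integer powers of `X`, where `Xi` is the inverse of `X`. -/
def zpow (v : Γ) (X Xi : Op Γ R) : ℤ → Op Γ R
  | Int.ofNat k => pow v X k
  | Int.negSucc k => pow v Xi (k + 1)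

/-- `k ↦ ∑_{i ≥ 0} k_i T^(-i)`. -/
def down (k : ℕ → Γ → R) : Op Γ R := fun m x => if m ≤ 0 then k (-m).toNat x else 0

/-- `k ↦ ∑_{i ≥ 0} k_i T^i`. -/
def up (k : ℕ → Γ → R) : Op Γ R := fun m x => if 0 ≤ m then k m.toNat x else 0

/-- The coefficients `h_i` of the inverse of `∑_{i ≥ 0} k_i U^i`, where `U` is the shift by `v`:
`h_0 = k_0⁻¹` and `∑_{i ≤ m} h_i(x) k_{m-i}(x + i v) = 0` for `m > 0`. -/
def invCoeff (v : Γ) (k : ℕ → Γ → R) : ℕ → Γ → R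
  | m => fun x =>
    if m = 0 then Ring.inverse (k 0 x)
    else -(∑ i : Fin m, invCoeff v k i x * k (m - i) (x + (i : ℕ) • v)) *
      Ring.inverse (k 0 (x + m • v))
termination_by m => m
decreasing_by exact i.2

/-- `A · X · A⁻¹`, where `Ai` is the inverse of `A`. -/
def dress (v : Γ) (A Ai X : Op Γ R) : Op Γ R := mul v (mul v A X) Ai

/-- `F(X, Y) = ∑_{i ≥ 0, j ∈ ℤ} F_{ij} X^i Y^j`, where `Yi` is the inverse of `Y`. -/
def eval₂ [Module ℂ R] (v : Γ) (F : ℕ → ℤ → ℂ) (X Y Yi : Op Γ R) : Op Γ R :=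
  fun m x => ∑ᶠ ij : ℕ × ℤ, F ij.1 ij.2 • mul v (pow v X ij.1) (zpow v Y Yi ij.2) m x

end Op

/-! ## The multicomponent 2D Toda hierarchy -/

/-- The index set `𝒮 = 𝕊 ∪ 𝕊̄`: `Sum.inl k` is `k ∈ 𝕊`, `Sum.inr k` is `k̄ ∈ 𝕊̄`.
The elements `1 ∈ 𝕊` and `1̄ ∈ 𝕊̄` are `Sum.inl 0` and `Sum.inr 0`. -/
abbrev Idx (N : ℕ) := Fin N ⊕ Fin N

/-- `sg a = 1` on `𝕊` and `sg a = -1` on `𝕊̄`. -/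
def sg {N : ℕ} : Idx N → ℤ
  | Sum.inl _ => 1
  | Sum.inr _ => -1

/-- Continuous times; `t a j` is the time `t_{j+1,a}`. -/
abbrev Times (N D : ℕ) := Idx N → Fin D → ℂ

/-- The direction of the time `t_{j+1,a}`. -/
def timeDir {N D : ℕ} (a : Idx N) (j : Fin D) : Times N D := Pi.single a (Pi.single j 1)

abbrev Mat (N : ℕ) := Matrix (Fin N) (Fin N) ℂ

/-- Coefficients of the dressing series `S = ∑_{i ≥ 0} φ_i(n) Λ^(-i)` and
`S̄ = ∑_{i ≥ 0} φ̄_i(n) Λ^i`, as functions of `i, n, s, t`. -/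
structure TodaData (N D : ℕ) where
  φ : ℕ → ℤ → (Idx N → ℤ) → Times N D → Mat N
  φbar : ℕ → ℤ → (Idx N → ℤ) → Times N D → Mat N

section Toda

variable {N D : ℕ}

namespace TodaData

variable (A : TodaData N D) (s : Idx N → ℤ) (t : Times N D)

def S : Op ℤ (Mat N) := Op.down fun i n => A.φ i n s t
def Sinv : Op ℤ (Mat N) := Op.down (Op.invCoeff (-1) fun i n => A.φ i n s t)
def Sbar : Op ℤ (Mat N) := Op.up fun i n => A.φbar i n s t
def Sbarinv : Op ℤ (Mat N) := Op.up (Op.invCoeff 1 fun i n => A.φbar i n s t)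

/-- `∂S/∂t_{j+1,a}`. -/
def dS (a : Idx N) (j : Fin D) : Op ℤ (Mat N) := Op.down fun i n => Matrix.of fun k l =>
  fderiv ℂ (fun t' => A.φ i n s t' k l) t (timeDir a j)

/-- `∂S̄/∂t_{j+1,a}`. -/
def dSbar (a : Idx N) (j : Fin D) : Op ℤ (Mat N) := Op.up fun i n => Matrix.of fun k l =>
  fderiv ℂ (fun t' => A.φbar i n s t' k l) t (timeDir a j)

end TodaData

/-- `E_kk Λ^j`. -/
def EΛ (k : Fin N) (j : ℤ) : Op ℤ (Mat N) := fun m _ => if m = j then Matrix.single k k 1 else 0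

/-- `W₀(s + v, t) W₀(s, t)⁻¹ = ∑_k E_kk Λ^(v_k)`, where
`W₀ = ∑_k E_kk Λ^(s_k) exp (∑_j t_{jk} Λ^j)`. -/
def ratioW₀ (v : Idx N → ℤ) : Op ℤ (Mat N) :=
  fun m _ => Matrix.diagonal fun k => if m = v (Sum.inl k) then 1 else 0

/-- `W̄₀(s + v, t) W̄₀(s, t)⁻¹ = ∑_k E_kk Λ^(-v_k̄)`, where
`W̄₀ = ∑_k E_kk Λ^(-s_k̄) exp (∑_j t_{jk̄} Λ^(-j))`. -/
def ratioW₀bar (v : Idx N → ℤ) : Op ℤ (Mat N) :=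
  fun m _ => Matrix.diagonal fun k => if m = -v (Sum.inr k) then 1 else 0

/-- `∂W/∂t_{j+1,a} · W⁻¹` for `W = S W₀`. -/
def dWWinv (A : TodaData N D) (s : Idx N → ℤ) (t : Times N D) (a : Idx N) (j : Fin D) :
    Op ℤ (Mat N) :=
  Op.mul 1 (A.dS s t a j) (A.Sinv s t) +
    match a with
    | Sum.inl k => Op.dress 1 (A.S s t) (A.Sinv s t) (EΛ k (j + 1))
    | Sum.inr _ => 0

/-- `∂W̄/∂t_{j+1,a} · W̄⁻¹` for `W̄ = S̄ W̄₀`. -/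
def dWbarWbarinv (A : TodaData N D) (s : Idx N → ℤ) (t : Times N D) (a : Idx N) (j : Fin D) :
    Op ℤ (Mat N) :=
  Op.mul 1 (A.dSbar s t a j) (A.Sbarinv s t) +
    match a with
    | Sum.inl _ => 0
    | Sum.inr k => Op.dress 1 (A.Sbar s t) (A.Sbarinv s t) (EΛ k (-(j + 1)))

/-- `S ∈ G_-` and `S̄ ∈ G_+` solve the factorization problem `S W₀ g = S̄ W̄₀`, `W = S W₀`,
`W̄ = S̄ W̄₀`, on the set `dom` of parameters `(s, t)`, with an operator `g` that does not depend on
`(s, t)`. Products of series that are infinite in opposite directions carry no formal meaning, so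
the constancy of `g = W⁻¹ W̄` in `(s, t)` is written with the well-defined series
`W(s',t) W(s,t)⁻¹ = W̄(s',t) W̄(s,t)⁻¹` and `∂W · W⁻¹ = ∂W̄ · W̄⁻¹`. -/
structure SolvesFactorization (A : TodaData N D) (dom : Set ((Idx N → ℤ) × Times N D)) :
    Prop where
  lead : ∀ s t, (s, t) ∈ dom → ∀ n, A.φ 0 n s t = 1
  lead_bar : ∀ s t, (s, t) ∈ dom → ∀ n, IsUnit (A.φbar 0 n s t)
  diff : ∀ s t, (s, t) ∈ dom → ∀ i n k l, DifferentiableAt ℂ (fun t' => A.φ i n s t' k l) t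
  diff_bar : ∀ s t, (s, t) ∈ dom → ∀ i n k l,
    DifferentiableAt ℂ (fun t' => A.φbar i n s t' k l) t
  const_s : ∀ s s' t, (s, t) ∈ dom → (s', t) ∈ dom →
    Op.mul 1 (Op.mul 1 (A.S s' t) (ratioW₀ (s' - s))) (A.Sinv s t) =
      Op.mul 1 (Op.mul 1 (A.Sbar s' t) (ratioW₀bar (s' - s))) (A.Sbarinv s t)
  const_t : ∀ s t, (s, t) ∈ dom → ∀ a j, dWWinv A s t a j = dWbarWbarinv A s t a j

/-- `W₀ n W₀⁻¹ = n + ∑_k E_kk (s_k + ∑_j j t_{jk} Λ^j)`. -/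
def vacOrlov (s : Idx N → ℤ) (t : Times N D) : Op ℤ (Mat N) := fun m n =>
  (if m = 0 then Matrix.diagonal fun k => (n : ℂ) + s (Sum.inl k) else 0) +
    Matrix.diagonal fun k =>
      ∑ j : Fin D, if m = (j : ℤ) + 1 then ((j : ℂ) + 1) * t (Sum.inl k) j else 0

/-- `W̄₀ n W̄₀⁻¹ = n - ∑_k E_kk (s_k̄ + ∑_j j t_{jk̄} Λ^(-j))`. -/
def vacOrlovbar (s : Idx N → ℤ) (t : Times N D) : Op ℤ (Mat N) := fun m n =>
  (if m = 0 then Matrix.diagonal fun k => (n : ℂ) - s (Sum.inr k) else 0) -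
    Matrix.diagonal fun k =>
      ∑ j : Fin D, if m = -((j : ℤ) + 1) then ((j : ℂ) + 1) * t (Sum.inr k) j else 0

namespace TodaData

variable (A : TodaData N D) (s : Idx N → ℤ) (t : Times N D)

/-- `L = W Λ W⁻¹ = S Λ S⁻¹`, and its inverse. -/
def L : Op ℤ (Mat N) := Op.dress 1 (A.S s t) (A.Sinv s t) (Op.shift 1)
def Linv : Op ℤ (Mat N) := Op.dress 1 (A.S s t) (A.Sinv s t) (Op.shift (-1))

/-- `L̄ = W̄ Λ W̄⁻¹ = S̄ Λ S̄⁻¹`, and its inverse. -/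
def Lbar : Op ℤ (Mat N) := Op.dress 1 (A.Sbar s t) (A.Sbarinv s t) (Op.shift 1)
def Lbarinv : Op ℤ (Mat N) := Op.dress 1 (A.Sbar s t) (A.Sbarinv s t) (Op.shift (-1))

/-- `M = W n W⁻¹` and `M̄ = W̄ n W̄⁻¹`. -/
def M : Op ℤ (Mat N) := Op.dress 1 (A.S s t) (A.Sinv s t) (vacOrlov s t)
def Mbar : Op ℤ (Mat N) := Op.dress 1 (A.Sbar s t) (A.Sbarinv s t) (vacOrlovbar s t)

/-- `C_kk = W E_kk W⁻¹` and `C̄_kk = W̄ E_kk W̄⁻¹`. -/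
def C (k : Fin N) : Op ℤ (Mat N) := Op.dress 1 (A.S s t) (A.Sinv s t) (EΛ k 0)
def Cbar (k : Fin N) : Op ℤ (Mat N) := Op.dress 1 (A.Sbar s t) (A.Sbarinv s t) (EΛ k 0)

/-- The string equation
`E₁₁ ∑_k F_k(M, L) C_kk = E₁₁ ∑_k F_k̄(M̄, L̄⁻¹) C̄_kk` at `(s, t)`, as operators in `n`;
multiplication by `E₁₁` selects the first row. -/
def StringEq [NeZero N] (F : Idx N → ℕ → ℤ → ℂ) : Prop :=
  ∀ (m n : ℤ) (l : Fin N),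
    (∑ k, Op.mul 1 (Op.eval₂ 1 (F (Sum.inl k)) (A.M s t) (A.L s t) (A.Linv s t))
        (A.C s t k) m n) 0 l =
      (∑ k, Op.mul 1 (Op.eval₂ 1 (F (Sum.inr k)) (A.Mbar s t) (A.Lbarinv s t) (A.Lbar s t))
        (A.Cbar s t k) m n) 0 l

end TodaData

end Toda

/-! ## Scalar operators of the dispersive Whitham hierarchy -/

section Scalar

variable {N D : ℕ} [NeZero N]

/-- The three pictures of the dispersionless limit. -/
inductive Picture
  | kp
  | toda
  | altToda
  deriving DecidableEq

/-- The vector `e_a - e_b` of the shift `T_(a,b) : s_a ↦ s_a + 1, s_b ↦ s_b - 1`. -/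
def shiftVec (a b : Idx N) : Idx N → ℤ := Pi.single a 1 - Pi.single b 1

/-- The shift vector of `𝒯_a` (KP and Toda pictures: `T_(1,a₀)` for `a = 1` and `T_(a,1)`
otherwise) and of `𝒯̄_a` (alternative Toda picture, whose `a₀` is `1`: `T_(1̄,1)` for `a = 1̄` and
`T_(a,1̄)` otherwise). -/
def vec (pic : Picture) (a₀ a : Idx N) : Idx N → ℤ :=
  match pic with
  | Picture.altToda =>
    if a = Sum.inr 0 then shiftVec (Sum.inr 0) (Sum.inl 0) else shiftVec a (Sum.inr 0)
  | _ => if a = Sum.inl 0 then shiftVec (Sum.inl 0) a₀ else shiftVec a (Sum.inl 0)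

/-- `ν_a = 1` for `a ∈ 𝕊 \ {1}` and `ν_a = 0` otherwise. -/
def ν : Idx N → ℤ
  | Sum.inl k => if k = 0 then 0 else 1
  | Sum.inr _ => 0

namespace TodaData

variable (A : TodaData N D) (n₀ : ℤ) (t : Times N D)

/-- The coefficients at `n = n₀` of `𝒦_a = ∑_{i ≥ 0} κ_{a,i} 𝒯_a^(-i)`; they are entries of the
first rows of `S` and `S̄`. The wave functions `Ψ_k = ψ_{1k}`, `Ψ_k̄ = ψ̄_{1k}` are
`Ψ_a = z^(n₀ - ν_a + sg(a) s_a) exp (∑_j t_{ja} z^(sg(a) j)) ∑_{i ≥ 0} κ_{a,i} y^i` with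
`y = z^(-sg(a))`. -/
def κ (a : Idx N) : ℕ → (Idx N → ℤ) → ℂ :=
  match a with
  | Sum.inl k => fun i s => if k = 0 then A.φ i n₀ s t 0 0 else A.φ (i + 1) n₀ s t 0 k
  | Sum.inr k => fun i s => A.φbar i n₀ s t 0 k

/-- `𝒦_a` and its inverse, as series in the shift with vector `v`. -/
def K (a : Idx N) : Op (Idx N → ℤ) ℂ := Op.down (A.κ n₀ t a)
def Kinv (v : Idx N → ℤ) (a : Idx N) : Op (Idx N → ℤ) ℂ :=
  Op.down (Op.invCoeff (-v) (A.κ n₀ t a))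

/-- The scalar Lax operator `ℒ_a = 𝒦_a 𝒯_a 𝒦_a⁻¹`, and its inverse. -/
def scalarL (v : Idx N → ℤ) (a : Idx N) : Op (Idx N → ℤ) ℂ :=
  Op.dress v (A.K n₀ t a) (A.Kinv n₀ t v a) (Op.shift 1)
def scalarLinv (v : Idx N → ℤ) (a : Idx N) : Op (Idx N → ℤ) ℂ :=
  Op.dress v (A.K n₀ t a) (A.Kinv n₀ t v a) (Op.shift (-1))

/-- The scalar Orlov–Schulman operator `ℳ_a = n - ν_a + sg(a) 𝒲_a s_a 𝒲_a⁻¹` at `n = n₀`, where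
`𝒲_a = 𝒦_a 𝒲_{0,a}`, `𝒲_{0,a} = exp (∑_j t_{ja} 𝒯_a^j)` and
`𝒲_{0,a} s_a 𝒲_{0,a}⁻¹ = s_a + ∑_j j t_{ja} 𝒯_a^j`. -/
def scalarM (v : Idx N → ℤ) (a : Idx N) : Op (Idx N → ℤ) ℂ := fun m s =>
  (if m = 0 then (n₀ : ℂ) - ν a else 0) +
    sg a * Op.dress v (A.K n₀ t a) (A.Kinv n₀ t v a)
      (fun m' s' => (if m' = 0 then (s' a : ℂ) else 0) +
        ∑ j : Fin D, if m' = (j : ℤ) + 1 then ((j : ℂ) + 1) * t a j else 0) m s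

/-- `F_a(ℳ_a, ℒ_a)`. -/
def scalarF (v : Idx N → ℤ) (F : ℕ → ℤ → ℂ) (a : Idx N) : Op (Idx N → ℤ) ℂ :=
  Op.eval₂ v F (A.scalarM n₀ t v a) (A.scalarL n₀ t v a) (A.scalarLinv n₀ t v a)

end TodaData

/-- The projection `X_+` of `X = ∑_j X_j 𝒯_a^j`: `∑_{j ≥ 0} X_j 𝒯_1^j` for `a = 1`;
`∑_{j > 0} X_j (𝒯̄_a^j - 1)` in the alternative Toda picture for `a ≠ 1, 1̄`; and
`∑_{j > 0} X_j 𝒯_a^j` in the other cases. -/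
def plusOp {Γ : Type*} (pic : Picture) (a : Idx N) (X : Op Γ ℂ) : Op Γ ℂ := fun j x =>
  if a = Sum.inl 0 then (if 0 ≤ j then X j x else 0)
  else if 0 < j then X j x
  else if j = 0 ∧ pic = Picture.altToda ∧ a ≠ Sum.inr 0 then
    -∑ᶠ i : ℤ, if 0 < i then X i x else 0
  else 0

/-! ## Laurent series -/

/-- The Laurent series with given coefficients (if they vanish for large negative indices). -/
def toLaurent (u : ℤ → ℂ) : LaurentSeries ℂ :=
  open Classical in
  if h : BddBelow (Function.support u) then HahnSeries.ofSuppBddBelow u h else 0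

/-- `∑_j c_j Z^j`. -/
def laurentSum (c : ℤ → ℂ) (Z : LaurentSeries ℂ) : LaurentSeries ℂ :=
  toLaurent fun r => ∑ᶠ j : ℤ, c j * (Z ^ j).coeff r

/-- The composition `f(y(w))`, for `y` of positive order. -/
def lsubst (f y : LaurentSeries ℂ) : LaurentSeries ℂ := laurentSum f.coeff y

/-- The exponential of a formal power series. -/
def expSeries (f : PowerSeries ℂ) : PowerSeries ℂ := PowerSeries.mk fun m =>
  Complex.exp (f.coeff 0) * ∑ r ∈ Finset.range (m + 1),
    ((f - PowerSeries.C (f.coeff 0)) ^ r).coeff m / (r.factorial : ℂ)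

/-- `w^k` times a constant. -/
def mono (k : ℤ) (c : ℂ) : LaurentSeries ℂ := HahnSeries.single k c

def ofPS (f : PowerSeries ℂ) : LaurentSeries ℂ := HahnSeries.ofPowerSeries ℤ ℂ f

/-- `X(Ψ_b) / Ψ_b` at `s` as a Laurent series in `y = z^(-sg(b))`, for `X = ∑_j X_j T^j` with `T`
the shift by `v`, and `κ` the coefficients of `Ψ_b`; note that `T^j` multiplies the elementary
factor of `Ψ_b` by `z^(sg(b) j v_b) = y^(-j v_b)`. -/
def waveRatio (v : Idx N → ℤ) (X : Op (Idx N → ℤ) ℂ) (κ : ℕ → (Idx N → ℤ) → ℂ) (b : Idx N)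
    (s : Idx N → ℤ) : LaurentSeries ℂ :=
  toLaurent (fun r => ∑ᶠ j : ℤ, X j s *
      (if 0 ≤ r + j * v b then κ (r + j * v b).toNat (s + j • v) else 0)) /
    ofPS (PowerSeries.mk fun i => κ i s)

/-! ## The dispersionless limit -/

/-- Points `(s, t)` of slow variables. -/
abbrev Slow (N D : ℕ) := (Idx N → ℝ) × Times N D

/-- The slow variables `(ε s, ε t)`. -/
def toSlow (ε : ℝ) (s : Idx N → ℤ) (t : Times N D) : Slow N D :=
  (fun a => ε * s a, (ε : ℂ) • t)

/-- The zero charge parameters `(s, t)` whose slow variables lie in `U`. -/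
def fastDom (U : Set (Slow N D)) (ε : ℝ) : Set ((Idx N → ℤ) × Times N D) :=
  {p | ∑ a, p.1 a = 0 ∧ toSlow ε p.1 p.2 ∈ U}

/-- `ε → 0⁺` while the zero charge lattice points `m` satisfy `ε m → s`. -/
def slowLim (s : Idx N → ℝ) : Filter (ℝ × (Idx N → ℤ)) :=
  (𝓝[>] (0 : ℝ) ×ˢ 𝓟 {m : Idx N → ℤ | ∑ a, m a = 0}) ⊓
    comap (fun p => fun a => p.1 * (p.2 a : ℝ)) (𝓝 s)

/-- The quasi-classical form of the wave functions: `Ψ_a = exp (𝒮_a / ε)` with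
`𝒮_a = (ε(n₀ - ν_a) + sg(a) s_a) log z + ∑_j t_{ja} z^(sg(a) j) + ∑_{i ≥ 0} σ_{a,i} y^i`,
`y = z^(-sg(a))`, where the `σ_{a,i}` are smooth in `(s, t)` and in `ε` up to `ε = 0`, so that
`𝒮_a = 𝒮_{a,0} + ε 𝒮_{a,1} + ⋯`, and `σ_{1,0} = 0`. -/
structure QuasiClassical (U : Set (Slow N D)) (ε₀ : ℝ) (n₀ : ℤ) (A : ℝ → TodaData N D)
    (σ : Idx N → ℕ → ℝ → Slow N D → ℂ) : Prop where
  smooth : ∀ a i, ContDiffOn ℝ ∞ (fun x : ℝ × Slow N D => σ a i x.1 x.2) (Set.Ico 0 ε₀ ×ˢ U)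
  lead : ∀ ε ∈ Set.Ico 0 ε₀, ∀ x ∈ U, σ (Sum.inl 0) 0 ε x = 0
  wave : ∀ ε ∈ Set.Ioo 0 ε₀, ∀ s t, (s, t) ∈ fastDom U ε → ∀ a,
    PowerSeries.mk (fun i => (A ε).κ n₀ t a i s) =
      expSeries (PowerSeries.mk fun i => σ a i ε (toSlow ε s t) / ε)

section Classical

variable (σ : Idx N → ℕ → ℝ → Slow N D → ℂ) (x : Slow N D)

/-- The derivative of `σ_{a,i}|_{ε = 0}` at `x` in a direction. -/
def dσ (a : Idx N) (i : ℕ) (dir : Slow N D) : ℂ := fderiv ℝ (σ a i 0) x dir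

/-- The direction of the slow discrete variables given by an integer vector. -/
def dirS (v : Idx N → ℤ) : Slow N D := (fun a => (v a : ℝ), 0)

/-- `∂𝒮_{b,0}/∂t_{j+1,a}` as a Laurent series in `y = z^(-sg(b))`. -/
def dtS (a : Idx N) (j : Fin D) (b : Idx N) : LaurentSeries ℂ :=
  (if a = b then mono (-((j : ℤ) + 1)) 1 else 0) +
    ofPS (PowerSeries.mk fun i => dσ σ x b i (0, timeDir a j))

/-- `exp (∑_c v_c ∂𝒮_{b,0}/∂s_c)` as a Laurent series in `y = z^(-sg(b))`. -/
def expdsS (v : Idx N → ℤ) (b : Idx N) : LaurentSeries ℂ :=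
  mono (-v b) 1 * ofPS (expSeries (PowerSeries.mk fun i => dσ σ x b i (dirS v)))

/-- `z ∂𝒮_{a,0}/∂z` as a Laurent series in `y = z^(-sg(a))`. -/
def zdzS (a : Idx N) : LaurentSeries ℂ :=
  (sg a : ℤ) • (mono 0 (x.1 a : ℂ) +
    (∑ j : Fin D, mono (-((j : ℤ) + 1)) (((j : ℂ) + 1) * x.2 a j)) -
      ofPS (PowerSeries.mk fun i => (i : ℂ) * σ a i 0 x))

/-- `q_a = (∂_{s_a} - ∂_{s_1}) σ_{1,1}|_{ε = 0}`, where `σ_{1,1} = ε φ_{1,11}`. -/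
def q (a : Idx N) : ℂ := dσ σ x (Sum.inl 0) 1 (dirS (shiftVec a (Sum.inl 0)))

/-- `ρ_a = exp ((∂_{s_1} - ∂_{s_a}) σ_{1̄,0}|_{ε = 0})`, where `σ_{1̄,0} = ε log φ̄_{0,11}`. It is
the quotient of `r_1` by `r_a`, where
`r_a = exp ((∂_{s_a} - ∂_{s_1̄}) σ_{1̄,0}|_{ε = 0})` is the limit of the leading coefficient
of `ℒ̄_1̄` formed with the shift `T_(1̄,a)`. -/
def ρ (a : Idx N) : ℂ := Complex.exp (dσ σ x (Sum.inr 0) 0 (dirS (shiftVec (Sum.inl 0) a)))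

variable [NeZero D] (pic : Picture) (a₀ : Idx N)

/-- The series in `y = z^(-sg(b))` that defines `p`: `∂𝒮_{b,0}/∂t_{11}` (KP);
`exp ((∂_{s_1} - ∂_{s_{a₀}}) 𝒮_{b,0})` (Toda); `exp ((∂_{s_1} - ∂_{s_1̄}) 𝒮_{b,0})`
(alternative Toda). -/
def pSeries (b : Idx N) : LaurentSeries ℂ :=
  match pic with
  | Picture.kp => dtS σ x (Sum.inl 0) 0 b
  | Picture.toda => expdsS σ x (shiftVec (Sum.inl 0) a₀) b
  | Picture.altToda => expdsS σ x (shiftVec (Sum.inl 0) (Sum.inr 0)) b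

/-- The puncture `a ≠ 1` (the puncture `1` is `p = ∞`): `q_a` (KP); `q_a - q_{a₀}` (Toda);
`0` for `a = 1̄` and `-ρ_a` otherwise (alternative Toda). -/
def puncture (a : Idx N) : ℂ :=
  match pic with
  | Picture.kp => q σ x a
  | Picture.toda => if a = a₀ then 0 else q σ x a - q σ x a₀
  | Picture.altToda => if a = Sum.inr 0 then 0 else -ρ σ x a

/-- `p` in terms of the local parameter `w` at the puncture `a`: `p = 1/w` for `a = 1`, and
`p = puncture a + w` otherwise. -/
def pLoc (a : Idx N) : LaurentSeries ℂ :=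
  if a = Sum.inl 0 then mono (-1) 1 else mono 0 (puncture σ x pic a₀ a) + mono 1 1

/-- The expansion at the puncture `a` of a rational function of `p`. -/
def expand (a : Idx N) (R : RatFunc ℂ) : LaurentSeries ℂ :=
  RatFunc.eval HahnSeries.C (pLoc σ x pic a₀ a) R

/-- The rational function `Z_a(p)` that is the limit of the symbol of `𝒯_a` (or `𝒯̄_a`). -/
def Zfun (a : Idx N) : RatFunc ℂ :=
  match pic with
  | Picture.kp =>
    if a = Sum.inl 0 then RatFunc.X - RatFunc.C (q σ x a₀)
    else 1 / (RatFunc.X - RatFunc.C (q σ x a))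
  | Picture.toda =>
    if a = Sum.inl 0 then RatFunc.X
    else if a = a₀ then 1 / RatFunc.X
    else 1 / (RatFunc.X - RatFunc.C (q σ x a - q σ x a₀))
  | Picture.altToda =>
    if a = Sum.inl 0 then RatFunc.X
    else if a = Sum.inr 0 then 1 / RatFunc.X
    else RatFunc.X / (RatFunc.X + RatFunc.C (ρ σ x a))

/-- `∑_j c_j Z_a(p)^j`, expanded at the puncture `a`. -/
def fullSum (a : Idx N) (c : ℤ → ℂ) : LaurentSeries ℂ :=
  laurentSum c (expand σ x pic a₀ a (Zfun σ x pic a₀ a))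

/-- The rational function `∑_{j ≥ 0} c_j Z_1^j` for `a = 1`; `∑_{j > 0} c_j (Z_a^j - 1)` in the
alternative Toda picture for `a ≠ 1, 1̄`; `∑_{j > 0} c_j Z_a^j` in the other cases. -/
def plusSum (a : Idx N) (c : ℤ → ℂ) : RatFunc ℂ :=
  if a = Sum.inl 0 then
    ∑ᶠ j : ℤ, if 0 ≤ j then RatFunc.C (c j) * Zfun σ x pic a₀ a ^ j else 0
  else if pic = Picture.altToda ∧ a ≠ Sum.inr 0 then
    ∑ᶠ j : ℤ, if 0 < j then RatFunc.C (c j) * (Zfun σ x pic a₀ a ^ j - 1) else 0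
  else
    ∑ᶠ j : ℤ, if 0 < j then RatFunc.C (c j) * Zfun σ x pic a₀ a ^ j else 0

/-- `R = (u)_+` for a Laurent series `u` at the puncture `a`: `u = ∑_{j ≤ d} c_j Z_a^j` and `R` is
the corresponding projection. -/
def IsPlusPart (a : Idx N) (u : LaurentSeries ℂ) (R : RatFunc ℂ) : Prop :=
  ∃ c : ℤ → ℂ, (∃ d : ℤ, ∀ j > d, c j = 0) ∧ u = fullSum σ x pic a₀ a c ∧
    R = plusSum σ x pic a₀ a c

/-- The dispersionless Lax functions `z_a`, through `y_a = z_a^(-sg(a))`, a Laurent series in the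
local parameter at the puncture `a` that vanishes there and satisfies the implicit relation
`p = pSeries a` at `y = y_a`. -/
def IsLaxFamily (y : Idx N → LaurentSeries ℂ) : Prop :=
  ∀ a, 0 < (y a).order ∧ lsubst (pSeries σ x pic a₀ a) (y a) = pLoc σ x pic a₀ a

/-- `z_a = y_a^(-sg(a))`. -/
def zLax (y : Idx N → LaurentSeries ℂ) (a : Idx N) : LaurentSeries ℂ := y a ^ (-sg a)

/-- The Orlov–Schulman function: `m_a = ∂𝒮_{a,0}/∂z` (KP) or `m_a = z ∂𝒮_{a,0}/∂z` (Toda and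
alternative Toda), at `z = z_a`; here `z⁻¹ = y^(sg(a))`. -/
def mOrlov (y : Idx N → LaurentSeries ℂ) (a : Idx N) : LaurentSeries ℂ :=
  match pic with
  | Picture.kp => lsubst (mono (sg a) 1 * zdzS σ x a) (y a)
  | _ => lsubst (zdzS σ x a) (y a)

/-- `∑ F_{ij} z_a^(i + sg(a) j) m_a^i` (KP) or `∑ F_{ij} z_a^(sg(a) j) m_a^i` (Toda and alternative
Toda), summed coefficientwise. -/
def symbolF (F : ℕ → ℤ → ℂ) (y : Idx N → LaurentSeries ℂ) (a : Idx N) : LaurentSeries ℂ :=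
  toLaurent fun r => ∑ᶠ ij : ℕ × ℤ, F ij.1 ij.2 *
    (zLax y a ^ ((if pic = Picture.kp then (ij.1 : ℤ) else 0) + sg a * ij.2) *
      mOrlov σ x pic y a ^ ij.1).coeff r

end Classical

section Limits

variable (A : ℝ → TodaData N D) (n₀ : ℤ) (σ : Idx N → ℕ → ℝ → Slow N D → ℂ) (x : Slow N D)
  (pic : Picture) (a₀ : Idx N) (y : Idx N → LaurentSeries ℂ)

/-- `lim_{ε → 0} X(Ψ_a) / Ψ_a = G` at the slow point `x`, coefficientwise in `y`; here `X ε` is an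
operator in the shift `𝒯_a` (or `𝒯̄_a`) at the fast times `x.2 / ε`. -/
def TendstoRatio (X : ℝ → Op (Idx N → ℤ) ℂ) (a : Idx N) (G : LaurentSeries ℂ) : Prop :=
  ∀ r : ℤ, Tendsto (fun p : ℝ × (Idx N → ℤ) =>
      (waveRatio (vec pic a₀ a) (X p.1) ((A p.1).κ n₀ ((p.1 : ℂ)⁻¹ • x.2) a) a p.2).coeff r)
    (slowLim x.1) (𝓝 (G.coeff r))

/-- `H = [lim_{ε → 0} X(Ψ_a) / Ψ_a]_{z = z_a}`. -/
def HasDispLimit (X : ℝ → Op (Idx N → ℤ) ℂ) (a : Idx N) (H : LaurentSeries ℂ) : Prop :=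
  ∃ G : LaurentSeries ℂ, TendstoRatio A n₀ x pic a₀ X a G ∧ H = lsubst G (y a)

/-- The rational function `R` of `p` is `[lim_{ε → 0} X_+(Ψ_a) / Ψ_a]_{z = z_a}`. -/
def HasDispLimitPlus (X : ℝ → Op (Idx N → ℤ) ℂ) (a : Idx N) (R : RatFunc ℂ) : Prop :=
  HasDispLimit A n₀ x pic a₀ y (fun ε => plusOp pic a (X ε)) a (expand σ x pic a₀ a R)

/-- `F_a(ℳ_a, ℒ_a)` (or `F_a(ℳ̄_a, ℒ̄_a)`) at the slow times `x.2`, for all `ε`. -/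
def opF (F : ℝ → Idx N → ℕ → ℤ → ℂ) (a : Idx N) : ℝ → Op (Idx N → ℤ) ℂ := fun ε =>
  (A ε).scalarF n₀ ((ε : ℂ)⁻¹ • x.2) (vec pic a₀ a) (F ε a) a

/-- `ℒ_a^j` (or `ℒ̄_a^j`) at the slow times `x.2`, for all `ε`. -/
def opLpow (a : Idx N) (j : ℕ) : ℝ → Op (Idx N → ℤ) ℂ := fun ε =>
  Op.pow (vec pic a₀ a) ((A ε).scalarL n₀ ((ε : ℂ)⁻¹ • x.2) (vec pic a₀ a) a) j

end Limits

/-- The coefficients satisfy `F_{aij} = F_{aij,0} ε^i + O(ε^(i+1))`, and the series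
`∑ F_{aij} M^i L^j` make sense formally: only finitely many terms contribute to each power of the
shift, where `M` has order at most `D`. -/
structure Admissible (D : ℕ) (ε₀ : ℝ) (F : ℝ → Idx N → ℕ → ℤ → ℂ) (F₀ : Idx N → ℕ → ℤ → ℂ) :
    Prop where
  finite : ∀ (a : Idx N) (m : ℤ), {ij : ℕ × ℤ |
    (∃ ε ∈ Set.Ioo 0 ε₀, F ε a ij.1 ij.2 ≠ 0) ∧ m ≤ D * ij.1 + ij.2}.Finite
  expansion : ∀ a i j, (fun ε : ℝ => F ε a i j - F₀ a i j * (ε : ℂ) ^ i) =O[𝓝[>] 0]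
    fun ε : ℝ => ε ^ (i + 1)

end Scalar

end Whitham

end

open Whitham

/-! Fix `ε` and the parameters `(s, t)`, and divide every function of `z` by the elementary factor
of the wave functions. A tuple `(u_c)` of Laurent series, one for each index in `𝒮`, is the same as
a row bounded above in `Λ` (unbarred components) together with a row bounded below (barred
components). The tuples with `r S⁻¹ = r̄ S̄⁻¹` (`InGr`) form a linear space, the formal version of
the point of the Grassmannian given by `g`. It is transversal: if all `u_c` are free of poles and
`u_1` also vanishes at `y = 0`, then the left side has only negative powers of `Λ` and the right
side only nonnegative ones, so both vanish and `u = 0` (`InGr.eq_zero`). A member is therefore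
determined by its coefficients of negative degree and by the constant term of its component `1`.

Constancy of `g` in `s` and in `t` says that shifted wave functions and their time derivatives are
members (`inGr_shiftedWave`, `inGr_timeWave`). The string equation says that the tuple `F_c(ℳ_c,
ℒ_c) Ψ_c` is a member (`inGr_stringWave`). Powers `𝒯_b^j` with `j ≥ 0` create poles in component `b`
only, so a combination of shifted wave functions with the same principal parts can be read off, and
its coefficients are those of the projections `X_+`. The result is an exact identity at each `ε`
(`eq_sum_plus`). The term `-1` in the alternative Toda projection restores the constant term of
component `1`, because there `𝒯_b` with `b ≠ 1, 1̄` does not move `s_1`.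

Dividing by `Ψ_c` and letting `ε → 0`, a shift by `v` becomes `exp(∂_v 𝒮_{c,0})`, a slow time
derivative of `log Ψ_c` becomes `∂_t 𝒮_{c,0}`, and `ε ℳ_c` becomes `z ∂_z 𝒮_{c,0}`
(`lTendsto_shiftedWave`, `lTendsto_timeWave`, `lTendsto_orlovWave`). Transversality also gives an
exact relation between `T_(1,b)` and `∂/∂t_{11}` (`shiftedWave_first`). Its limit `exp((∂_{s_1} -
∂_{s_b}) 𝒮) = ∂_{t_{11}} 𝒮 - q_b` holds with the same constant at every puncture, so the symbols of
all shifts become the rational functions `Z_a(p)` (`FirstTimeRelation.lsubst_expdsS`). The three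
pictures differ by a translation of `p` and by the choice of shifts. The same relation shows that
the local parameter at a puncture has order one in `y`, so that `z_a` exists and is unique by
reversion of series.

Solutions are only given where the slow variables lie in `U`, so leading coefficients are invertible
only along finite stretches of a shift orbit. Identities between operators are accordingly proved
column by column inside a finite window. Each coefficient involves finitely many columns, and for
small `ε` these all lie in `U`. -/

namespace Whitham

set_option linter.unusedSectionVars false

/-! ## Laurent series: bounds and locally finite sums -/

/-- All coefficients of index less than `a` vanish. -/
def Below (f : LaurentSeries ℂ) (a : ℤ) : Prop := ∀ i < a, f.coeff i = 0

theorem Below.mono_le {f : LaurentSeries ℂ} {a b : ℤ} (h : Below f a) (hb : b ≤ a) : Below f b :=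
  fun i hi => h i (lt_of_lt_of_le hi hb)

theorem below_order (f : LaurentSeries ℂ) : Below f f.order := fun _ hi =>
  HahnSeries.coeff_eq_zero_of_lt_order hi

theorem Below.add {f g : LaurentSeries ℂ} {a : ℤ} (hf : Below f a) (hg : Below g a) :
    Below (f + g) a := fun i hi => by simp [hf i hi, hg i hi]

theorem Below.sub {f g : LaurentSeries ℂ} {a : ℤ} (hf : Below f a) (hg : Below g a) :
    Below (f - g) a := fun i hi => by simp [hf i hi, hg i hi]

theorem Below.smul {f : LaurentSeries ℂ} {a : ℤ} (c : ℂ) (hf : Below f a) : Below (c • f) a :=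
  fun i hi => by simp [hf i hi]

theorem below_sum {ι : Type*} (s : Finset ι) {f : ι → LaurentSeries ℂ} {a : ℤ}
    (h : ∀ i ∈ s, Below (f i) a) : Below (∑ i ∈ s, f i) a := fun r hr => by
  rw [HahnSeries.coeff_sum]
  exact Finset.sum_eq_zero fun i hi => h i hi r hr

theorem below_mono (k : ℤ) (c : ℂ) : Below (mono k c) k := fun i hi => by
  rw [mono, HahnSeries.coeff_single_of_ne hi.ne]

theorem below_ofPS (f : PowerSeries ℂ) : Below (ofPS f) 0 := fun i hi => by
  rw [ofPS, PowerSeries.coeff_coe, if_pos hi]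

/-- The range of summation depends only on lower bounds for the orders and not on the supports, so
products can be compared and passed to the limit term by term. -/
theorem coeff_mul_Icc {f g : LaurentSeries ℂ} {a b : ℤ} (hf : Below f a) (hg : Below g b) (r : ℤ) :
    (f * g).coeff r = ∑ i ∈ Finset.Icc a (r - b), f.coeff i * g.coeff (r - i) := by
  rw [HahnSeries.coeff_mul]
  refine Finset.sum_bij_ne_zero (fun ij _ _ => ij.1) ?_ ?_ ?_ ?_
  · rintro ⟨i, j⟩ h _
    simp only [Finset.mem_antidiagonal, HahnSeries.mem_support] at h
    obtain ⟨h1, h2, h3⟩ := h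
    have h4 : a ≤ i := by by_contra h; exact h1 (hf i (by omega))
    have h5 : b ≤ j := by by_contra h; exact h2 (hg j (by omega))
    simp only [Finset.mem_Icc]; omega
  · rintro ⟨i, j⟩ h _ ⟨i', j'⟩ h' _ h''
    simp only [Finset.mem_antidiagonal] at h h' h''
    ext <;> simp <;> omega
  · intro i hi hne
    refine ⟨(i, r - i), ?_, hne, rfl⟩
    simp only [Finset.mem_antidiagonal, HahnSeries.mem_support]
    exact ⟨left_ne_zero_of_mul hne, right_ne_zero_of_mul hne, by ring⟩
  · rintro ⟨i, j⟩ h _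
    simp only [Finset.mem_antidiagonal] at h
    have : j = r - i := by omega
    simp [this]

theorem Below.mul {f g : LaurentSeries ℂ} {a b : ℤ} (hf : Below f a) (hg : Below g b) :
    Below (f * g) (a + b) := fun r hr => by
  rw [coeff_mul_Icc hf hg, Finset.Icc_eq_empty (by omega), Finset.sum_empty]

theorem coeff_mul_lead {f g : LaurentSeries ℂ} {a b : ℤ} (hf : Below f a) (hg : Below g b) :
    (f * g).coeff (a + b) = f.coeff a * g.coeff b := by
  rw [coeff_mul_Icc hf hg]
  simp

theorem below_one : Below 1 0 := fun i hi => by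
  rw [HahnSeries.coeff_one, if_neg hi.ne]

theorem Below.pow {f : LaurentSeries ℂ} {a : ℤ} (hf : Below f a) (n : ℕ) :
    Below (f ^ n) (n * a) := by
  induction n with
  | zero => simpa using below_one
  | succ n ih => rw [pow_succ]; convert ih.mul hf using 1; push_cast; ring

/-- `f = c w^a + ⋯` with `c ≠ 0`. -/
def HasOrd (f : LaurentSeries ℂ) (a : ℤ) : Prop := Below f a ∧ f.coeff a ≠ 0

theorem HasOrd.ne_zero {f : LaurentSeries ℂ} {a : ℤ} (h : HasOrd f a) : f ≠ 0 := by
  rintro rfl; exact h.2 rfl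

theorem HasOrd.order_eq {f : LaurentSeries ℂ} {a : ℤ} (h : HasOrd f a) : f.order = a := by
  apply le_antisymm (HahnSeries.order_le_of_coeff_ne_zero h.2)
  by_contra hlt
  have := h.1 f.order (by omega)
  rw [HahnSeries.coeff_order_eq_zero] at this
  exact h.ne_zero this

theorem hasOrd_order {f : LaurentSeries ℂ} (h : f ≠ 0) : HasOrd f f.order :=
  ⟨below_order f, fun h' => h (HahnSeries.coeff_order_eq_zero.1 h')⟩

theorem HasOrd.mul {f g : LaurentSeries ℂ} {a b : ℤ} (hf : HasOrd f a) (hg : HasOrd g b) :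
    HasOrd (f * g) (a + b) :=
  ⟨hf.1.mul hg.1, by rw [coeff_mul_lead hf.1 hg.1]; exact mul_ne_zero hf.2 hg.2⟩

theorem hasOrd_one : HasOrd 1 0 := ⟨below_one, by simp⟩

theorem HasOrd.pow {f : LaurentSeries ℂ} {a : ℤ} (hf : HasOrd f a) (n : ℕ) :
    HasOrd (f ^ n) (n * a) := by
  induction n with
  | zero => simpa using hasOrd_one
  | succ n ih => rw [pow_succ]; convert ih.mul hf using 1; push_cast; ring

theorem HasOrd.inv {f : LaurentSeries ℂ} {a : ℤ} (hf : HasOrd f a) : HasOrd f⁻¹ (-a) := by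
  have h := hasOrd_order (inv_ne_zero hf.ne_zero)
  have h2 := (hf.mul h).order_eq
  rw [mul_inv_cancel₀ hf.ne_zero, hasOrd_one.order_eq] at h2
  have : f⁻¹.order = -a := by omega
  rwa [this] at h

theorem HasOrd.zpow {f : LaurentSeries ℂ} {a : ℤ} (hf : HasOrd f a) (n : ℤ) :
    HasOrd (f ^ n) (n * a) := by
  obtain ⟨k, rfl | rfl⟩ := n.eq_nat_or_neg
  · simpa using hf.pow k
  · simpa using (hf.pow k).inv

theorem mono_mul (j k : ℤ) (c d : ℂ) : mono j c * mono k d = mono (j + k) (c * d) := by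
  simp [mono]

theorem mono_zero_mul_mono_zero (c d : ℂ) : mono 0 c * mono 0 d = mono 0 (c * d) := by
  rw [mono_mul, add_zero]

theorem mono_zero_one : mono 0 1 = 1 := rfl

theorem coeff_mono (k : ℤ) (c : ℂ) (r : ℤ) : (mono k c).coeff r = if r = k then c else 0 := by
  rw [mono, HahnSeries.coeff_single]; split_ifs <;> rfl

theorem coeff_mono_mul (k : ℤ) (c : ℂ) (f : LaurentSeries ℂ) (r : ℤ) :
    (mono k c * f).coeff r = c * f.coeff (r - k) := by
  rw [mono, HahnSeries.coeff_single_mul]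

theorem smul_eq_mono_mul (c : ℂ) (f : LaurentSeries ℂ) : c • f = mono 0 c * f := by
  ext r; rw [coeff_mono_mul]; simp

theorem mono_smul (k : ℤ) (c : ℂ) : mono k c = c • mono k 1 := by
  ext r; simp [coeff_mono]

theorem mono_pow (k : ℤ) (n : ℕ) : mono k 1 ^ n = mono (n * k) 1 := by
  induction n with
  | zero => simp [mono_zero_one]
  | succ n ih => rw [pow_succ, ih, mono_mul]; push_cast; ring_nf

theorem mono_inv (k : ℤ) : (mono k 1)⁻¹ = mono (-k) 1 := by
  apply inv_eq_of_mul_eq_one_right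
  rw [mono_mul]; simp [mono_zero_one]

theorem mono_zpow (k : ℤ) (n : ℤ) : mono k 1 ^ n = mono (n * k) 1 := by
  obtain ⟨m, rfl | rfl⟩ := n.eq_nat_or_neg
  · simpa using mono_pow k m
  · rw [zpow_neg, zpow_natCast, mono_pow, mono_inv]; congr 1; ring

theorem coeff_ofPS (f : PowerSeries ℂ) (r : ℤ) :
    (ofPS f).coeff r = if 0 ≤ r then PowerSeries.coeff r.toNat f else 0 := by
  rw [ofPS, PowerSeries.coeff_coe]
  split_ifs with h1 h2 h2
  · omega
  · rfl
  · congr 1; congr 1; omega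
  · omega

theorem ofPS_mul (f g : PowerSeries ℂ) : ofPS (f * g) = ofPS f * ofPS g := by simp [ofPS]
theorem ofPS_one : ofPS 1 = 1 := by simp [ofPS]

theorem toLaurent_coeff {u : ℤ → ℂ} {a : ℤ} (h : ∀ i < a, u i = 0) : (toLaurent u).coeff = u := by
  have hb : BddBelow (Function.support u) := ⟨a, fun i hi => by
    by_contra hlt
    exact hi (h i (by omega))⟩
  rw [toLaurent, dif_pos hb, HahnSeries.coeff_ofSuppBddBelow]

theorem toLaurent_of_coeff (f : LaurentSeries ℂ) : toLaurent f.coeff = f := by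
  ext r
  rw [toLaurent_coeff (below_order f)]

/-- `G` is the sum of the locally finite family `u`. -/
def HasLSum {ι : Type*} (u : ι → LaurentSeries ℂ) (G : LaurentSeries ℂ) : Prop :=
  (∃ a, ∀ i, Below (u i) a) ∧ ∀ r, {i | (u i).coeff r ≠ 0}.Finite ∧
    G.coeff r = ∑ᶠ i, (u i).coeff r

theorem HasLSum.unique {ι : Type*} {u : ι → LaurentSeries ℂ} {G G' : LaurentSeries ℂ}
    (h : HasLSum u G) (h' : HasLSum u G') : G = G' := by
  ext r
  rw [(h.2 r).2, (h'.2 r).2]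

theorem HasLSum.below {ι : Type*} {u : ι → LaurentSeries ℂ} {G : LaurentSeries ℂ}
    (h : HasLSum u G) {a : ℤ} (ha : ∀ i, Below (u i) a) : Below G a := fun r hr => by
  rw [(h.2 r).2]
  simp [ha _ r hr]

theorem HasLSum.toLaurent_eq {ι : Type*} {u : ι → LaurentSeries ℂ} {G : LaurentSeries ℂ}
    (h : HasLSum u G) : toLaurent (fun r => ∑ᶠ i, (u i).coeff r) = G := by
  rw [← toLaurent_of_coeff G]
  congr 1
  funext r
  rw [(h.2 r).2]

theorem hasLSum_toLaurent {ι : Type*} {u : ι → LaurentSeries ℂ} {a : ℤ}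
    (ha : ∀ i, Below (u i) a) (hf : ∀ r, {i | (u i).coeff r ≠ 0}.Finite) :
    HasLSum u (toLaurent fun r => ∑ᶠ i, (u i).coeff r) := by
  refine ⟨⟨a, ha⟩, fun r => ⟨hf r, ?_⟩⟩
  rw [toLaurent_coeff (a := a)]
  intro i hi
  simp [ha _ i hi]

theorem HasLSum.comp_equiv {ι κ : Type*} {u : ι → LaurentSeries ℂ} {G : LaurentSeries ℂ}
    (h : HasLSum u G) (e : κ ≃ ι) : HasLSum (fun k => u (e k)) G := by
  obtain ⟨⟨a, ha⟩, h2⟩ := h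
  refine ⟨⟨a, fun k => ha _⟩, fun r => ⟨?_, ?_⟩⟩
  · exact (h2 r).1.preimage (f := e) e.injective.injOn
  · rw [(h2 r).2]
    exact (finsum_comp_equiv e (f := fun i => (u i).coeff r)).symm

theorem HasLSum.mul_left {ι : Type*} {u : ι → LaurentSeries ℂ} {G : LaurentSeries ℂ}
    (h : HasLSum u G) (f : LaurentSeries ℂ) : HasLSum (fun i => f * u i) (f * G) := by
  obtain ⟨⟨a, ha⟩, h2⟩ := h
  have hG : Below G a := HasLSum.below ⟨⟨a, ha⟩, h2⟩ ha
  have hf := below_order f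
  refine ⟨⟨f.order + a, fun i => hf.mul (ha i)⟩, fun r => ?_⟩
  have hfin : ∀ k ∈ Finset.Icc f.order (r - a),
      Function.HasFiniteSupport fun i => f.coeff k * (u i).coeff (r - k) := fun k _ =>
    (h2 (r - k)).1.subset fun i hi => right_ne_zero_of_mul hi
  constructor
  · refine ((Finset.Icc f.order (r - a)).finite_toSet.biUnion
      fun k _ => (h2 (r - k)).1).subset fun i hi => ?_
    simp only [Set.mem_ofPred_eq, coeff_mul_Icc hf (ha i)] at hi
    obtain ⟨k, hk, hne⟩ := Finset.exists_ne_zero_of_sum_ne_zero hi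
    exact Set.mem_biUnion hk (right_ne_zero_of_mul hne)
  · rw [coeff_mul_Icc hf hG]
    simp only [coeff_mul_Icc hf (ha _)]
    rw [finsum_sum_comm _ _ hfin]
    refine Finset.sum_congr rfl fun k _ => ?_
    rw [(h2 _).2, mul_finsum]

theorem HasLSum.smul_mono (f : LaurentSeries ℂ) : HasLSum (fun j : ℤ => mono j (f.coeff j)) f := by
  refine ⟨⟨f.order, fun j i hi => ?_⟩, fun r => ⟨?_, ?_⟩⟩
  · rw [coeff_mono]
    split_ifs with h
    · rw [← h]; exact below_order f i hi
    · rfl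
  · refine (Set.finite_singleton r).subset fun j hj => ?_
    simp only [Set.mem_ofPred_eq, coeff_mono] at hj
    by_contra h
    exact hj (if_neg fun h' => h h'.symm)
  · rw [finsum_eq_single _ r]
    · simp [coeff_mono]
    · intro j hj
      rw [coeff_mono, if_neg hj.symm]

/-! ## Substitution -/

section Subst

variable {y : LaurentSeries ℂ}

theorem HasOrd.of_pos_order (hy : 0 < y.order) : HasOrd y y.order :=
  hasOrd_order (by rintro rfl; simp at hy)

/-- The absolute value forces `j` to be positive, and then `y ^ j` starts in degree at least `j`.
The cutoff does not depend on the order of `y`. -/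
theorem zpow_coeff_eq_zero (hy : 0 < y.order) {j r : ℤ} (h : |r| < j) : (y ^ j).coeff r = 0 := by
  refine ((HasOrd.of_pos_order hy).zpow j).1 r ?_
  have : r ≤ |r| := le_abs_self r
  have : 0 ≤ |r| := abs_nonneg r
  nlinarith

theorem hasLSum_laurentSum (hy : 0 < y.order) {c : ℤ → ℂ} {a : ℤ} (hc : ∀ j < a, c j = 0) :
    HasLSum (fun j : ℤ => c j • y ^ j) (laurentSum c y) := by
  refine hasLSum_toLaurent (a := a * y.order) (fun j r hr => ?_) (fun r => ?_)
  · rcases lt_or_ge j a with h | h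
    · simp [hc j h]
    · have : (y ^ j).coeff r = 0 := ((HasOrd.of_pos_order hy).zpow j).1 r (by nlinarith)
      simp [this]
  · refine (Finset.Icc a |r|).finite_toSet.subset fun j hj => ?_
    simp only [Set.mem_ofPred_eq, HahnSeries.coeff_smul, smul_eq_mul] at hj
    simp only [Finset.coe_Icc, Set.mem_Icc]
    constructor
    · by_contra h
      exact left_ne_zero_of_mul hj (hc j (by omega))
    · by_contra h
      exact right_ne_zero_of_mul hj (zpow_coeff_eq_zero hy (by omega))

theorem hasLSum_lsubst (hy : 0 < y.order) (f : LaurentSeries ℂ) :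
    HasLSum (fun j : ℤ => f.coeff j • y ^ j) (lsubst f y) :=
  hasLSum_laurentSum hy (below_order f)

theorem Below.lsubst (hy : 0 < y.order) {f : LaurentSeries ℂ} {a : ℤ} (hf : Below f a) :
    Below (lsubst f y) (a * y.order) := by
  refine (hasLSum_lsubst hy f).below fun j r hr => ?_
  rcases lt_or_ge j a with h | h
  · simp [hf j h]
  · have : (y ^ j).coeff r = 0 := ((HasOrd.of_pos_order hy).zpow j).1 r (by nlinarith)
    simp [this]

theorem coeff_lsubst (hy : 0 < y.order) {f : LaurentSeries ℂ} {a : ℤ} (hf : Below f a) (r : ℤ) :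
    (lsubst f y).coeff r = ∑ j ∈ Finset.Icc a |r|, f.coeff j * (y ^ j).coeff r := by
  rw [((hasLSum_lsubst hy f).2 r).2]
  rw [finsum_eq_sum_of_support_subset]
  · rfl
  · intro j hj
    simp only [Function.mem_support, HahnSeries.coeff_smul, smul_eq_mul] at hj
    simp only [Finset.coe_Icc, Set.mem_Icc]
    constructor
    · by_contra h
      exact left_ne_zero_of_mul hj (hf j (by omega))
    · by_contra h
      exact right_ne_zero_of_mul hj (zpow_coeff_eq_zero hy (by omega))

theorem HasLSum.lsubst (hy : 0 < y.order) {ι : Type*} {u : ι → LaurentSeries ℂ}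
    {G : LaurentSeries ℂ} (h : HasLSum u G) :
    HasLSum (fun i => Whitham.lsubst (u i) y) (Whitham.lsubst G y) := by
  obtain ⟨⟨a, ha⟩, h2⟩ := h
  have hG : Below G a := HasLSum.below ⟨⟨a, ha⟩, h2⟩ ha
  refine ⟨⟨a * y.order, fun i => (ha i).lsubst hy⟩, fun r => ?_⟩
  have hfin : ∀ k ∈ Finset.Icc a |r|,
      Function.HasFiniteSupport fun i => (u i).coeff k * (y ^ k).coeff r := fun k _ =>
    (h2 k).1.subset fun i hi => left_ne_zero_of_mul hi
  constructor
  · refine ((Finset.Icc a |r|).finite_toSet.biUnion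
      fun k _ => (h2 k).1).subset fun i hi => ?_
    simp only [Set.mem_ofPred_eq, coeff_lsubst hy (ha i)] at hi
    obtain ⟨k, hk, hne⟩ := Finset.exists_ne_zero_of_sum_ne_zero hi
    exact Set.mem_biUnion hk (left_ne_zero_of_mul hne)
  · rw [coeff_lsubst hy hG]
    simp only [coeff_lsubst hy (ha _)]
    rw [finsum_sum_comm _ _ hfin]
    refine Finset.sum_congr rfl fun k _ => ?_
    rw [(h2 _).2, finsum_mul]

theorem lsubst_add (hy : 0 < y.order) (f g : LaurentSeries ℂ) :
    lsubst (f + g) y = lsubst f y + lsubst g y := by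
  have hf := (below_order f).mono_le (min_le_left f.order g.order)
  have hg := (below_order g).mono_le (min_le_right f.order g.order)
  ext r
  rw [HahnSeries.coeff_add, coeff_lsubst hy hf, coeff_lsubst hy hg, coeff_lsubst hy (hf.add hg),
    ← Finset.sum_add_distrib]
  exact Finset.sum_congr rfl fun j _ => by simp [add_mul]

theorem lsubst_mono (hy : 0 < y.order) (k : ℤ) (c : ℂ) : lsubst (mono k c) y = c • y ^ k := by
  ext r
  rw [((hasLSum_lsubst hy _).2 r).2, finsum_eq_single _ k]
  · simp [coeff_mono]
  · intro j hj
    simp [coeff_mono, hj]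

theorem lsubst_mono_mul (hy : 0 < y.order) (k : ℤ) (c : ℂ) (f : LaurentSeries ℂ) :
    lsubst (mono k c * f) y = (c • y ^ k) * lsubst f y := by
  have h1 := (hasLSum_lsubst hy (mono k c * f)).comp_equiv (Equiv.addRight k)
  have h2 := (hasLSum_lsubst hy f).mul_left (c • y ^ k)
  refine h1.unique ?_
  convert h2 using 2 with j
  simp only [Equiv.coe_addRight, coeff_mono_mul, add_sub_cancel_right]
  rw [zpow_add₀ (HasOrd.of_pos_order hy).ne_zero]
  simp only [smul_eq_mono_mul, ← mono_zero_mul_mono_zero]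
  ring

/-- Both sides are compatible with locally finite sums in `f`, so it is enough to take `f` a
monomial. -/
theorem lsubst_mul (hy : 0 < y.order) (f g : LaurentSeries ℂ) :
    lsubst (f * g) y = lsubst f y * lsubst g y := by
  have h1 := ((HasLSum.smul_mono f).mul_left g).lsubst hy
  have h2 := (hasLSum_lsubst hy f).mul_left (lsubst g y)
  rw [mul_comm f, mul_comm (lsubst f y)]
  refine h1.unique ?_
  convert h2 using 2 with j
  rw [mul_comm g, lsubst_mono_mul hy, mul_comm]

/-- Substitution as a ring homomorphism. -/
noncomputable def lsubstHom (hy : 0 < y.order) : LaurentSeries ℂ →+* LaurentSeries ℂ where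
  toFun f := lsubst f y
  map_one' := by rw [← mono_zero_one, lsubst_mono hy]; simp [mono_zero_one]
  map_mul' := lsubst_mul hy
  map_zero' := by
    have := lsubst_add hy 0 0
    simpa using this
  map_add' := lsubst_add hy

@[simp] theorem lsubstHom_apply (hy : 0 < y.order) (f : LaurentSeries ℂ) :
    lsubstHom hy f = lsubst f y := rfl

theorem lsubst_smul (hy : 0 < y.order) (c : ℂ) (f : LaurentSeries ℂ) :
    lsubst (c • f) y = c • lsubst f y := by
  rw [smul_eq_mono_mul, lsubst_mono_mul hy, zpow_zero, smul_eq_mono_mul, smul_eq_mono_mul, mul_one]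

theorem lsubst_C (hy : 0 < y.order) (c : ℂ) : lsubst (mono 0 c) y = mono 0 c := by
  rw [lsubst_mono hy, zpow_zero, ← mono_zero_one, mono_smul 0 c]

theorem lsubst_zpow (hy : 0 < y.order) (f : LaurentSeries ℂ) (n : ℤ) :
    lsubst (f ^ n) y = lsubst f y ^ n := map_zpow₀ (lsubstHom hy) f n

theorem lsubst_inv (hy : 0 < y.order) (f : LaurentSeries ℂ) :
    lsubst f⁻¹ y = (lsubst f y)⁻¹ := map_inv₀ (lsubstHom hy) f

theorem HasOrd.lsubst (hy : 0 < y.order) {f : LaurentSeries ℂ} {a : ℤ} (hf : HasOrd f a) :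
    HasOrd (lsubst f y) (a * y.order) := by
  refine ⟨hf.1.lsubst hy, ?_⟩
  have h2 := (HasOrd.of_pos_order hy).zpow a
  rw [((hasLSum_lsubst hy f).2 _).2, finsum_eq_single _ a]
  · simpa using ⟨hf.2, h2.2⟩
  · intro j hj
    rcases lt_or_gt_of_ne hj with h | h
    · simp [hf.1 j h]
    · have := ((HasOrd.of_pos_order hy).zpow j).1 (a * y.order) (by nlinarith)
      simp [this]

theorem lsubst_lsubst {g : LaurentSeries ℂ} (hy : 0 < y.order) (hg : 0 < g.order)
    (f : LaurentSeries ℂ) : lsubst (lsubst f g) y = lsubst f (lsubst g y) := by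
  have h1 := (hasLSum_lsubst hg f).lsubst hy
  have h : 0 < (lsubst g y).order := by
    rw [((HasOrd.of_pos_order hg).lsubst hy).order_eq]
    positivity
  refine h1.unique ?_
  convert hasLSum_lsubst h f using 2 with j
  rw [lsubst_smul hy, lsubst_zpow hy]

theorem lsubst_self (f : LaurentSeries ℂ) : lsubst f (mono 1 1) = f := by
  have h : 0 < (mono 1 (1 : ℂ)).order := by
    rw [mono, HahnSeries.order_single one_ne_zero]; exact one_pos
  refine (hasLSum_lsubst h f).unique ?_
  convert HasLSum.smul_mono f using 2 with j
  rw [mono_zpow, mono_smul j (f.coeff j), mul_one]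

/-- Series in descending powers of `Z`, where `Z` has a pole, become ordinary substitutions into
`Z⁻¹`. -/
theorem laurentSum_inv (c : ℤ → ℂ) (Z : LaurentSeries ℂ) :
    laurentSum c Z = laurentSum (fun j => c (-j)) Z⁻¹ := by
  rw [laurentSum, laurentSum]
  congr 1
  funext r
  rw [← finsum_comp_equiv (Equiv.neg ℤ)]
  refine finsum_congr fun j => ?_
  simp

end Subst

/-! ## Compositional inverses -/

/-- The coefficients of the left compositional inverse of a Laurent series of order one. -/
noncomputable def revCoeff (g : LaurentSeries ℂ) : ℕ → ℂ
  | m => ((if m = 1 then 1 else 0) - ∑ i : Fin m, revCoeff g i * (g ^ (i : ℕ)).coeff m) /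
      (g ^ m).coeff m
termination_by m => m
decreasing_by exact i.2

/-- The equations for the coefficients of `f` are triangular: `g ^ m` starts in degree `m` with a
nonzero coefficient, so degree `m` determines the `m`-th coefficient of `f`. -/
theorem exists_left_inverse {g : LaurentSeries ℂ} (hg : HasOrd g 1) :
    ∃ f, HasOrd f 1 ∧ lsubst f g = mono 1 1 := by
  have hg0 : 0 < g.order := by rw [hg.order_eq]; exact one_pos
  have hrec : ∀ m : ℕ, ∑ i ∈ Finset.range (m + 1), revCoeff g i * (g ^ i).coeff m =
      if m = 1 then 1 else 0 := by
    intro m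
    have hne : (g ^ m).coeff m ≠ 0 := by simpa using (hg.pow m).2
    rw [Finset.sum_range_succ, revCoeff, div_mul_cancel₀ _ hne,
      ← Fin.sum_univ_eq_sum_range (fun i => revCoeff g i * (g ^ i).coeff m)]
    ring
  set f := ofPS (PowerSeries.mk (revCoeff g)) with hf
  have hfc : ∀ i : ℕ, f.coeff i = revCoeff g i := fun i => by simp [hf, coeff_ofPS]
  have hfg : lsubst f g = mono 1 1 := by
    ext r
    rcases lt_or_ge r 0 with hr | hr
    · rw [(below_ofPS _).lsubst hg0 r (by simpa using hr), coeff_mono, if_neg (by omega)]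
    · lift r to ℕ using hr
      rw [coeff_lsubst hg0 (below_ofPS _), coeff_mono]
      have := hrec r
      rw [show ((if (r : ℤ) = 1 then (1 : ℂ) else 0)) = if r = 1 then 1 else 0 by norm_cast,
        ← this]
      rw [Nat.abs_cast]
      refine (Finset.sum_nbij (fun i : ℕ => (i : ℤ)) ?_ ?_ ?_ ?_).symm
      · intro i hi; simp at hi ⊢; omega
      · intro i _ j _ h; simpa using h
      · intro i hi
        simp only [Finset.coe_Icc, Set.mem_Icc] at hi
        exact ⟨i.toNat, by simp; omega, by simp; omega⟩
      · intro i _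
        rw [hfc, zpow_natCast]
  refine ⟨f, ?_, hfg⟩
  have hne : f ≠ 0 := by
    intro h0
    have := map_zero (lsubstHom hg0)
    rw [lsubstHom_apply, ← h0, hfg, h0] at this
    have h2 := congrArg (fun f => f.coeff 1) this
    simp [coeff_mono] at h2
  -- Orders multiply under substitution, so `f(g) = w` together with order one for `g` forces order
  -- one for `f`.
  have h1 := ((hasOrd_order hne).lsubst hg0).order_eq
  rw [hfg, hg.order_eq, mono, HahnSeries.order_single one_ne_zero, mul_one] at h1
  rw [h1]
  exact hasOrd_order hne

theorem existsUnique_right_inverse {g : LaurentSeries ℂ} (hg : HasOrd g 1) :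
    ∃! y : LaurentSeries ℂ, 0 < y.order ∧ lsubst g y = mono 1 1 := by
  have hg0 : 0 < g.order := by rw [hg.order_eq]; exact one_pos
  obtain ⟨f, hf, hfg⟩ := exists_left_inverse hg
  have hf0 : 0 < f.order := by rw [hf.order_eq]; exact one_pos
  obtain ⟨e, he, hef⟩ := exists_left_inverse hf
  have hX : ∀ h : LaurentSeries ℂ, 0 < h.order → lsubst (mono 1 1) h = h := fun h hh => by
    rw [lsubst_mono hh]; simp
  refine ⟨f, ⟨hf0, ?_⟩, fun y ⟨hy, hgy⟩ => ?_⟩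
  -- Evaluating `e ∘ f ∘ g` in two ways gives `e = g`, so the left inverse `f` of `g` is also a
  -- right inverse.
  · have : lsubst e (lsubst f g) = lsubst (mono 1 1) g := by rw [← lsubst_lsubst hg0 hf0, hef]
    rw [hfg, hX g hg0, lsubst_self] at this
    rw [← this, hef]
  · have : lsubst f (lsubst g y) = lsubst (mono 1 1) y := by rw [← lsubst_lsubst hy hg0, hfg]
    rw [hgy, lsubst_self, hX y hy] at this
    exact this.symm

/-! ## The exponential of a formal power series -/

section Exp

open PowerSeries

theorem coeff_pow_eq_zero_of_lt {h : PowerSeries ℂ} (h0 : coeff 0 h = 0) {m r : ℕ} (hr : m < r) :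
    coeff m (h ^ r) = 0 := by
  have hX : (X : PowerSeries ℂ) ∣ h := X_dvd_iff.2 (by simpa using h0)
  exact X_pow_dvd_iff.1 (pow_dvd_pow_of_dvd hX r) m hr

theorem coeff_zero_mul_eq (f g : PowerSeries ℂ) : coeff 0 (f * g) = coeff 0 f * coeff 0 g := by
  simp

theorem coeff_zero_expSeries (f : PowerSeries ℂ) :
    coeff 0 (expSeries f) = Complex.exp (coeff 0 f) := by
  simp [expSeries]

/-- Up to a given degree the exponential is a polynomial in the part of `f` without constant term.
The algebra of derivations then applies to finite sums. -/
theorem coeff_expSeries_trunc (f : PowerSeries ℂ) {m M : ℕ} (hm : m ≤ M) :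
    coeff m (expSeries f) = coeff m (C (Complex.exp (coeff 0 f)) *
      ∑ r ∈ Finset.range (M + 1), C ((r.factorial : ℂ)⁻¹) * (f - C (coeff 0 f)) ^ r) := by
  have h0 : coeff 0 (f - C (coeff 0 f)) = 0 := by simp
  rw [expSeries, coeff_mk, coeff_C_mul, map_sum]
  congr 1
  rw [← Finset.sum_subset (Finset.range_mono (Nat.succ_le_succ hm))]
  · refine Finset.sum_congr rfl fun r _ => ?_
    rw [coeff_C_mul, div_eq_inv_mul]
  · intro r _ hr
    rw [coeff_C_mul, coeff_pow_eq_zero_of_lt h0 (by simpa using hr), mul_zero]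

theorem derivative_expSeries (f : PowerSeries ℂ) :
    derivative ℂ (expSeries f) = derivative ℂ f * expSeries f := by
  set h := f - C (coeff 0 f) with hh
  have hd : derivative ℂ h = derivative ℂ f := by
    rw [hh, map_sub, derivative_C, sub_zero]
  have hT : ∀ M : ℕ, derivative ℂ (C (Complex.exp (coeff 0 f)) *
      ∑ r ∈ Finset.range (M + 1 + 1), C ((r.factorial : ℂ)⁻¹) * h ^ r) =
      derivative ℂ f * (C (Complex.exp (coeff 0 f)) *
      ∑ r ∈ Finset.range (M + 1), C ((r.factorial : ℂ)⁻¹) * h ^ r) := by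
    intro M
    rw [Derivation.leibniz, derivative_C, smul_zero, add_zero, map_sum, Finset.sum_range_succ']
    have h1 : ∀ r : ℕ, derivative ℂ (C (((r + 1).factorial : ℂ)⁻¹) * h ^ (r + 1)) =
        derivative ℂ f * (C ((r.factorial : ℂ)⁻¹) * h ^ r) := by
      intro r
      rw [Derivation.leibniz, derivative_C, smul_zero, add_zero, Derivation.leibniz_pow, hd,
        Nat.add_sub_cancel]
      have : ((r + 1).factorial : ℂ)⁻¹ * (r + 1) = (r.factorial : ℂ)⁻¹ := by
        rw [Nat.factorial_succ]; push_cast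
        have : (r : ℂ) + 1 ≠ 0 := by exact_mod_cast r.succ_ne_zero
        field_simp
      rw [← this, map_mul, map_add, map_one, map_natCast]
      simp only [smul_eq_mul, nsmul_eq_mul]
      push_cast
      ring
    simp only [h1]
    rw [← Finset.mul_sum]
    simp only [pow_zero, mul_one, derivative_C, add_zero, smul_eq_mul]
    ring
  ext m
  have e1 : coeff m (derivative ℂ (expSeries f)) = coeff m (derivative ℂ
      (C (Complex.exp (coeff 0 f)) *
      ∑ r ∈ Finset.range (m + 1 + 1), C ((r.factorial : ℂ)⁻¹) * h ^ r)) := by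
    rw [coeff_derivative, coeff_derivative, coeff_expSeries_trunc f (le_refl (m + 1))]
  rw [e1, hT, coeff_mul, coeff_mul]
  refine Finset.sum_congr rfl fun ij hij => ?_
  rw [coeff_expSeries_trunc f (M := m) (by rw [Finset.HasAntidiagonal.mem_antidiagonal] at hij; omega)]

theorem coeff_succ_expSeries (f : PowerSeries ℂ) (m : ℕ) :
    coeff (m + 1) (expSeries f) = (∑ ij ∈ Finset.HasAntidiagonal.antidiagonal m,
      coeff (ij.1 + 1) f * (ij.1 + 1) * coeff ij.2 (expSeries f)) / (m + 1) := by
  have hm : (m : ℂ) + 1 ≠ 0 := by exact_mod_cast m.succ_ne_zero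
  rw [eq_div_iff hm, ← coeff_derivative, derivative_expSeries, coeff_mul]
  refine Finset.sum_congr rfl fun ij _ => ?_
  rw [coeff_derivative]

/-- A linear differential equation `E' = g E` determines each coefficient from the preceding ones
and the constant term; functional equations of the exponential reduce to this. -/
theorem eq_of_derivative_eq_mul {g E E' : PowerSeries ℂ} (h : derivative ℂ E = g * E)
    (h' : derivative ℂ E' = g * E') (h0 : coeff 0 E = coeff 0 E') : E = E' := by
  ext m
  induction m using Nat.strong_induction_on with
  | _ m ih =>
    cases m with
    | zero => exact h0
    | succ m =>
      have hm : (m : ℂ) + 1 ≠ 0 := by exact_mod_cast m.succ_ne_zero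
      apply mul_right_cancel₀ hm
      rw [← coeff_derivative, ← coeff_derivative, h, h', coeff_mul, coeff_mul]
      refine Finset.sum_congr rfl fun ij hij => ?_
      rw [ih ij.2 (by rw [Finset.HasAntidiagonal.mem_antidiagonal] at hij; omega)]

theorem expSeries_add (f g : PowerSeries ℂ) :
    expSeries (f + g) = expSeries f * expSeries g := by
  refine eq_of_derivative_eq_mul (derivative_expSeries _) ?_ ?_
  · rw [Derivation.leibniz, derivative_expSeries, derivative_expSeries, map_add]
    simp only [smul_eq_mul]
    ring
  · rw [coeff_zero_mul_eq, coeff_zero_expSeries, coeff_zero_expSeries,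
      coeff_zero_expSeries, map_add, Complex.exp_add]

theorem expSeries_zero : expSeries 0 = 1 := by
  refine eq_of_derivative_eq_mul (derivative_expSeries _) ?_ ?_
  · simp
  · rw [coeff_zero_expSeries]; simp

theorem expSeries_mul_neg (f : PowerSeries ℂ) : expSeries f * expSeries (-f) = 1 := by
  rw [← expSeries_add, add_neg_cancel, expSeries_zero]

theorem hasOrd_expSeries (f : PowerSeries ℂ) : HasOrd (ofPS (expSeries f)) 0 :=
  ⟨below_ofPS _, by
    rw [coeff_ofPS, if_pos le_rfl, Int.toNat_zero, coeff_zero_expSeries]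
    exact Complex.exp_ne_zero _⟩

/-- The recursion for the coefficients of the exponential expresses each one polynomially through
earlier ones and coefficients of `f`, so continuity passes up by induction. -/
theorem tendsto_expSeries {ι : Type*} {l : Filter ι} {f : ι → PowerSeries ℂ} {f₀ : PowerSeries ℂ}
    (h : ∀ m, Tendsto (fun p => coeff m (f p)) l (𝓝 (coeff m f₀))) (m : ℕ) :
    Tendsto (fun p => coeff m (expSeries (f p))) l (𝓝 (coeff m (expSeries f₀))) := by
  induction m using Nat.strong_induction_on with
  | _ m ih =>
    cases m with
    | zero =>
      simp only [coeff_zero_expSeries]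
      exact (Complex.continuous_exp.tendsto _).comp (h 0)
    | succ m =>
      simp only [coeff_succ_expSeries]
      refine Tendsto.div_const (tendsto_finsetSum _ fun ij hij => ?_) _
      exact ((h _).mul_const _).mul (ih _ (by rw [Finset.HasAntidiagonal.mem_antidiagonal] at hij; omega))

/-- Differentiation in the parameter is carried through the same recursion. The right side satisfies
the differentiated recursion by the product rule for the formal derivative. -/
theorem hasDerivAt_expSeries {f : ℝ → PowerSeries ℂ} {f' : PowerSeries ℂ} {τ : ℝ}
    (h : ∀ m, HasDerivAt (fun u => coeff m (f u)) (coeff m f') τ) (m : ℕ) :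
    HasDerivAt (fun u => coeff m (expSeries (f u))) (coeff m (f' * expSeries (f τ))) τ := by
  induction m using Nat.strong_induction_on with
  | _ m ih =>
    cases m with
    | zero =>
      simp only [coeff_zero_expSeries, coeff_zero_mul_eq]
      rw [mul_comm]
      exact (h 0).cexp
    | succ m =>
      simp only [coeff_succ_expSeries]
      have hm : (m : ℂ) + 1 ≠ 0 := by exact_mod_cast m.succ_ne_zero
      have e : coeff (m + 1) (f' * expSeries (f τ)) = (∑ ij ∈ Finset.HasAntidiagonal.antidiagonal m,
          (coeff (ij.1 + 1) f' * (ij.1 + 1) * coeff ij.2 (expSeries (f τ)) +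
          coeff (ij.1 + 1) (f τ) * (ij.1 + 1) * coeff ij.2 (f' * expSeries (f τ)))) / (m + 1) := by
        rw [eq_div_iff hm, ← coeff_derivative, Derivation.leibniz, derivative_expSeries,
          Finset.sum_add_distrib]
        simp only [← coeff_derivative]
        rw [← coeff_mul, ← coeff_mul, ← map_add]
        congr 1
        simp only [smul_eq_mul]
        ring
      rw [e]
      refine HasDerivAt.div_const (HasDerivAt.fun_sum fun ij hij => ?_) _
      exact ((h _).mul_const _).mul (ih _ (by rw [Finset.HasAntidiagonal.mem_antidiagonal] at hij; omega))

theorem coeff_one_expSeries (f : PowerSeries ℂ) (h : coeff 0 f = 0) :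
    coeff 1 (expSeries f) = coeff 1 f := by
  have := coeff_succ_expSeries f 0
  simpa [coeff_zero_expSeries, h] using this

end Exp

/-! ## Coefficientwise limits of Laurent series -/

/-- Coefficientwise convergence with a uniform bound on the order of the poles. -/
def LTendsto {ι : Type*} (u : ι → LaurentSeries ℂ) (l : Filter ι) (G : LaurentSeries ℂ) : Prop :=
  (∃ a, Below G a ∧ ∀ᶠ p in l, Below (u p) a) ∧
    ∀ r, Tendsto (fun p => (u p).coeff r) l (𝓝 (G.coeff r))

section LTendsto

variable {ι : Type*} {l : Filter ι} {u v : ι → LaurentSeries ℂ} {G H : LaurentSeries ℂ}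

theorem LTendsto.congr' (h : LTendsto u l G) (huv : ∀ᶠ p in l, u p = v p) : LTendsto v l G := by
  obtain ⟨⟨a, ha, hu⟩, h2⟩ := h
  refine ⟨⟨a, ha, ?_⟩, fun r => (h2 r).congr' ?_⟩
  · filter_upwards [hu, huv] with p h1 h2
    rwa [← h2]
  · filter_upwards [huv] with p h1
    rw [h1]

theorem lTendsto_const (G : LaurentSeries ℂ) : LTendsto (fun _ : ι => G) l G :=
  ⟨⟨G.order, below_order G, Eventually.of_forall fun _ => below_order G⟩,
    fun _ => tendsto_const_nhds⟩

theorem LTendsto.add (h : LTendsto u l G) (h' : LTendsto v l H) :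
    LTendsto (fun p => u p + v p) l (G + H) := by
  obtain ⟨⟨a, ha, hu⟩, h2⟩ := h
  obtain ⟨⟨b, hb, hv⟩, h3⟩ := h'
  refine ⟨⟨min a b, (ha.mono_le (min_le_left _ _)).add (hb.mono_le (min_le_right _ _)), ?_⟩,
    fun r => by simpa using (h2 r).add (h3 r)⟩
  filter_upwards [hu, hv] with p h1 h2
  exact (h1.mono_le (min_le_left _ _)).add (h2.mono_le (min_le_right _ _))

/-- The common bound on the poles makes each coefficient of the product a finite sum of fixed
length. -/
theorem LTendsto.mul (h : LTendsto u l G) (h' : LTendsto v l H) :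
    LTendsto (fun p => u p * v p) l (G * H) := by
  obtain ⟨⟨a, ha, hu⟩, h2⟩ := h
  obtain ⟨⟨b, hb, hv⟩, h3⟩ := h'
  refine ⟨⟨a + b, ha.mul hb, ?_⟩, fun r => ?_⟩
  · filter_upwards [hu, hv] with p h1 h2
    exact h1.mul h2
  · rw [coeff_mul_Icc ha hb]
    refine (tendsto_finsetSum (Finset.Icc a (r - b))
      fun i _ => (h2 i).mul (h3 (r - i))).congr' ?_
    filter_upwards [hu, hv] with p h1 h2
    rw [coeff_mul_Icc h1 h2]

theorem lTendsto_sum {κ : Type*} (s : Finset κ) {u : κ → ι → LaurentSeries ℂ}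
    {G : κ → LaurentSeries ℂ} (h : ∀ k ∈ s, LTendsto (u k) l (G k)) :
    LTendsto (fun p => ∑ k ∈ s, u k p) l (∑ k ∈ s, G k) := by
  classical
  induction s using Finset.induction_on with
  | empty => simpa using lTendsto_const 0
  | insert k s hk ih =>
    simp only [Finset.sum_insert hk]
    exact (h k (Finset.mem_insert_self _ _)).add
      (ih fun j hj => h j (Finset.mem_insert_of_mem hj))

theorem lTendsto_mono (k : ℤ) {c : ι → ℂ} {c₀ : ℂ} (h : Tendsto c l (𝓝 c₀)) :
    LTendsto (fun p => mono k (c p)) l (mono k c₀) := by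
  refine ⟨⟨k, below_mono _ _, Eventually.of_forall fun _ => below_mono _ _⟩, fun r => ?_⟩
  simp only [coeff_mono]
  split_ifs
  · exact h
  · exact tendsto_const_nhds

theorem LTendsto.smul {c : ι → ℂ} {c₀ : ℂ} (h : Tendsto c l (𝓝 c₀)) (hu : LTendsto u l G) :
    LTendsto (fun p => c p • u p) l (c₀ • G) := by
  simp only [smul_eq_mono_mul]
  exact (lTendsto_mono 0 h).mul hu

theorem lTendsto_ofPS {f : ι → PowerSeries ℂ} {f₀ : PowerSeries ℂ}
    (h : ∀ m, Tendsto (fun p => PowerSeries.coeff m (f p)) l (𝓝 (PowerSeries.coeff m f₀))) :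
    LTendsto (fun p => ofPS (f p)) l (ofPS f₀) := by
  refine ⟨⟨0, below_ofPS _, Eventually.of_forall fun _ => below_ofPS _⟩, fun r => ?_⟩
  simp only [coeff_ofPS]
  split_ifs
  · exact h _
  · exact tendsto_const_nhds

theorem LTendsto.unique [l.NeBot] (h : LTendsto u l G) (h' : LTendsto u l H) : G = H := by
  ext r
  exact tendsto_nhds_unique (h.2 r) (h'.2 r)

end LTendsto

namespace Op

/-! ## Series in a shift operator acting on rows from the right -/

section Action

variable {Γ R : Type*} [AddCommGroup Γ] [Ring R]

/-- The row vector `r` with entries in the columns `x + i v`, multiplied by the operator `Y`. -/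
noncomputable def act (v x : Γ) (r : ℤ → R) (Y : Op Γ R) : ℤ → R :=
  fun m => ∑ᶠ i : ℤ, r i * Y (m - i) (x + i • v)

/-- The row of `X` at `x`. -/
def row (X : Op Γ R) (x : Γ) : ℤ → R := fun m => X m x

theorem mul_eq_act (v : Γ) (X Y : Op Γ R) (m : ℤ) (x : Γ) :
    mul v X Y m x = act v x (row X x) Y m := rfl

theorem row_mul (v : Γ) (X Y : Op Γ R) (x : Γ) :
    row (mul v X Y) x = act v x (row X x) Y := rfl

def URow (r : ℤ → R) (d : ℤ) : Prop := ∀ j, d < j → r j = 0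

theorem URow.add {r r' : ℤ → R} {d : ℤ} (h : URow r d) (h' : URow r' d) :
    URow (fun m => r m + r' m) d := fun j hj => by simp only [h j hj, h' j hj, add_zero]

def UB (X : Op Γ R) (d : ℤ) : Prop := ∀ j, d < j → ∀ x, X j x = 0

theorem UB.row {X : Op Γ R} {d : ℤ} (h : UB X d) (x : Γ) : URow (row X x) d :=
  fun j hj => h j hj x

theorem act_eq_sum {v x : Γ} {r : ℤ → R} {Y : Op Γ R} {d e : ℤ} (hr : URow r d) (hY : UB Y e)
    {m : ℤ} {s : Finset ℤ} (hs : Finset.Icc (m - e) d ⊆ s) :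
    act v x r Y m = ∑ i ∈ s, r i * Y (m - i) (x + i • v) := by
  refine finsum_eq_sum_of_support_subset _ fun i hi => hs ?_
  simp only [Function.mem_support] at hi
  rw [Finset.mem_Icc]
  constructor
  · by_contra h
    exact hi (by rw [hY _ (by omega), mul_zero])
  · by_contra h
    exact hi (by rw [hr _ (by omega), zero_mul])

theorem URow.act {v x : Γ} {r : ℤ → R} {Y : Op Γ R} {d e : ℤ} (hr : URow r d) (hY : UB Y e) :
    URow (act v x r Y) (d + e) := fun j hj => by
  rw [act_eq_sum hr hY (Finset.Subset.refl _), Finset.Icc_eq_empty (by omega), Finset.sum_empty]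

theorem UB.mul {v : Γ} {X Y : Op Γ R} {d e : ℤ} (hX : UB X d) (hY : UB Y e) :
    UB (mul v X Y) (d + e) := fun j hj x => (hX.row x).act hY j hj

theorem mul_shifted {v : Γ} {X Y : Op Γ R} {d e : ℤ} (hX : UB X d) (hY : UB Y e) (x : Γ)
    {m i : ℤ} {s : Finset ℤ} (hs : Finset.Icc (m - e) (i + d) ⊆ s) :
    mul v X Y (m - i) (x + i • v) =
      ∑ n ∈ s, X (n - i) (x + i • v) * Y (m - n) (x + n • v) := by
  rw [mul, ← finsum_comp_equiv (Equiv.subRight i)]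
  simp only [Equiv.subRight_apply]
  rw [← finsum_eq_sum_of_support_subset (s := s)]
  · refine finsum_congr fun n => ?_
    congr 2
    · omega
    · rw [sub_smul]; abel
  · intro n hn
    simp only [Function.mem_support] at hn
    refine hs ?_
    rw [Finset.mem_Icc]
    constructor
    · by_contra h
      exact hn (by rw [hY _ (by omega), mul_zero])
    · by_contra h
      exact hn (by rw [hX _ (by omega), zero_mul])

/-- For factors bounded above every coefficient is a finite double sum, and associativity is the
interchange of the two summations. -/
theorem act_mul {v x : Γ} {r : ℤ → R} {X Y : Op Γ R} {d e f : ℤ} (hr : URow r d) (hX : UB X e)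
    (hY : UB Y f) : act v x r (mul v X Y) = act v x (act v x r X) Y := by
  funext m
  rw [act_eq_sum hr (hX.mul hY) (s := Finset.Icc (m - (e + f)) d) (Finset.Subset.refl _),
    act_eq_sum (hr.act hX) hY (s := Finset.Icc (m - f) (d + e)) (Finset.Subset.refl _)]
  have h1 : ∀ i ∈ Finset.Icc (m - (e + f)) d, r i * mul v X Y (m - i) (x + i • v) =
      ∑ n ∈ Finset.Icc (m - f) (d + e),
        r i * X (n - i) (x + i • v) * Y (m - n) (x + n • v) := by
    intro i hi
    rw [Finset.mem_Icc] at hi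
    rw [mul_shifted hX hY x (s := Finset.Icc (m - f) (d + e))
      (Finset.Icc_subset_Icc le_rfl (by omega)), Finset.mul_sum]
    simp only [mul_assoc]
  rw [Finset.sum_congr rfl h1, Finset.sum_comm]
  refine Finset.sum_congr rfl fun n hn => ?_
  rw [Finset.mem_Icc] at hn
  rw [act_eq_sum hr hX (s := Finset.Icc (m - (e + f)) d)
    (Finset.Icc_subset_Icc (by omega) le_rfl), Finset.sum_mul]

/-- An operator with powers between `0` and `D` reads only `D + 1` columns. This locality keeps all
computations inside a finite window. -/
theorem act_congr_of_agree {v x : Γ} {r r' : ℤ → R} {Y : Op Γ R} {D : ℤ}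
    (hY : UB Y D) (hY0 : ∀ j < 0, ∀ x, Y j x = 0) {m : ℤ}
    (h : ∀ i, m - D ≤ i → i ≤ m → r i = r' i) : act v x r Y m = act v x r' Y m := by
  refine finsum_congr fun i => ?_
  by_cases h1 : m - D ≤ i
  · by_cases h2 : i ≤ m
    · rw [h i h1 h2]
    · rw [hY0 _ (by omega), mul_zero, mul_zero]
  · rw [hY _ (by omega), mul_zero, mul_zero]

theorem act_shift (v x : Γ) (r : ℤ → R) (j m : ℤ) : act v x r (shift j) m = r (m - j) := by
  rw [act, finsum_eq_single _ (m - j)]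
  · simp [shift]
  · intro i hi
    rw [shift, if_neg (by omega), mul_zero]

theorem UB_shift (j : ℤ) : UB (shift j : Op Γ R) j := fun i hi x => by
  rw [shift, if_neg hi.ne']

theorem UB_down (k : ℕ → Γ → R) : UB (down k) 0 := fun i hi x => by
  rw [down, if_neg (by omega)]

theorem UB.pow {v : Γ} {X : Op Γ R} {d : ℤ} (hX : UB X d) (n : ℕ) : UB (pow v X n) (n * d) := by
  induction n with
  | zero => simpa [Op.pow] using UB_shift (R := R) (Γ := Γ) 0
  | succ n ih =>
    have := ih.mul (v := v) hX
    rw [Op.pow]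
    convert this using 1
    push_cast; ring

theorem UB.zpow {v : Γ} {X Xi : Op Γ R} (hX : UB X 1) (hXi : UB Xi (-1)) (j : ℤ) :
    UB (zpow v X Xi j) j := by
  cases j with
  | ofNat n => simpa [Op.zpow] using hX.pow (v := v) n
  | negSucc n =>
    have := hXi.pow (v := v) (n + 1)
    rw [Op.zpow]
    convert this using 1
    rw [Int.negSucc_eq]; push_cast; ring

theorem UB.dress {v : Γ} {k h : ℕ → Γ → R} {X : Op Γ R} {d : ℤ} (hX : UB X d) :
    UB (dress v (down k) (down h) X) d := by
  have := ((UB_down k).mul (v := v) hX).mul (v := v) (UB_down h)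
  rw [Op.dress]
  convert this using 1
  ring

theorem invCoeff_apply (v : Γ) (k : ℕ → Γ → R) (m : ℕ) (x : Γ) : invCoeff v k m x =
    if m = 0 then Ring.inverse (k 0 x)
    else -(∑ i : Fin m, invCoeff v k i x * k (m - i) (x + (i : ℕ) • v)) *
      Ring.inverse (k 0 (x + m • v)) := by
  rw [invCoeff]

variable {v x : Γ} {k : ℕ → Γ → R}

theorem act_down_invCoeff_mul (y : Γ) (n : ℕ) (hu : IsUnit (k 0 (y + n • (-v)))) :
    ∑ a ∈ Finset.range (n + 1), invCoeff (-v) k a y * k (n - a) (y + a • (-v)) =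
      if n = 0 then 1 else 0 := by
  rw [Finset.sum_range_succ]
  rcases Nat.eq_zero_or_pos n with rfl | hn
  · simp only [zero_smul, add_zero] at hu
    rw [invCoeff_apply, if_pos rfl]
    simp [Ring.inverse_mul_cancel _ hu]
  · rw [if_neg hn.ne']
    rw [invCoeff_apply (-v) k n, if_neg hn.ne', Nat.sub_self, mul_assoc, Ring.inverse_mul_cancel _ hu, mul_one,
      ← Fin.sum_univ_eq_sum_range (fun a => invCoeff (-v) k a y * k (n - a) (y + a • (-v)))]
    exact add_neg_cancel _

/-- The recursion for the inverse divides by the leading coefficient at the point reached by the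
column in question. Invertibility is therefore required there alone and not on the whole orbit. -/
theorem mul_inv_self (m : ℤ) (y : Γ) (hu : IsUnit (k 0 (y + m • v))) :
    mul v (down (invCoeff (-v) k)) (down k) m y = if m = 0 then 1 else 0 := by
  rcases lt_or_ge 0 m with hm | hm
  · rw [(UB_down _).mul (UB_down _) m (by omega), if_neg (by omega)]
  · obtain ⟨n, rfl⟩ : ∃ n : ℕ, m = -n := ⟨(-m).toNat, by omega⟩
    rw [mul_eq_act, act_eq_sum ((UB_down _).row y) (UB_down _)
      (s := (Finset.range (n + 1)).image fun a : ℕ => -(a : ℤ))]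
    · rw [Finset.sum_image (by intro a _ b _ h; simpa using h)]
      have hu' : IsUnit (k 0 (y + n • (-v))) := by simpa using hu
      have := act_down_invCoeff_mul (v := v) (k := k) y n hu'
      simp only [neg_eq_zero, Nat.cast_eq_zero]
      rw [← this]
      refine Finset.sum_congr rfl fun a ha => ?_
      rw [Finset.mem_range] at ha
      rw [row, down, down, if_pos (by omega), if_pos (by omega)]
      congr 2
      · omega
      · omega
      · simp
    · intro i hi
      rw [Finset.mem_Icc] at hi
      exact Finset.mem_image.2 ⟨(-i).toNat, Finset.mem_range.2 (by omega), by omega⟩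

theorem act_inv_mul {r : ℤ → R} {m : ℤ} (hu : IsUnit (k 0 (x + m • v))) :
    act v x r (mul v (down (invCoeff (-v) k)) (down k)) m = r m := by
  rw [act, finsum_eq_single _ m]
  · rw [mul_inv_self _ _ (by simpa using hu)]; simp
  · intro i hi
    rw [mul_inv_self _ _ (by rw [add_assoc, ← add_smul]; simpa using hu), if_neg (by omega),
      mul_zero]

/-- The dressed operators act on the row of `K = down k` like the bare ones, in the columns where
the leading coefficient of `K` is invertible. -/
theorem act_dress {r : ℤ → R} {V : Op Γ R} {d D : ℤ} (hr : URow r d) (hV : UB V D) {m : ℤ}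
    (hu : IsUnit (k 0 (x + m • v))) :
    act v x (act v x r (dress v (down k) (down (invCoeff (-v) k)) V)) (down k) m =
      act v x (act v x r (down k)) V m := by
  have hk := UB_down k
  have hi := UB_down (invCoeff (-v) k)
  rw [dress, act_mul hr (hk.mul hV) hi, act_mul hr hk hV,
    ← act_mul ((hr.act hk).act hV) hi hk, act_inv_mul hu]

/-- The row of `K V^n`. -/
noncomputable def iterRow (v x : Γ) (k : ℕ → Γ → R) (V : Op Γ R) (n : ℕ) : ℤ → R :=
  (fun r => act v x r V)^[n] (row (down k) x)

theorem iterRow_succ (V : Op Γ R) (n : ℕ) :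
    iterRow v x k V (n + 1) = act v x (iterRow v x k V n) V := by
  rw [iterRow, Function.iterate_succ_apply']; rfl

theorem URow_iterRow {V : Op Γ R} {D : ℤ} (hV : UB V D) (n : ℕ) :
    URow (iterRow v x k V n) (n * D) := by
  induction n with
  | zero => simpa [iterRow] using (UB_down k).row x
  | succ n ih =>
    rw [iterRow_succ]
    convert ih.act hV using 1
    push_cast; ring

theorem act_row_one (Y : Op Γ R) (m : ℤ) : act v x (row (shift 0) x) Y m = Y m x := by
  rw [act, finsum_eq_single _ 0]
  · simp [row, shift]
  · intro i hi
    simp [row, shift, hi]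

/-- `M` acts on the row of `K = down k` at `x` like `V` does, in the columns where the leading
coefficient of `K` is invertible. -/
def ActsAs (v x : Γ) (k : ℕ → Γ → R) (M V : Op Γ R) : Prop :=
  ∀ (r : ℤ → R) (d m : ℤ), URow r d → IsUnit (k 0 (x + m • v)) →
    act v x (act v x r M) (down k) m = act v x (act v x r (down k)) V m

/-- Each factor reads up to `D` columns below the current one, so `n` factors use up `D n` columns
at the lower end of the window. -/
theorem act_pow_of_actsAs {M V : Op Γ R} {D : ℕ} (hM : UB M D) (hMV : ActsAs v x k M V)
    (hV : UB V D) (hV0 : ∀ j < 0, ∀ x, V j x = 0)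
    {lo hi : ℤ} (hu : ∀ m, lo ≤ m → m ≤ hi → IsUnit (k 0 (x + m • v))) (n : ℕ) (m : ℤ)
    (h1 : lo + D * n ≤ m) (h2 : m ≤ hi) :
    act v x (row (pow v M n) x) (down k) m = iterRow v x k V n m := by
  induction n generalizing m with
  | zero => exact act_row_one _ _
  | succ n ih =>
    rw [pow, row_mul, hMV _ _ m ((hM.pow n).row x) 
      (hu m (by push_cast at h1; nlinarith) h2), iterRow_succ]
    refine act_congr_of_agree hV hV0 fun i hi1 hi2 => ih i ?_ (hi2.trans h2)
    push_cast at h1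
    linarith

/-- Dressing cancels against the row of the dressing series and leaves the bare shift. One column is
lost at each end of the window per factor, which covers both directions `e = ±1`. -/
theorem act_pow_shift {r : ℤ → R} {d : ℤ} (hr : URow r d) (e : ℤ) (he : |e| ≤ 1)
    {lo hi : ℤ} (hu : ∀ m, lo ≤ m → m ≤ hi → IsUnit (k 0 (x + m • v))) (n : ℕ) (m : ℤ)
    (h1 : lo + n ≤ m) (h2 : m ≤ hi - n) :
    act v x (act v x r (pow v (dress v (down k) (down (invCoeff (-v) k)) (shift e)) n)) (down k) m
      = act v x r (down k) (m - n * e) := by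
  rw [abs_le] at he
  have hL : UB (dress v (down k) (down (invCoeff (-v) k)) (shift e)) e := (UB_shift e).dress
  induction n generalizing m with
  | zero =>
    have : act v x r (pow v (dress v (down k) (down (invCoeff (-v) k)) (shift e)) 0) = r := by
      funext m
      rw [pow, act_shift, sub_zero]
    rw [this]; simp
  | succ n ih =>
    push_cast at h1 h2
    rw [pow, act_mul hr (hL.pow n) hL, act_dress (hr.act (hL.pow n)) (UB_shift e)
      (hu m (by omega) (by omega)), act_shift, ih _ (by omega) (by omega)]
    congr 1
    push_cast; ring

theorem act_zpow_shift {r : ℤ → R} {d : ℤ} (hr : URow r d) {lo hi : ℤ}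
    (hu : ∀ m, lo ≤ m → m ≤ hi → IsUnit (k 0 (x + m • v))) (j m : ℤ)
    (h1 : lo + |j| ≤ m) (h2 : m ≤ hi - |j|) :
    act v x (act v x r (zpow v (dress v (down k) (down (invCoeff (-v) k)) (shift 1))
      (dress v (down k) (down (invCoeff (-v) k)) (shift (-1))) j)) (down k) m
      = act v x r (down k) (m - j) := by
  cases j with
  | ofNat n =>
    rw [zpow]
    simp only [Int.ofNat_eq_natCast, Nat.abs_cast] at h1 h2
    rw [act_pow_shift hr 1 (by simp) hu n m h1 h2]
    simp
  | negSucc n =>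
    rw [zpow]
    have : |Int.negSucc n| = ((n + 1 : ℕ) : ℤ) := by rw [Int.negSucc_eq, abs_neg]; norm_cast
    rw [this] at h1 h2
    rw [act_pow_shift hr (-1) (by simp) hu (n + 1) m h1 h2]
    congr 1
    rw [Int.negSucc_eq]; push_cast; ring

end Action

/-! ### Functions of dressed operators -/

section Eval

variable {Γ R : Type*} [AddCommGroup Γ] [Ring R] [Algebra ℂ R]
variable {v x : Γ} {k : ℕ → Γ → R}

/-- Only finitely many terms of `∑ F_{ij} X^i Y^j` contribute to each power of the shift, when `X`
has order `D` and `Y` has order one. -/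
def FiniteAbove (D : ℕ) (F : ℕ → ℤ → ℂ) : Prop :=
  ∀ m : ℤ, {ij : ℕ × ℤ | F ij.1 ij.2 ≠ 0 ∧ m ≤ D * ij.1 + ij.2}.Finite

theorem FiniteAbove.exists_bound {D : ℕ} {F : ℕ → ℤ → ℂ} (h : FiniteAbove D F) :
    ∃ d : ℤ, 0 ≤ d ∧ ∀ i j, F i j ≠ 0 → (D : ℤ) * i + j ≤ d := by
  obtain ⟨d, hd⟩ := ((h 0).image fun ij : ℕ × ℤ => (D : ℤ) * ij.1 + ij.2).bddAbove
  refine ⟨max d 0, le_max_right _ _, fun i j hF => ?_⟩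
  by_cases h0 : (0 : ℤ) ≤ D * i + j
  · exact le_max_of_le_left (hd ⟨(i, j), ⟨hF, h0⟩, rfl⟩)
  · exact le_max_of_le_right (by omega)

variable {M V : Op Γ R} {D : ℕ}

theorem UB_term (hM : UB M D) (i : ℕ) (j : ℤ) :
    UB (mul v (pow v M i)
      (zpow v (dress v (down k) (down (invCoeff (-v) k)) (shift 1))
        (dress v (down k) (down (invCoeff (-v) k)) (shift (-1))) j)) (D * i + j) := by
  rw [mul_comm (D : ℤ)]
  exact (hM.pow i).mul (UB.zpow (UB_shift 1).dress (UB_shift (-1)).dress j)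

theorem UB_eval₂ (hM : UB M D) {F : ℕ → ℤ → ℂ} {d : ℤ}
    (hd : ∀ i j, F i j ≠ 0 → (D : ℤ) * i + j ≤ d) :
    UB (eval₂ v F M
      (dress v (down k) (down (invCoeff (-v) k)) (shift 1))
      (dress v (down k) (down (invCoeff (-v) k)) (shift (-1)))) d := fun m hm x => by
  rw [eval₂]
  refine finsum_eq_zero_of_forall_eq_zero fun ij => ?_
  by_cases hF : F ij.1 ij.2 = 0
  · rw [hF, zero_smul]
  · rw [UB_term hM ij.1 ij.2 m (lt_of_le_of_lt (hd _ _ hF) hm), smul_zero]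

/-- Term by term, `F(M, L) K` is `∑ F_{ij} K V^i T^j`. The condition on `m` says that every term
that can reach column `m` stays within the window where the leading coefficient is invertible. -/
theorem act_eval₂ (hM : UB M D) (hMV : ActsAs v x k M V) (hV : UB V D) (hV0 : ∀ j < 0, ∀ x, V j x = 0) {F : ℕ → ℤ → ℂ}
    (hF : FiniteAbove D F) {lo hi : ℤ}
    (hu : ∀ m, lo ≤ m → m ≤ hi → IsUnit (k 0 (x + m • v))) (m : ℤ)
    (hm : ∀ i j, F i j ≠ 0 → m ≤ D * i + j → lo + D * i + |j| ≤ m ∧ m ≤ hi - |j|) :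
    act v x (row (eval₂ v F M
      (dress v (down k) (down (invCoeff (-v) k)) (shift 1))
      (dress v (down k) (down (invCoeff (-v) k)) (shift (-1)))) x) (down k) m =
      ∑ᶠ ij : ℕ × ℤ, F ij.1 ij.2 • iterRow v x k V ij.1 (m - ij.2) := by
  obtain ⟨d, -, hd⟩ := hF.exists_bound
  set P : ℕ → ℤ → Op Γ R := fun i j =>
    mul v (pow v M i)
      (zpow v (dress v (down k) (down (invCoeff (-v) k)) (shift 1))
        (dress v (down k) (down (invCoeff (-v) k)) (shift (-1))) j) with hP
  have hPUB : ∀ i j, UB (P i j) (D * i + j) := fun i j => UB_term hM i j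
  -- The terms that reach any column `m' ≥ m` are among those that reach `m`, so one finite set
  -- serves for all columns read by the descending series `down k`.
  set S := (hF m).toFinset with hS
  have hterm : ∀ ij ∈ S, act v x (row (P ij.1 ij.2) x) (down k) m =
      iterRow v x k V ij.1 (m - ij.2) := by
    intro ij hij
    simp only [hS, Set.Finite.mem_toFinset, Set.mem_ofPred_eq] at hij
    obtain ⟨h1, h2⟩ := hm _ _ hij.1 hij.2
    rw [hP, row_mul, act_zpow_shift ((hM.pow ij.1).row x) (lo := lo + D * ij.1)
      (hi := hi) (fun m' h h' => hu m' (by nlinarith) h') _ _ h1 h2]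
    have := neg_abs_le ij.2
    have := le_abs_self ij.2
    exact act_pow_of_actsAs hM hMV hV hV0 hu _ _ (by linarith) (by linarith)
  have hrhs : ∑ᶠ ij : ℕ × ℤ, F ij.1 ij.2 • iterRow v x k V ij.1 (m - ij.2) =
      ∑ ij ∈ S, F ij.1 ij.2 • iterRow v x k V ij.1 (m - ij.2) := by
    refine finsum_eq_sum_of_support_subset _ fun ij hij => ?_
    simp only [hS, Set.Finite.coe_toFinset, Set.mem_ofPred_eq]
    refine ⟨fun h => hij (by simp [h]), ?_⟩
    by_contra h
    refine hij ?_
    simp only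
    rw [URow_iterRow hV ij.1 _ (by linarith), smul_zero]
  have hlhs : ∀ m', m ≤ m' → eval₂ v F M
      (dress v (down k) (down (invCoeff (-v) k)) (shift 1))
      (dress v (down k) (down (invCoeff (-v) k)) (shift (-1))) m' x =
      ∑ ij ∈ S, F ij.1 ij.2 • P ij.1 ij.2 m' x := by
    intro m' hm'
    refine finsum_eq_sum_of_support_subset _ fun ij hij => ?_
    simp only [hS, Set.Finite.coe_toFinset, Set.mem_ofPred_eq]
    refine ⟨fun h => hij (by simp [h]), ?_⟩
    by_contra h
    refine hij ?_
    change F ij.1 ij.2 • P ij.1 ij.2 m' x = 0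
    rw [hPUB ij.1 ij.2 _ (by linarith), smul_zero]
  rw [hrhs, act_eq_sum ((UB_eval₂ hM hd).row x) (UB_down k) (Finset.Subset.refl _)]
  have h3 : ∀ m' ∈ Finset.Icc (m - 0) d, row (eval₂ v F
      M
      (dress v (down k) (down (invCoeff (-v) k)) (shift 1))
      (dress v (down k) (down (invCoeff (-v) k)) (shift (-1)))) x m' *
      down k (m - m') (x + m' • v) =
      ∑ ij ∈ S, F ij.1 ij.2 • (row (P ij.1 ij.2) x m' * down k (m - m') (x + m' • v)) := by
    intro m' hm'
    rw [Finset.mem_Icc] at hm'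
    rw [row, hlhs m' (by omega), Finset.sum_mul]
    refine Finset.sum_congr rfl fun ij _ => ?_
    rw [smul_mul_assoc]; rfl
  rw [Finset.sum_congr rfl h3, Finset.sum_comm]
  refine Finset.sum_congr rfl fun ij hij => ?_
  rw [← Finset.smul_sum, ← hterm ij hij]
  congr 1
  simp only [hS, Set.Finite.mem_toFinset, Set.mem_ofPred_eq] at hij
  exact (act_eq_sum ((hPUB ij.1 ij.2).row x) (UB_down k)
    (Finset.Icc_subset_Icc le_rfl (hd _ _ hij.1))).symm

theorem mul_eval₂_dress {E : Op Γ R} {e : ℤ} (hM : UB M D) (hE : UB E e) {F : ℕ → ℤ → ℂ}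
    (hF : FiniteAbove D F) (m : ℤ) :
    mul v (eval₂ v F M
      (dress v (down k) (down (invCoeff (-v) k)) (shift 1))
      (dress v (down k) (down (invCoeff (-v) k)) (shift (-1))))
      (dress v (down k) (down (invCoeff (-v) k)) E) m x =
    act v x (act v x (act v x (row (eval₂ v F M
      (dress v (down k) (down (invCoeff (-v) k)) (shift 1))
      (dress v (down k) (down (invCoeff (-v) k)) (shift (-1)))) x) (down k)) E)
      (down (invCoeff (-v) k)) m := by
  obtain ⟨d, -, hd⟩ := hF.exists_bound
  have hr := (UB_eval₂ (v := v) (k := k) hM hd).row x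
  rw [mul_eq_act, dress.eq_1 v _ _ E, act_mul hr ((UB_down k).mul hE) (UB_down _),
    act_mul hr (UB_down k) hE]

end Eval

/-! ## Reflection of the powers of the shift -/

section Reflect

variable {Γ R : Type*} [AddCommGroup Γ] [Ring R]

/-- The barred dressing series ascend in `Λ`. Replacing the shift by its inverse makes them
descending, and all results on rows bounded above apply with `-v` in place of `v`. -/
def reflect (X : Op Γ R) : Op Γ R := fun m x => X (-m) x

theorem reflect_mul (v : Γ) (X Y : Op Γ R) :
    reflect (mul v X Y) = mul (-v) (reflect X) (reflect Y) := by
  funext m x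
  simp only [reflect, mul]
  rw [← finsum_comp_equiv (Equiv.neg ℤ)]
  refine finsum_congr fun i => ?_
  simp only [Equiv.neg_apply, neg_sub_neg]
  congr 2
  · omega
  · simp

theorem reflect_shift (j : ℤ) : reflect (shift j : Op Γ R) = shift (-j) := by
  funext m x
  simp only [reflect, shift]
  congr 1
  exact propext ⟨fun h => by omega, fun h => by omega⟩

theorem reflect_up (k : ℕ → Γ → R) : reflect (up k) = down k := by
  funext m x
  simp only [reflect, up, down]
  congr 1
  exact propext ⟨fun h => by omega, fun h => by omega⟩

theorem reflect_pow (v : Γ) (X : Op Γ R) (n : ℕ) :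
    reflect (pow v X n) = pow (-v) (reflect X) n := by
  induction n with
  | zero => simp [pow, reflect_shift]
  | succ n ih => rw [pow, reflect_mul, ih]; rfl

theorem reflect_zpow (v : Γ) (X Xi : Op Γ R) (j : ℤ) :
    reflect (zpow v X Xi j) = zpow (-v) (reflect X) (reflect Xi) j := by
  cases j <;> simp [zpow, reflect_pow]

theorem reflect_dress (v : Γ) (A Ai X : Op Γ R) :
    reflect (dress v A Ai X) = dress (-v) (reflect A) (reflect Ai) (reflect X) := by
  simp [dress, reflect_mul]

theorem reflect_eval₂ [Algebra ℂ R] (v : Γ) (F : ℕ → ℤ → ℂ) (X Y Yi : Op Γ R) :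
    reflect (eval₂ v F X Y Yi) = eval₂ (-v) F (reflect X) (reflect Y) (reflect Yi) := by
  funext m x
  simp only [eval₂, reflect]
  refine finsum_congr fun ij => ?_
  rw [← reflect_pow, ← reflect_zpow, ← reflect_mul]
  rfl

end Reflect

end Op

/-! ## The Orlov operator on Laurent series -/

/-- `w d/dw`. -/
noncomputable def theta (f : LaurentSeries ℂ) : LaurentSeries ℂ :=
  toLaurent fun r => (r : ℂ) * f.coeff r

theorem coeff_theta (f : LaurentSeries ℂ) (r : ℤ) : (theta f).coeff r = r * f.coeff r := by
  rw [theta, toLaurent_coeff (a := f.order)]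
  intro i hi
  rw [below_order f i hi, mul_zero]

theorem Below.theta {f : LaurentSeries ℂ} {a : ℤ} (hf : Below f a) : Below (theta f) a :=
  fun i hi => by rw [coeff_theta, hf i hi, mul_zero]

theorem theta_mul (f g : LaurentSeries ℂ) : theta (f * g) = theta f * g + f * theta g := by
  ext r
  rw [HahnSeries.coeff_add, coeff_theta, coeff_mul_Icc (below_order f) (below_order g),
    coeff_mul_Icc (below_order f).theta (below_order g),
    coeff_mul_Icc (below_order f) (below_order g).theta, Finset.mul_sum,
    ← Finset.sum_add_distrib]
  refine Finset.sum_congr rfl fun i _ => ?_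
  rw [coeff_theta, coeff_theta]
  push_cast
  ring

/-- `c + sg(a) ∑_j (j+1) τ_j w^(-(j+1)) - sg(a) w d/dw`. -/
noncomputable def orlov {N D : ℕ} (a : Idx N) (c : ℂ) (τ : Fin D → ℂ) (u : LaurentSeries ℂ) :
    LaurentSeries ℂ :=
  (mono 0 c + ∑ j : Fin D, mono (-((j : ℤ) + 1)) (sg a * (((j : ℂ) + 1) * τ j))) * u -
    mono 0 (sg a) * theta u

theorem coeff_orlov {N D : ℕ} (a : Idx N) (c : ℂ) (τ : Fin D → ℂ) (u : LaurentSeries ℂ) (r : ℤ) :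
    (orlov a c τ u).coeff r = (c - sg a * r) * u.coeff r +
      ∑ j : Fin D, sg a * (((j : ℂ) + 1) * τ j) * u.coeff (r + ((j : ℤ) + 1)) := by
  rw [orlov, add_mul, Finset.sum_mul]
  simp only [HahnSeries.coeff_sub, HahnSeries.coeff_add, HahnSeries.coeff_sum, coeff_mono_mul,
    coeff_theta, sub_neg_eq_add, sub_zero]
  ring

theorem Below.orlov {N D : ℕ} {a : Idx N} {c : ℂ} {τ : Fin D → ℂ} {u : LaurentSeries ℂ} {b : ℤ}
    (hu : Below u b) : Below (orlov a c τ u) (b - D) := fun r hr => by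
  rw [coeff_orlov, hu r (by omega), mul_zero, zero_add]
  refine Finset.sum_eq_zero fun j _ => ?_
  have := j.2
  rw [hu _ (by omega), mul_zero]

theorem Below.orlov_iterate {N D : ℕ} {a : Idx N} {c : ℂ} {τ : Fin D → ℂ} {u : LaurentSeries ℂ}
    {b : ℤ} (hu : Below u b) (n : ℕ) : Below ((Whitham.orlov a c τ)^[n] u) (b - D * n) := by
  induction n with
  | zero => simpa using hu
  | succ n ih =>
    rw [Function.iterate_succ_apply']
    convert ih.orlov using 1
    push_cast; ring

/-! ### Bare Orlov–Schulman operators acting on rows -/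

namespace Op

section Ring

variable {Γ R : Type*} [AddCommGroup Γ] [Ring R]

theorem act_vacuum {D : ℕ} (v x : Γ) (r : ℤ → R) (g : Γ → R) (e : Fin D → R) (m : ℤ) :
    act v x r (fun m' x' => (if m' = 0 then g x' else 0) +
      ∑ j : Fin D, if m' = (j : ℤ) + 1 then e j else 0) m =
      r m * g (x + m • v) + ∑ j : Fin D, r (m - ((j : ℤ) + 1)) * e j := by
  rw [act, finsum_eq_sum_of_support_subset (s := Finset.Icc (m - D) m)]
  · simp only [mul_add, Finset.sum_add_distrib, Finset.mul_sum]
    congr 1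
    · rw [Finset.sum_eq_single m]
      · simp
      · intro i _ hi
        rw [if_neg (by omega), mul_zero]
      · intro h
        exact absurd (Finset.mem_Icc.2 ⟨by omega, le_rfl⟩) h
    · rw [Finset.sum_comm]
      refine Finset.sum_congr rfl fun j _ => ?_
      have := j.2
      rw [Finset.sum_eq_single (m - ((j : ℤ) + 1))]
      · rw [if_pos (by omega)]
      · intro i _ hi
        rw [if_neg (by omega), mul_zero]
      · intro h
        exact absurd (Finset.mem_Icc.2 ⟨by omega, by omega⟩) h
  · intro i hi
    by_contra h
    refine hi ?_
    simp only [Finset.coe_Icc, Set.mem_Icc, not_and_or, not_le] at h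
    have h0 : ¬ (m - i = 0) := by omega
    have h1 : ∑ j : Fin D, (if m - i = (j : ℤ) + 1 then e j else 0) = 0 :=
      Finset.sum_eq_zero fun j _ => if_neg (by have := j.2; omega)
    simp only [h0, if_false, h1, add_zero, mul_zero]

theorem UB_vacuum {D : ℕ} (g : Γ → R) (e : Fin D → R) :
    UB (fun (m' : ℤ) (x' : Γ) => (if m' = 0 then g x' else 0) +
      ∑ j : Fin D, if m' = (j : ℤ) + 1 then e j else 0) D := fun m hm x => by
  have h0 : ¬ (m = 0) := by omega
  have h1 : ∑ j : Fin D, (if m = (j : ℤ) + 1 then e j else 0) = 0 :=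
    Finset.sum_eq_zero fun j _ => if_neg (by have := j.2; omega)
  simp only [h0, if_false, h1, add_zero]

theorem vacuum_of_neg {D : ℕ} (g : Γ → R) (e : Fin D → R) (m : ℤ) (hm : m < 0) (x : Γ) :
    (if m = 0 then g x else 0) + ∑ j : Fin D, (if m = (j : ℤ) + 1 then e j else 0) = 0 := by
  have h1 : ∑ j : Fin D, (if m = (j : ℤ) + 1 then e j else 0) = 0 :=
    Finset.sum_eq_zero fun j _ => if_neg (by omega)
  rw [h1, if_neg (by omega), add_zero]

theorem act_left_mul {v x : Γ} {r : ℤ → R} {Y : Op Γ R} {d e : ℤ} (hr : URow r d) (hY : UB Y e)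
    (c : R) : act v x (fun m => c * r m) Y = fun m => c * act v x r Y m := by
  funext m
  have hr' : URow (fun m => c * r m) d := fun j hj => by simp only [hr j hj, mul_zero]
  rw [act_eq_sum hr' hY (Finset.Subset.refl _), act_eq_sum hr hY (Finset.Subset.refl _),
    Finset.mul_sum]
  simp only [mul_assoc]

theorem act_sum {ι : Type*} {v x : Γ} (s : Finset ι) {r : ι → ℤ → R} {Y : Op Γ R} {d e : ℤ}
    (hr : ∀ i ∈ s, URow (r i) d) (hY : UB Y e) :
    act v x (fun m => ∑ i ∈ s, r i m) Y = fun m => ∑ i ∈ s, act v x (r i) Y m := by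
  funext m
  have hr' : URow (fun m => ∑ i ∈ s, r i m) d := fun j hj =>
    Finset.sum_eq_zero fun i hi => hr i hi j hj
  rw [act_eq_sum hr' hY (Finset.Subset.refl _)]
  simp only [Finset.sum_mul]
  rw [Finset.sum_comm]
  refine Finset.sum_congr rfl fun i hi => ?_
  rw [act_eq_sum (hr i hi) hY (Finset.Subset.refl _)]

theorem act_add_left {v x : Γ} {r r' : ℤ → R} {Y : Op Γ R} {d e : ℤ}
    (hr : URow r d) (hr' : URow r' d) (hY : UB Y e) (m : ℤ) :
    act v x (fun m => r m + r' m) Y m = act v x r Y m + act v x r' Y m := by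
  have hs : URow (fun m => r m + r' m) d := fun j hj => by
    simp only [hr j hj, hr' j hj, add_zero]
  rw [act_eq_sum hs hY (Finset.Subset.refl _), act_eq_sum hr hY (Finset.Subset.refl _),
    act_eq_sum hr' hY (Finset.Subset.refl _), ← Finset.sum_add_distrib]
  simp only [add_mul]

/-- The highest surviving column of `r` is multiplied by an invertible leading coefficient only, so
it vanishes; descending from the bound `d` removes all columns. -/
theorem eq_zero_of_act_eq_zero {v x : Γ} {r : ℤ → R} {h : ℕ → Γ → R} {d : ℤ} (hr : URow r d)
    (hu : ∀ y, IsUnit (h 0 y)) (h0 : ∀ m, act v x r (down h) m = 0) : r = 0 := by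
  have key : ∀ n : ℕ, URow r (d - n) := by
    intro n
    induction n with
    | zero => simpa using hr
    | succ n ih =>
      intro j hj
      push_cast at hj
      rcases lt_or_ge (d - n) j with h1 | h1
      · exact ih j h1
      · obtain rfl : j = d - n := by omega
        have := h0 (d - n)
        rw [act_eq_sum ih (UB_down h) (Finset.Subset.refl _), sub_zero, Finset.Icc_self,
          Finset.sum_singleton] at this
        simp only [down, sub_self, le_refl, if_true] at this
        simpa using (hu _).mul_left_eq_zero.1 this
  funext j
  exact key (d - j + 1).toNat j (by omega)

end Ring

theorem UB_diagonal {N : ℕ} {Γ : Type*} {d : ℤ → Γ → Fin N → ℂ} {e : ℤ}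
    (h : ∀ l, UB (fun m x => d m x l) e) :
    UB (fun m x => (Matrix.diagonal (d m x) : Mat N)) e := fun m hm x => by
  have : d m x = 0 := funext fun l => h l m hm x
  change Matrix.diagonal (d m x) = 0
  rw [this]; exact Matrix.diagonal_zero

theorem act_diagonal {N : ℕ} {Γ : Type*} [AddCommGroup Γ] {v x : Γ} {r : ℤ → Mat N} {a e : ℤ}
    {d : ℤ → Γ → Fin N → ℂ} (hr : URow r a) (h : ∀ l, UB (fun m x => d m x l) e)
    (m : ℤ) (i l : Fin N) :
    act v x r (fun m x => Matrix.diagonal (d m x)) m i l =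
      act v x (fun j => r j i l) (fun m x => d m x l) m := by
  have hr' : URow (fun j => r j i l) a := fun j hj => by simp only [hr j hj, Matrix.zero_apply]
  rw [act_eq_sum hr (UB_diagonal h) (Finset.Subset.refl _),
    act_eq_sum hr' (h l) (Finset.Subset.refl _), Matrix.sum_apply]
  simp only [Matrix.mul_diagonal]

end Op

/-! ## The subspace attached to a solution of the factorization problem -/

section Gr

open Op

variable {N D : ℕ} [NeZero N]

/-- The first row at `n = n₀` of a series in `Λ`, from its columns as Laurent series in `y`. -/
def rowOf (u : Idx N → LaurentSeries ℂ) : ℤ → Mat N := fun m =>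
  Matrix.of fun i l => if i = 0 then (u (Sum.inl l)).coeff (-m - ν (Sum.inl l)) else 0

/-- The same for the reflected series on the barred side. -/
def rowBar (u : Idx N → LaurentSeries ℂ) : ℤ → Mat N := fun m =>
  Matrix.of fun i l => if i = 0 then (u (Sum.inr l)).coeff (-m) else 0

theorem ν_bounds (a : Idx N) : 0 ≤ ν a ∧ ν a ≤ 1 := by
  rcases a with k | k
  · by_cases h : k = 0 <;> simp [ν, h]
  · simp [ν]

theorem exists_below (u : Idx N → LaurentSeries ℂ) : ∃ d : ℤ, ∀ a, Below (u a) (-d) := by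
  obtain ⟨d, hd⟩ := (Set.finite_range fun a => -(u a).order).bddAbove
  exact ⟨d, fun a => (below_order _).mono_le (by have := hd ⟨a, rfl⟩; simp only at this; omega)⟩

theorem URow_rowOf {u : Idx N → LaurentSeries ℂ} {d : ℤ} (h : ∀ a, Below (u a) (-d)) :
    URow (rowOf u) d := fun j hj => by
  ext i l
  have := (ν_bounds (N := N) (Sum.inl l)).1
  simp only [rowOf, Matrix.of_apply, Matrix.zero_apply]
  rw [h _ _ (by omega), ite_self]

theorem URow_rowBar {u : Idx N → LaurentSeries ℂ} {d : ℤ} (h : ∀ a, Below (u a) (-d)) :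
    URow (rowBar u) d := fun j hj => by
  ext i l
  simp only [rowBar, Matrix.of_apply, Matrix.zero_apply]
  rw [h _ _ (by omega), ite_self]

theorem rowOf_add (u u' : Idx N → LaurentSeries ℂ) :
    rowOf (fun c => u c + u' c) = fun m => rowOf u m + rowOf u' m := by
  funext m
  ext i l
  simp only [rowOf, Matrix.of_apply, Matrix.add_apply]
  split_ifs <;> simp

theorem rowBar_add (u u' : Idx N → LaurentSeries ℂ) :
    rowBar (fun c => u c + u' c) = fun m => rowBar u m + rowBar u' m := by
  funext m
  ext i l
  simp only [rowBar, Matrix.of_apply, Matrix.add_apply]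
  split_ifs <;> simp

theorem rowOf_smul (c : ℂ) (u : Idx N → LaurentSeries ℂ) :
    rowOf (fun a => c • u a) = fun m => (c • (1 : Mat N)) * rowOf u m := by
  funext m
  ext i l
  simp only [rowOf, smul_mul_assoc, one_mul, Matrix.of_apply, Matrix.smul_apply]
  split_ifs <;> simp

theorem rowBar_smul (c : ℂ) (u : Idx N → LaurentSeries ℂ) :
    rowBar (fun a => c • u a) = fun m => (c • (1 : Mat N)) * rowBar u m := by
  funext m
  ext i l
  simp only [rowBar, smul_mul_assoc, one_mul, Matrix.of_apply, Matrix.smul_apply]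
  split_ifs <;> simp

variable (A : TodaData N D) (n₀ : ℤ) (s : Idx N → ℤ) (t : Times N D)

/-- The families `u` whose rows satisfy `r S⁻¹ = r̄ S̄⁻¹`. -/
def InGr (u : Idx N → LaurentSeries ℂ) : Prop :=
  ∀ m, act 1 n₀ (rowOf u) (A.Sinv s t) m =
    act (-1) n₀ (rowBar u) (reflect (A.Sbarinv s t)) (-m)

theorem reflect_Sbarinv : reflect (A.Sbarinv s t) =
    down (invCoeff (-(-1)) fun i n => A.φbar i n s t) := by
  rw [TodaData.Sbarinv, reflect_up, neg_neg]

theorem reflect_Sbar : reflect (A.Sbar s t) = down fun i n => A.φbar i n s t := by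
  rw [TodaData.Sbar, reflect_up]

theorem UB_Sinv : UB (A.Sinv s t) 0 := UB_down _

theorem UB_reflect_Sbarinv : UB (reflect (A.Sbarinv s t)) 0 := by
  rw [reflect_Sbarinv]; exact UB_down _

variable {A n₀ s t}

theorem InGr.add {u u' : Idx N → LaurentSeries ℂ} (h : InGr A n₀ s t u) (h' : InGr A n₀ s t u') :
    InGr A n₀ s t (fun c => u c + u' c) := by
  obtain ⟨d, hd⟩ := exists_below u
  obtain ⟨d', hd'⟩ := exists_below u'
  have h1 : ∀ a, Below (u a) (-max d d') := fun a => (hd a).mono_le (by omega)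
  have h2 : ∀ a, Below (u' a) (-max d d') := fun a => (hd' a).mono_le (by omega)
  intro m
  rw [rowOf_add, rowBar_add, act_add_left (URow_rowOf h1) (URow_rowOf h2) (UB_Sinv A s t),
    act_add_left (URow_rowBar h1) (URow_rowBar h2) (UB_reflect_Sbarinv A s t), h m, h' m]

theorem InGr.smul {u : Idx N → LaurentSeries ℂ} (h : InGr A n₀ s t u) (c : ℂ) :
    InGr A n₀ s t (fun a => c • u a) := by
  obtain ⟨d, hd⟩ := exists_below u
  intro m
  rw [rowOf_smul, rowBar_smul, act_left_mul (URow_rowOf hd) (UB_Sinv A s t),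
    act_left_mul (URow_rowBar hd) (UB_reflect_Sbarinv A s t)]
  simp only
  rw [h m]

theorem InGr.zero : InGr A n₀ s t fun _ => 0 := fun m => by
  have h1 : rowOf (fun _ : Idx N => (0 : LaurentSeries ℂ)) = 0 := by
    funext m; ext i l; simp [rowOf]
  have h2 : rowBar (fun _ : Idx N => (0 : LaurentSeries ℂ)) = 0 := by
    funext m; ext i l; simp [rowBar]
  rw [h1, h2]
  simp [act]

theorem InGr.sum {ι : Type*} (S : Finset ι) {u : ι → Idx N → LaurentSeries ℂ}
    (h : ∀ i ∈ S, InGr A n₀ s t (u i)) : InGr A n₀ s t (fun a => ∑ i ∈ S, u i a) := by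
  classical
  induction S using Finset.induction_on with
  | empty => simpa using InGr.zero
  | insert k S hk ih =>
    simp only [Finset.sum_insert hk]
    exact (h k (Finset.mem_insert_self _ _)).add
      (ih fun j hj => h j (Finset.mem_insert_of_mem hj))

theorem InGr.sub {u u' : Idx N → LaurentSeries ℂ} (h : InGr A n₀ s t u) (h' : InGr A n₀ s t u') :
    InGr A n₀ s t (fun c => u c - u' c) := by
  convert h.add (h'.smul (-1)) using 2 with c
  ext r
  simp [sub_eq_add_neg]

/-- Transversality. The two rows of `u` occupy powers of `Λ` below `0` and at least `0`
respectively, and multiplication by `S⁻¹` or `S̄⁻¹` respects this. The common value of `r S⁻¹` and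
`r̄ S̄⁻¹` is thus zero, and the inverse dressing series are injective on rows. The asymmetry at
component `1` comes from `ν`: for the other unbarred components a column is offset by one. -/
theorem InGr.eq_zero {u : Idx N → LaurentSeries ℂ} (h : InGr A n₀ s t u)
    (hφ : ∀ n, A.φ 0 n s t = 1) (hφ' : ∀ n, IsUnit (A.φbar 0 n s t))
    (h1 : Below (u (Sum.inl 0)) 1) (h0 : ∀ c, Below (u c) 0) : ∀ c, u c = 0 := by
  have hr : URow (rowOf u) (-1) := fun j hj => by
    ext i l
    simp only [rowOf, Matrix.of_apply, Matrix.zero_apply]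
    by_cases hl : l = 0
    · subst hl
      rw [h1 _ (by simp [ν]; omega), ite_self]
    · rw [h0 _ _ (by simp [ν, hl]; omega), ite_self]
  have hr' : URow (rowBar u) 0 := URow_rowBar (by simpa using h0)
  have z1 : ∀ m, act 1 n₀ (rowOf u) (A.Sinv s t) m = 0 := fun m => by
    rcases lt_or_ge m 0 with hm | hm
    · rw [h m]
      exact hr'.act (UB_reflect_Sbarinv A s t) _ (by omega)
    · exact hr.act (UB_Sinv A s t) _ (by omega)
  have z2 : ∀ m, act (-1) n₀ (rowBar u) (reflect (A.Sbarinv s t)) m = 0 := fun m => by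
    have := h (-m)
    rw [neg_neg, z1] at this
    exact this.symm
  have e1 : rowOf u = 0 := eq_zero_of_act_eq_zero hr (fun y => by
    rw [invCoeff_apply, if_pos rfl, hφ, Ring.inverse_one]; exact isUnit_one) z1
  rw [reflect_Sbarinv] at z2
  have e2 : rowBar u = 0 := eq_zero_of_act_eq_zero hr' (fun y => by
    rw [invCoeff_apply, if_pos rfl]; exact (isUnit_ringInverse).2 (hφ' y)) z2
  rintro (l | l)
  · ext r
    have := congrFun (congrFun (congrFun e1 (-r - ν (Sum.inl l))) 0) l
    simpa [rowOf] using this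
  · ext r
    have := congrFun (congrFun (congrFun e2 (-r)) 0) l
    simpa [rowBar] using this

/-- Only the first matrix row carries information: multiplying on the left by `E₁₁` commutes with
the action from the right. -/
theorem InGr.of_rows {u : Idx N → LaurentSeries ℂ} {r r' : ℤ → Mat N} {d d' : ℤ}
    (hr : URow r d) (hr' : URow r' d')
    (h1 : ∀ m l, (u (Sum.inl l)).coeff (-m - ν (Sum.inl l)) = r m 0 l)
    (h2 : ∀ m l, (u (Sum.inr l)).coeff (-m) = r' m 0 l)
    (h : ∀ m l, act 1 n₀ r (A.Sinv s t) m 0 l =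
      act (-1) n₀ r' (reflect (A.Sbarinv s t)) (-m) 0 l) : InGr A n₀ s t u := by
  have hE : ∀ (M : Mat N) (i l : Fin N), (Matrix.single 0 0 1 * M : Mat N) i l =
      if i = 0 then M 0 l else 0 := fun M i l => by
    split_ifs with hi
    · subst hi; simp
    · exact Matrix.single_mul_apply_of_ne _ _ _ _ _ hi _
  have e1 : rowOf u = fun m => Matrix.single 0 0 1 * r m := by
    funext m; ext i l
    rw [hE, rowOf, Matrix.of_apply, h1]
  have e2 : rowBar u = fun m => Matrix.single 0 0 1 * r' m := by
    funext m; ext i l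
    rw [hE, rowBar, Matrix.of_apply, h2]
  intro m
  rw [e1, e2, act_left_mul hr (UB_Sinv A s t), act_left_mul hr' (UB_reflect_Sbarinv A s t)]
  ext i l
  simp only [hE, h]

end Gr

/-! ### Wave functions and their time derivatives as members of the subspace -/

section Members

open Op

variable {N D : ℕ} [NeZero N] (A : TodaData N D) (n₀ : ℤ) (t : Times N D)

/-- The wave functions shifted by `v`, over the elementary factor at `s`. -/
noncomputable def shiftedWave (v s : Idx N → ℤ) (c : Idx N) : LaurentSeries ℂ :=
  mono (-v c) 1 * ofPS (PowerSeries.mk fun i => A.κ n₀ t c i (s + v))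

/-- The derivatives of the coefficients of the wave functions. -/
noncomputable def dκ (a : Idx N) (j : Fin D) (s : Idx N → ℤ) (c : Idx N) (i : ℕ) : ℂ :=
  fderiv ℂ (fun t' => A.κ n₀ t' c i s) t (timeDir a j)

/-- The time derivatives of the wave functions, over the elementary factor. -/
noncomputable def timeWave (a : Idx N) (j : Fin D) (s : Idx N → ℤ) (c : Idx N) :
    LaurentSeries ℂ :=
  (if a = c then mono (-((j : ℤ) + 1)) 1 else 0) *
    ofPS (PowerSeries.mk fun i => A.κ n₀ t c i s) + ofPS (PowerSeries.mk (dκ A n₀ t a j s c))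

variable {A n₀ t}

theorem act_S_entry {k : ℕ → ℤ → Mat N} {v₀ : ℤ} (d : Fin N → ℤ) (m : ℤ)
    (i l : Fin N) :
    act v₀ n₀ (row (down k) n₀) (fun m _ => Matrix.diagonal fun l => if m = d l then 1 else 0) m i l
      = down k (m - d l) n₀ i l := by
  obtain ⟨e, he⟩ := (Set.finite_range d).bddAbove
  have := act_diagonal (v := v₀) (x := n₀) (d := fun m _ l => if m = d l then (1 : ℂ) else 0)
    ((UB_down k).row n₀) (e := e) (fun l m hm x => if_neg (by have := he ⟨l, rfl⟩; omega)) m i l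
  rw [this]
  exact act_shift v₀ n₀ _ (d l) m

theorem coeff_mono_mul_mk (a r : ℤ) (c : ℂ) (k : ℕ → ℂ) :
    (mono a c * ofPS (PowerSeries.mk k)).coeff r =
      c * if a ≤ r then k (r - a).toNat else 0 := by
  rw [coeff_mono_mul, coeff_ofPS]
  simp only [sub_nonneg, PowerSeries.coeff_mk]

/-- The entries of the first row of `S`, through the coefficients of the wave functions. -/
theorem κ_inl_eq {s : Idx N → ℤ} (hφ : A.φ 0 n₀ s t = 1) (l : Fin N) (m : ℤ) :
    A.S s t m n₀ 0 l = if ν (Sum.inl l) ≤ -m then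
      A.κ n₀ t (Sum.inl l) (-m - ν (Sum.inl l)).toNat s else 0 := by
  rw [TodaData.S, down]
  by_cases hl : l = 0
  · subst hl
    simp only [ν, if_true, neg_nonneg, sub_zero, TodaData.κ]
    split_ifs <;> rfl
  · simp only [ν, hl, if_false, TodaData.κ]
    split_ifs with h1 h2 h2
    · congr 3; omega
    -- The offset by `ν` omits exactly the power `Λ⁰`, where the off-diagonal entry of `φ_0 = 1` is
    -- zero.
    · have : m = 0 := by omega
      subst this
      rw [neg_zero, Int.toNat_zero, hφ, Matrix.one_apply_ne (Ne.symm hl)]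
    · omega
    · rfl

theorem κ_inr_eq {s : Idx N → ℤ} (l : Fin N) (m : ℤ) :
    (down (fun i n => A.φbar i n s t) : Op ℤ (Mat N)) m n₀ 0 l = if 0 ≤ -m then
      A.κ n₀ t (Sum.inr l) (-m).toNat s else 0 := by
  rw [down]
  simp only [neg_nonneg, TodaData.κ]
  split_ifs <;> rfl

/-- The identity `W(s+v) W(s)⁻¹ = W̄(s+v) W̄(s)⁻¹` reads `r S⁻¹ = r̄ S̄⁻¹` when the factors `W₀(s+v)
W₀(s)⁻¹` are absorbed in the rows, where they shift the column `c` by `v_c`. -/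
theorem inGr_shiftedWave {dom : Set ((Idx N → ℤ) × Times N D)} (hA : SolvesFactorization A dom)
    {s v : Idx N → ℤ} (hs : (s, t) ∈ dom) (hsv : (s + v, t) ∈ dom) :
    InGr A n₀ s t (shiftedWave A n₀ t v s) := by
  have hc := hA.const_s s (s + v) t hs hsv
  rw [add_sub_cancel_left] at hc
  obtain ⟨e, he⟩ := (Set.finite_range fun l => v (Sum.inl l)).bddAbove
  obtain ⟨e', he'⟩ := (Set.finite_range fun l => v (Sum.inr l)).bddAbove
  have hr1 : UB (ratioW₀ v : Op ℤ (Mat N)) e := UB_diagonal fun l m hm x =>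
    if_neg (by have := he ⟨l, rfl⟩; simp only at this; omega)
  have hrefl : reflect (ratioW₀bar v : Op ℤ (Mat N)) =
      fun m _ => Matrix.diagonal fun k => if m = v (Sum.inr k) then 1 else 0 := by
    funext m x
    simp only [reflect, ratioW₀bar, neg_inj]
  have hr2 : UB (reflect (ratioW₀bar v : Op ℤ (Mat N))) e' := by
    rw [hrefl]
    exact UB_diagonal fun l m hm x =>
      if_neg (by have := he' ⟨l, rfl⟩; simp only at this; omega)
  refine InGr.of_rows (r := row (mul 1 (A.S (s + v) t) (ratioW₀ v)) n₀)
    (r' := row (mul (-1) (reflect (A.Sbar (s + v) t)) (reflect (ratioW₀bar v))) n₀)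
    (((UB_down _).mul hr1).row _)
    (UB.row (UB.mul (by rw [reflect_Sbar]; exact UB_down _) hr2) n₀) ?_ ?_ ?_
  · intro m l
    rw [row_mul, TodaData.S]
    change _ = act _ _ _ (fun m _ => Matrix.diagonal fun k => if m = v (Sum.inl k) then 1 else 0) _ _ _
    rw [act_S_entry (fun k => v (Sum.inl k)), ← TodaData.S, κ_inl_eq (hA.lead _ _ hsv _),
      shiftedWave, coeff_mono_mul_mk, one_mul]
    split_ifs with h1 h2 h2
    · congr 1; congr 1; omega
    · omega
    · omega
    · rfl
  · intro m l
    rw [row_mul, hrefl, reflect_Sbar, act_S_entry (fun k => v (Sum.inr k)), κ_inr_eq,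
      shiftedWave, coeff_mono_mul_mk, one_mul]
    split_ifs with h1 h2 h2
    · congr 1; congr 1; omega
    · omega
    · omega
    · rfl
  · intro m l
    rw [← row_mul, ← row_mul, ← reflect_mul, ← reflect_mul, hc]
    simp only [row, reflect, neg_neg]

theorem EΛ_eq_diagonal (k : Fin N) (j : ℤ) : (EΛ k j : Op ℤ (Mat N)) =
    fun m _ => Matrix.diagonal fun l => if l = k then (if m = j then 1 else 0) else 0 := by
  funext m x
  rw [EΛ]
  ext i l
  by_cases hm : m = j
  · by_cases hi : i = l
    · subst hi
      by_cases hk : i = k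
      · subst hk; simp [hm]
      · simp [hm, hk, Ne.symm hk]
    · rw [if_pos hm, Matrix.diagonal_apply_ne _ hi, Matrix.single_apply,
        if_neg (fun h => hi (h.1.symm.trans h.2))]
  · simp [hm]

theorem UB_EΛ (k : Fin N) (j : ℤ) : UB (EΛ k j : Op ℤ (Mat N)) j := fun m hm x => by
  rw [EΛ, if_neg hm.ne']

theorem act_EΛ {v₀ : ℤ} {r : ℤ → Mat N} {d : ℤ} (hr : URow r d) (k : Fin N) (j m : ℤ)
    (i l : Fin N) : act v₀ n₀ r (EΛ k j) m i l = if l = k then r (m - j) i l else 0 := by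
  rw [EΛ_eq_diagonal, act_diagonal hr (e := j)]
  · by_cases hl : l = k
    · simp only [hl, if_true]
      exact act_shift v₀ n₀ _ j m
    · simp only [hl, if_false, act, mul_zero, finsum_zero]
  · intro l m hm x
    simp only [hm.ne', if_false, ite_self]

theorem reflect_EΛ (k : Fin N) (j : ℤ) : reflect (EΛ k (-j) : Op ℤ (Mat N)) = EΛ k j := by
  funext m x
  simp only [reflect, EΛ, neg_inj]

theorem dκ_inl_eq {s : Idx N → ℤ} (hφ : ∀ᶠ t' in 𝓝 t, A.φ 0 n₀ s t' = 1) (a : Idx N) (j : Fin D)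
    (l : Fin N) (m : ℤ) : A.dS s t a j m n₀ 0 l = if ν (Sum.inl l) ≤ -m then
      dκ A n₀ t a j s (Sum.inl l) (-m - ν (Sum.inl l)).toNat else 0 := by
  rw [TodaData.dS, down]
  by_cases hl : l = 0
  · subst hl
    simp only [ν, if_true, neg_nonneg, sub_zero, dκ, TodaData.κ]
    split_ifs <;> rfl
  · simp only [ν, hl, if_false, dκ, TodaData.κ]
    split_ifs with h1 h2 _
    · rw [Matrix.of_apply]
      congr 3
      rw [show (-m).toNat = (-m - 1).toNat + 1 by omega]
    · have : m = 0 := by omega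
      subst this
      rw [neg_zero, Int.toNat_zero, Matrix.of_apply]
      -- The derivative of the omitted entry vanishes because the normalization `φ_0 = 1` holds in a
      -- neighbourhood of `t`.
      have : (fun t' => A.φ 0 n₀ s t' 0 l) =ᶠ[𝓝 t] fun _ => 0 := by
        filter_upwards [hφ] with t' ht'
        rw [ht', Matrix.one_apply_ne (Ne.symm hl)]
      rw [this.fderiv_eq]
      simp
    · omega
    · rfl

theorem dκ_inr_eq {s : Idx N → ℤ} (a : Idx N) (j : Fin D) (l : Fin N) (m : ℤ) :
    reflect (A.dSbar s t a j) m n₀ 0 l = if 0 ≤ -m then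
      dκ A n₀ t a j s (Sum.inr l) (-m).toNat else 0 := by
  rw [TodaData.dSbar, reflect_up, down]
  simp only [neg_nonneg, dκ, TodaData.κ]
  split_ifs <;> rfl

theorem coeff_timeWave (a : Idx N) (j : Fin D) (s : Idx N → ℤ) (c : Idx N) (r : ℤ) :
    (timeWave A n₀ t a j s c).coeff r = (if a = c then
      (if -((j : ℤ) + 1) ≤ r then A.κ n₀ t c (r + (j + 1)).toNat s else 0) else 0) +
      if 0 ≤ r then dκ A n₀ t a j s c r.toNat else 0 := by
  rw [timeWave, HahnSeries.coeff_add, coeff_ofPS, PowerSeries.coeff_mk]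
  congr 1
  split_ifs with h1 h2
  · rw [coeff_mono_mul_mk, if_pos h2, one_mul, sub_neg_eq_add]
  · rw [coeff_mono_mul_mk, if_neg h2, one_mul]
  · simp

/-- This is `∂W W⁻¹ = ∂W̄ W̄⁻¹`. The derivative of `W₀` contributes a term with `E_kk` on the side
of the differentiated time only, which becomes the pole in component `a`. -/
theorem inGr_timeWave {dom : Set ((Idx N → ℤ) × Times N D)} (hA : SolvesFactorization A dom)
    {s : Idx N → ℤ} (hs : ∀ᶠ t' in 𝓝 t, (s, t') ∈ dom) (a : Idx N) (j : Fin D) :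
    InGr A n₀ s t (timeWave A n₀ t a j s) := by
  have hst : (s, t) ∈ dom := hs.self_of_nhds
  have hc := hA.const_t s t hst a j
  have hφ : ∀ᶠ t' in 𝓝 t, A.φ 0 n₀ s t' = 1 := hs.mono fun t' h => hA.lead _ _ h _
  have hS : UB (A.S s t) 0 := UB_down _
  have hS' : UB (reflect (A.Sbar s t)) 0 := by rw [reflect_Sbar]; exact UB_down _
  have hd : UB (A.dS s t a j) 0 := UB_down _
  have hd' : UB (reflect (A.dSbar s t a j)) 0 := by
    rw [TodaData.dSbar, reflect_up]; exact UB_down _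
  have hc' : ∀ m, dWWinv A s t a j m n₀ = reflect (dWbarWbarinv A s t a j) (-m) n₀ := fun m => by
    rw [hc, reflect, neg_neg]
  obtain k | k := a
  · have h1 : UB (mul 1 (A.S s t) (EΛ k (j + 1))) (j + 1) := by
      simpa using hS.mul (UB_EΛ k (j + 1))
    have hd0 : UB (A.dS s t (Sum.inl k) j) (j + 1) := fun m hm => hd m (by omega)
    refine InGr.of_rows (r := fun m => row (A.dS s t (Sum.inl k) j) n₀ m +
        row (mul 1 (A.S s t) (EΛ k (j + 1))) n₀ m)
      (r' := row (reflect (A.dSbar s t (Sum.inl k) j)) n₀) (d := j + 1)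
      ((hd0.row n₀).add (h1.row n₀)) (hd'.row n₀) ?_ ?_ ?_
    · intro m l
      rw [coeff_timeWave, Matrix.add_apply, row_mul, act_EΛ (hS.row n₀), row, row,
        dκ_inl_eq hφ, κ_inl_eq hφ.self_of_nhds, add_comm]
      congr 1
      · simp only [sub_nonneg]
      · by_cases h : l = k
        · subst h
          rw [if_pos rfl, if_pos rfl]
          split_ifs with h1 h2 h2
          · congr 1; congr 1; omega
          · omega
          · omega
          · rfl
        · rw [if_neg h, if_neg (fun h' => h (Sum.inl_injective h').symm)]
    · intro m l
      rw [coeff_timeWave, row, dκ_inr_eq, if_neg (by simp), zero_add]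
    · intro m l
      have := congrFun (congrFun (hc' m) 0) l
      rw [dWWinv, dWbarWbarinv, add_zero, reflect_mul] at this
      rw [act_add_left (hd0.row n₀) (h1.row n₀) (UB_Sinv A s t)]
      exact this
  · have h1 : UB (mul (-1) (reflect (A.Sbar s t)) (EΛ k (j + 1))) (j + 1) := by
      simpa using hS'.mul (UB_EΛ k (j + 1))
    have hd0 : UB (reflect (A.dSbar s t (Sum.inr k) j)) (j + 1) := fun m hm => hd' m (by omega)
    refine InGr.of_rows (r := row (A.dS s t (Sum.inr k) j) n₀)
      (r' := fun m => row (reflect (A.dSbar s t (Sum.inr k) j)) n₀ m +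
        row (mul (-1) (reflect (A.Sbar s t)) (EΛ k (j + 1))) n₀ m) (d' := j + 1)
      (hd.row n₀)
      ((hd0.row n₀).add (h1.row n₀)) ?_ ?_ ?_
    · intro m l
      rw [coeff_timeWave, row, dκ_inl_eq hφ, if_neg (by simp), zero_add]
      simp only [sub_nonneg]
    · intro m l
      rw [coeff_timeWave, Matrix.add_apply, row_mul, act_EΛ (hS'.row n₀), row, row,
        dκ_inr_eq, reflect_Sbar, κ_inr_eq, add_comm]
      congr 1
      by_cases h : l = k
      · subst h
        rw [if_pos rfl, if_pos rfl]
        split_ifs with h1 h2 h2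
        · congr 1; congr 1; omega
        · omega
        · omega
        · rfl
      · rw [if_neg h, if_neg (fun h' => h (Sum.inr_injective h').symm)]
    · intro m l
      have := congrFun (congrFun (hc' m) 0) l
      rw [dWWinv, dWbarWbarinv, add_zero] at this
      rw [act_add_left (hd0.row n₀) (h1.row n₀) (UB_reflect_Sbarinv A s t)]
      have e1 := congrFun (congrFun (reflect_mul 1 (A.dSbar s t (Sum.inr k) j)
        (A.Sbarinv s t)) (-m)) n₀
      have e2 := congrFun (congrFun (reflect_dress 1 (A.Sbar s t) (A.Sbarinv s t)
        (EΛ k (-((j : ℤ) + 1)))) (-m)) n₀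
      rw [reflect_EΛ] at e2
      exact this.trans (congrArg₂ (fun P Q : Mat N => (P + Q) 0 l) e1 e2)

end Members

/-! ### The string equation as membership in the subspace -/

section StringMembers

open Op

variable {N D : ℕ} [NeZero N] (A : TodaData N D) (n₀ : ℤ) (t : Times N D)

/-- `ℳ_a^i ℒ_a^j Ψ_a` over the elementary factor. -/
noncomputable def orlovWave (s : Idx N → ℤ) (a : Idx N) (i : ℕ) (j : ℤ) : LaurentSeries ℂ :=
  mono (-j) 1 * (orlov a ((n₀ : ℂ) - ν a + sg a * s a) (t a))^[i]
    (ofPS (PowerSeries.mk fun i => A.κ n₀ t a i s))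

/-- `F(ℳ_a, ℒ_a) Ψ_a` over the elementary factor. -/
noncomputable def stringWave (F : ℕ → ℤ → ℂ) (s : Idx N → ℤ) (a : Idx N) : LaurentSeries ℂ :=
  toLaurent fun r => ∑ᶠ ij : ℕ × ℤ, (F ij.1 ij.2 • orlovWave A n₀ t s a ij.1 ij.2).coeff r

variable {A n₀ t}

theorem below_orlovWave (s : Idx N → ℤ) (a : Idx N) (i : ℕ) (j : ℤ) :
    Below (orlovWave A n₀ t s a i j) (-(D * i + j)) := by
  have h : Below (ofPS (PowerSeries.mk fun i => A.κ n₀ t a i s)) 0 := below_ofPS _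
  unfold orlovWave
  exact ((below_mono (-j) 1).mul (h.orlov_iterate i)).mono_le (by linarith)

theorem hasLSum_of_finiteAbove {F : ℕ → ℤ → ℂ} (hF : FiniteAbove D F)
    {u : ℕ → ℤ → LaurentSeries ℂ} (hu : ∀ i j, Below (u i j) (-(D * i + j))) :
    HasLSum (fun ij : ℕ × ℤ => F ij.1 ij.2 • u ij.1 ij.2)
      (toLaurent fun r => ∑ᶠ ij : ℕ × ℤ, (F ij.1 ij.2 • u ij.1 ij.2).coeff r) := by
  obtain ⟨d, -, hd⟩ := hF.exists_bound
  refine hasLSum_toLaurent (a := -d) (fun ij r hr => ?_) (fun r => ?_)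
  · by_cases h : F ij.1 ij.2 = 0
    · simp [h]
    · rw [HahnSeries.coeff_smul, hu _ _ r (by have := hd _ _ h; omega), smul_zero]
  · refine (hF (-r)).subset fun ij hij => ?_
    simp only [Set.mem_ofPred_eq, HahnSeries.coeff_smul] at hij ⊢
    refine ⟨fun h => hij (by simp [h]), ?_⟩
    by_contra h
    exact hij (by rw [hu _ _ r (by omega), smul_zero])

theorem coeff_stringWave {F : ℕ → ℤ → ℂ} (hF : FiniteAbove D F) (s : Idx N → ℤ) (a : Idx N)
    (r : ℤ) : (stringWave A n₀ t F s a).coeff r =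
      ∑ᶠ ij : ℕ × ℤ, F ij.1 ij.2 * (orlovWave A n₀ t s a ij.1 ij.2).coeff r := by
  exact ((hasLSum_of_finiteAbove hF (below_orlovWave s a)).2 r).2

theorem coeff_orlovWave (s : Idx N → ℤ) (a : Idx N) (i : ℕ) (j r : ℤ) :
    (orlovWave A n₀ t s a i j).coeff r = ((orlov a ((n₀ : ℂ) - ν a + sg a * s a) (t a))^[i]
      (ofPS (PowerSeries.mk fun i => A.κ n₀ t a i s))).coeff (r + j) := by
  rw [orlovWave, coeff_mono_mul, one_mul, sub_neg_eq_add]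

theorem vacOrlov_eq (s : Idx N → ℤ) (t : Times N D) : (vacOrlov s t : Op ℤ (Mat N)) =
    fun m (n : ℤ) => Matrix.diagonal fun l => (if m = 0 then (n : ℂ) + s (Sum.inl l) else 0) +
      ∑ j : Fin D, if m = (j : ℤ) + 1 then ((j : ℂ) + 1) * t (Sum.inl l) j else 0 := by
  funext m n
  rw [vacOrlov]
  split_ifs with h
  · rw [Matrix.diagonal_add]
  · rw [zero_add]; simp

theorem reflect_vacOrlovbar_eq (s : Idx N → ℤ) (t : Times N D) :
    reflect (vacOrlovbar s t : Op ℤ (Mat N)) =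
    fun m (n : ℤ) => Matrix.diagonal fun l => (if m = 0 then (n : ℂ) - s (Sum.inr l) else 0) +
      ∑ j : Fin D, if m = (j : ℤ) + 1 then -(((j : ℂ) + 1) * t (Sum.inr l) j) else 0 := by
  funext m n
  have h1 : ∀ l, ∑ j : Fin D, (if m = (j : ℤ) + 1 then -(((j : ℂ) + 1) * t (Sum.inr l) j) else 0) =
      -∑ j : Fin D, (if -m = -((j : ℤ) + 1) then ((j : ℂ) + 1) * t (Sum.inr l) j else 0) := by
    intro l
    rw [← Finset.sum_neg_distrib]
    refine Finset.sum_congr rfl fun j _ => ?_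
    by_cases h : m = (j : ℤ) + 1
    · rw [if_pos h, if_pos (by omega)]
    · rw [if_neg h, if_neg (by omega), neg_zero]
  simp only [h1, reflect, vacOrlovbar, neg_eq_zero]
  split_ifs with h
  · rw [Matrix.diagonal_sub]
    simp only [sub_eq_add_neg]
  · rw [zero_sub]
    simp only [zero_add]
    rw [← Matrix.diagonal_neg]

theorem UB_vacOrlov (s : Idx N → ℤ) (t : Times N D) : UB (vacOrlov s t : Op ℤ (Mat N)) D := by
  rw [vacOrlov_eq]
  exact UB_diagonal fun l => UB_vacuum _ _

theorem UB_reflect_vacOrlovbar (s : Idx N → ℤ) (t : Times N D) :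
    UB (reflect (vacOrlovbar s t : Op ℤ (Mat N))) D := by
  rw [reflect_vacOrlovbar_eq]
  exact UB_diagonal fun l => UB_vacuum (fun n : ℤ => (n : ℂ) - s (Sum.inr l)) _

theorem diagonal_vacuum_of_neg {g : Fin N → ℤ → ℂ} {e : Fin N → Fin D → ℂ} (m : ℤ) (hm : m < 0)
    (n : ℤ) : (Matrix.diagonal fun l => (if m = 0 then g l n else 0) +
      ∑ j : Fin D, if m = (j : ℤ) + 1 then e l j else 0 : Mat N) = 0 := by
  have : (fun l => (if m = 0 then g l n else 0) +
      ∑ j : Fin D, if m = (j : ℤ) + 1 then e l j else 0) = 0 :=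
    funext fun l => vacuum_of_neg (g l) (e l) m hm n
  rw [this]; exact Matrix.diagonal_zero

/-- Right multiplication by `W₀ n W₀⁻¹` is diagonal in the columns; in column `l` the variable `n`
becomes the exponent of the corresponding power of `y`, which produces the derivation in `orlov`. -/
theorem iterRow_vacOrlov {s : Idx N → ℤ} (hφ : A.φ 0 n₀ s t = 1) (i : ℕ) (m : ℤ) (l : Fin N) :
    iterRow 1 n₀ (fun i n => A.φ i n s t) (vacOrlov s t) i m 0 l =
      ((orlov (Sum.inl l) ((n₀ : ℂ) - ν (Sum.inl l) + sg (Sum.inl l) * s (Sum.inl l))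
        (t (Sum.inl l)))^[i] (ofPS (PowerSeries.mk fun i => A.κ n₀ t (Sum.inl l) i s))).coeff
        (-m - ν (Sum.inl l)) := by
  induction i generalizing m with
  | zero =>
    change A.S s t m n₀ 0 l = _
    rw [κ_inl_eq hφ, Function.iterate_zero, id, coeff_ofPS]
    simp only [sub_nonneg, PowerSeries.coeff_mk]
  | succ i ih =>
    rw [iterRow_succ, Function.iterate_succ_apply', coeff_orlov]
    nth_rewrite 2 [vacOrlov_eq s t]
    rw [act_diagonal (URow_iterRow (UB_vacOrlov s t) i) (fun l => UB_vacuum _ _),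
      act_vacuum 1 n₀ _ (fun n : ℤ => (n : ℂ) + s (Sum.inl l))]
    simp only [ih, sg]
    congr 1
    · simp only [smul_eq_mul, mul_one]; push_cast; ring
    · refine Finset.sum_congr rfl fun j _ => ?_
      rw [show -(m - ((j : ℤ) + 1)) - ν (Sum.inl l) = -m - ν (Sum.inl l) + (j + 1) by ring]
      push_cast; ring

theorem iterRow_vacOrlovbar {s : Idx N → ℤ} (i : ℕ) (m : ℤ) (l : Fin N) :
    iterRow (-1) n₀ (fun i n => A.φbar i n s t) (reflect (vacOrlovbar s t)) i m 0 l =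
      ((orlov (Sum.inr l) ((n₀ : ℂ) - ν (Sum.inr l) + sg (Sum.inr l) * s (Sum.inr l))
        (t (Sum.inr l)))^[i] (ofPS (PowerSeries.mk fun i => A.κ n₀ t (Sum.inr l) i s))).coeff
        (-m) := by
  induction i generalizing m with
  | zero =>
    change (down (fun i n => A.φbar i n s t) : Op ℤ (Mat N)) m n₀ 0 l = _
    rw [κ_inr_eq, Function.iterate_zero, id, coeff_ofPS]
    simp only [PowerSeries.coeff_mk]
  | succ i ih =>
    rw [iterRow_succ, Function.iterate_succ_apply', coeff_orlov]
    nth_rewrite 2 [reflect_vacOrlovbar_eq s t]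
    rw [act_diagonal (URow_iterRow (UB_reflect_vacOrlovbar s t) i)
      (fun l => UB_vacuum (fun n : ℤ => (n : ℂ) - s (Sum.inr l)) _),
      act_vacuum (-1) n₀ _ (fun n : ℤ => (n : ℂ) - s (Sum.inr l))]
    simp only [ih, sg, ν]
    congr 1
    · simp only [smul_eq_mul, mul_neg, mul_one]; push_cast; ring
    · refine Finset.sum_congr rfl fun j _ => ?_
      rw [show -(m - ((j : ℤ) + 1)) = -m + (j + 1) by ring]
      push_cast; ring

/-- `m ↦ ∑_{ij} F_{ij} (K V^i T^j)_m` has finitely many nonzero terms. -/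
theorem finite_support_iterRow {Γ R : Type*} [AddCommGroup Γ] [Ring R] [Algebra ℂ R] {v x : Γ}
    {k : ℕ → Γ → R} {V : Op Γ R} (hV : UB V D) {F : ℕ → ℤ → ℂ} (hF : FiniteAbove D F) (m : ℤ) :
    (Function.support fun ij : ℕ × ℤ => F ij.1 ij.2 • iterRow v x k V ij.1 (m - ij.2)).Finite := by
  refine (hF m).subset fun ij hij => ⟨fun h => hij (by simp [h]), ?_⟩
  by_contra h
  refine hij ?_
  simp only
  rw [URow_iterRow hV ij.1 _ (by linarith), smul_zero]

theorem entry_finsum {ι : Type*} {f : ι → Mat N} (hf : (Function.support f).Finite) (i l : Fin N) :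
    (∑ᶠ p, f p) i l = ∑ᶠ p, f p i l :=
  AddMonoidHom.map_finsum (Matrix.entryAddMonoidHom ℂ i l) hf

theorem actsAs_dress {Γ R : Type*} [AddCommGroup Γ] [Ring R] {v x : Γ} {k : ℕ → Γ → R}
    {V : Op Γ R} {D : ℤ} (hV : UB V D) :
    ActsAs v x k (dress v (down k) (down (invCoeff (-v) k)) V) V :=
  fun _ _ _ hr hu => act_dress hr hV hu

/-- The entries of the first row of `F(M, L) S`, where all leading coefficients are invertible. -/
theorem act_eval₂_entry {v₀ : ℤ} {k : ℕ → ℤ → Mat N} {V : Op ℤ (Mat N)} (hV : UB V D)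
    (hV0 : ∀ j < 0, ∀ x, V j x = 0) {F : ℕ → ℤ → ℂ} (hF : FiniteAbove D F)
    (hu : ∀ n, IsUnit (k 0 n)) (m : ℤ) (l : Fin N) :
    act v₀ n₀ (row (eval₂ v₀ F (dress v₀ (down k) (down (invCoeff (-v₀) k)) V)
      (dress v₀ (down k) (down (invCoeff (-v₀) k)) (shift 1))
      (dress v₀ (down k) (down (invCoeff (-v₀) k)) (shift (-1)))) n₀) (down k) m 0 l =
      ∑ᶠ ij : ℕ × ℤ, F ij.1 ij.2 * iterRow v₀ n₀ k V ij.1 (m - ij.2) 0 l := by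
  -- All leading coefficients are invertible here, so the window only has to be large enough for the
  -- finitely many terms that reach column `m`.
  obtain ⟨B, hB⟩ := ((hF m).image fun ij : ℕ × ℤ => (D : ℤ) * ij.1 + |ij.2|).bddAbove
  have hB' : ∀ i j, F i j ≠ 0 → m ≤ D * i + j → (D : ℤ) * i + |j| ≤ B := fun i j h1 h2 =>
    hB ⟨(i, j), ⟨h1, h2⟩, rfl⟩
  rw [act_eval₂ (lo := m - B) (hi := m + B) hV.dress (actsAs_dress hV) hV hV0 hF
    (fun m _ _ => hu _), entry_finsum (finite_support_iterRow hV hF m)]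
  · rfl
  · intro i j h1 h2
    have := hB' i j h1 h2
    have h3 : (0 : ℤ) ≤ D * i := by positivity
    constructor <;> linarith

/-- Since `C_kk = S E_kk S⁻¹`, the left side of the string equation is `r S⁻¹` with `r` the first
row of `∑_k F_k(M, L) S E_kk`; the right side is of the same form. Column `k` of `r` is the series
of `F_k(ℳ_k, ℒ_k) Ψ_k`. -/
theorem inGr_stringWave {dom : Set ((Idx N → ℤ) × Times N D)} (hA : SolvesFactorization A dom)
    {s : Idx N → ℤ} (hs : (s, t) ∈ dom) {F : Idx N → ℕ → ℤ → ℂ} (hF : ∀ a, FiniteAbove D (F a))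
    (hstr : A.StringEq s t F) :
    InGr A n₀ s t fun a => stringWave A n₀ t (F a) s a := by
  have hφ := hA.lead s t hs
  choose d _ hd using fun a => (hF a).exists_bound
  obtain ⟨e, he⟩ := (Set.finite_range d).bddAbove
  have hd' : ∀ a i j, F a i j ≠ 0 → (D : ℤ) * i + j ≤ e := fun a i j h =>
    (hd a i j h).trans (he ⟨a, rfl⟩)
  set k₁ : ℕ → ℤ → Mat N := fun i n => A.φ i n s t with hk₁
  set k₂ : ℕ → ℤ → Mat N := fun i n => A.φbar i n s t with hk₂
  set V₁ : Op ℤ (Mat N) := vacOrlov s t with hV₁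
  set V₂ : Op ℤ (Mat N) := reflect (vacOrlovbar s t) with hV₂
  have uV₁ : UB V₁ D := UB_vacOrlov s t
  have uV₂ : UB V₂ D := UB_reflect_vacOrlovbar s t
  have nV₁ : ∀ j < 0, ∀ x, V₁ j x = 0 := fun j hj x => by
    rw [hV₁, vacOrlov_eq]
    exact diagonal_vacuum_of_neg (g := fun l n => (n : ℂ) + s (Sum.inl l)) j hj x
  have nV₂ : ∀ j < 0, ∀ x, V₂ j x = 0 := fun j hj x => by
    rw [hV₂, reflect_vacOrlovbar_eq]
    exact diagonal_vacuum_of_neg (g := fun l n => (n : ℂ) - s (Sum.inr l)) j hj x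
  set X₁ : Fin N → Op ℤ (Mat N) := fun l =>
    eval₂ 1 (F (Sum.inl l)) (dress 1 (down k₁) (down (invCoeff (-1) k₁)) V₁)
      (dress 1 (down k₁) (down (invCoeff (-1) k₁)) (shift 1))
      (dress 1 (down k₁) (down (invCoeff (-1) k₁)) (shift (-1))) with hX₁
  set X₂ : Fin N → Op ℤ (Mat N) := fun l =>
    eval₂ (-1) (F (Sum.inr l)) (dress (-1) (down k₂) (down (invCoeff (-(-1)) k₂)) V₂)
      (dress (-1) (down k₂) (down (invCoeff (-(-1)) k₂)) (shift 1))
      (dress (-1) (down k₂) (down (invCoeff (-(-1)) k₂)) (shift (-1))) with hX₂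
  have u₁ : ∀ l, URow (act 1 n₀ (row (X₁ l) n₀) (down k₁)) e := fun l => by
    have := ((UB_eval₂ (v := (1 : ℤ)) (k := k₁)
      (M := dress 1 (down k₁) (down (invCoeff (-1) k₁)) V₁) uV₁.dress (hd' (Sum.inl l))).row n₀).act
      (v := (1 : ℤ)) (x := n₀) (UB_down k₁)
    rwa [add_zero] at this
  have u₂ : ∀ l, URow (act (-1) n₀ (row (X₂ l) n₀) (down k₂)) e := fun l => by
    have := ((UB_eval₂ (v := (-1 : ℤ)) (k := k₂)
      (M := dress (-1) (down k₂) (down (invCoeff (-(-1)) k₂)) V₂) uV₂.dress (hd' (Sum.inr l))).row n₀).act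
      (v := (-1 : ℤ)) (x := n₀) (UB_down k₂)
    rwa [add_zero] at this
  have w₁ : ∀ l, URow (act 1 n₀ (act 1 n₀ (row (X₁ l) n₀) (down k₁)) (EΛ l 0)) e := fun l => by
    have := (u₁ l).act (v := (1 : ℤ)) (x := n₀) (UB_EΛ l 0)
    rwa [add_zero] at this
  have w₂ : ∀ l, URow (act (-1) n₀ (act (-1) n₀ (row (X₂ l) n₀) (down k₂)) (EΛ l 0)) e :=
    fun l => by
      have := (u₂ l).act (v := (-1 : ℤ)) (x := n₀) (UB_EΛ l 0)
      rwa [add_zero] at this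
  refine InGr.of_rows
    (r := fun m => ∑ l, act 1 n₀ (act 1 n₀ (row (X₁ l) n₀) (down k₁)) (EΛ l 0) m)
    (r' := fun m => ∑ l, act (-1) n₀ (act (-1) n₀ (row (X₂ l) n₀) (down k₂)) (EΛ l 0) m)
    (d := e) (d' := e)
    (fun j hj => Finset.sum_eq_zero fun l _ => w₁ l j hj)
    (fun j hj => Finset.sum_eq_zero fun l _ => w₂ l j hj) ?_ ?_ ?_
  · intro m l
    rw [Matrix.sum_apply]
    simp only [act_EΛ (u₁ _)]
    rw [Finset.sum_ite_eq, if_pos (Finset.mem_univ _), sub_zero, hX₁,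
      act_eval₂_entry uV₁ nV₁ (hF _) (fun n => by rw [hk₁]; simp only [hφ n]; exact isUnit_one),
      coeff_stringWave (hF _)]
    refine finsum_congr fun ij => ?_
    rw [coeff_orlovWave, iterRow_vacOrlov (hφ n₀)]
    congr 2
    ring
  · intro m l
    rw [Matrix.sum_apply]
    simp only [act_EΛ (u₂ _)]
    rw [Finset.sum_ite_eq, if_pos (Finset.mem_univ _), sub_zero, hX₂,
      act_eval₂_entry uV₂ nV₂ (hF _) (fun n => hA.lead_bar s t hs n),
      coeff_stringWave (hF _)]
    refine finsum_congr fun ij => ?_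
    rw [coeff_orlovWave, iterRow_vacOrlovbar]
    congr 2
    ring
  · intro m l
    rw [act_sum _ (fun i _ => w₁ i) (UB_Sinv A s t),
      act_sum _ (fun i _ => w₂ i) (UB_reflect_Sbarinv A s t)]
    have h1 : ∀ i, act 1 n₀ (act 1 n₀ (act 1 n₀ (row (X₁ i) n₀) (down k₁)) (EΛ i 0))
        (A.Sinv s t) m = mul 1 (eval₂ 1 (F (Sum.inl i)) (A.M s t) (A.L s t) (A.Linv s t))
        (A.C s t i) m n₀ := fun i =>
      (mul_eval₂_dress uV₁.dress (UB_EΛ i 0) (hF _) m).symm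
    have h2 : ∀ i, act (-1) n₀ (act (-1) n₀ (act (-1) n₀ (row (X₂ i) n₀) (down k₂)) (EΛ i 0))
        (reflect (A.Sbarinv s t)) (-m) =
        mul 1 (eval₂ 1 (F (Sum.inr i)) (A.Mbar s t) (A.Lbarinv s t) (A.Lbar s t))
        (A.Cbar s t i) m n₀ := fun i => by
      -- Reflection turns `L̄⁻¹` into the dressed forward shift, which matches its place as second
      -- argument of `F_k̄`.
      have hs1 : reflect (shift (-1) : Op ℤ (Mat N)) = shift 1 := by rw [reflect_shift, neg_neg]
      have hE0 : reflect (EΛ i 0 : Op ℤ (Mat N)) = EΛ i 0 := by simpa using reflect_EΛ i 0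
      have e1 := congrFun (congrFun (reflect_mul 1
        (eval₂ 1 (F (Sum.inr i)) (A.Mbar s t) (A.Lbarinv s t) (A.Lbar s t))
        (A.Cbar s t i)) (-m)) n₀
      rw [reflect_eval₂, TodaData.Mbar, TodaData.Lbarinv, TodaData.Lbar, TodaData.Cbar,
        reflect_dress, reflect_dress, reflect_dress, reflect_dress, reflect_Sbar,
        reflect_Sbarinv, hs1, reflect_shift, hE0, mul_eval₂_dress uV₂.dress (UB_EΛ i 0) (hF _)] at e1
      rw [reflect_Sbarinv, ← e1, reflect, neg_neg]
      rfl
    simp only [h1, h2]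
    exact hstr m n₀ l

end StringMembers

/-! ### Scalar operators acting on the wave functions -/

section Scalar

open Op

variable {N D : ℕ} [NeZero N] {A : TodaData N D} {n₀ : ℤ} {t : Times N D}

/-- `n₀ - ν_a + sg(a) (s_a + ∑_j j t_{ja} 𝒯_a^j)`. -/
def scalarVac (n₀ : ℤ) (t : Times N D) (a : Idx N) : Op (Idx N → ℤ) ℂ := fun m s =>
  (if m = 0 then (n₀ : ℂ) - ν a + sg a * s a else 0) +
    ∑ j : Fin D, if m = (j : ℤ) + 1 then sg a * (((j : ℂ) + 1) * t a j) else 0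

theorem UB_scalarVac (a : Idx N) : UB (scalarVac n₀ t a) D :=
  UB_vacuum (fun s : Idx N → ℤ => (n₀ : ℂ) - ν a + sg a * s a) _

theorem UB_scalarM (v : Idx N → ℤ) (a : Idx N) : UB (A.scalarM n₀ t v a) D := fun m hm s => by
  have h := (UB_vacuum (fun s' : Idx N → ℤ => (s' a : ℂ))
    (fun j : Fin D => ((j : ℂ) + 1) * t a j)).dress (v := v) (k := A.κ n₀ t a)
    (h := invCoeff (-v) (A.κ n₀ t a)) m hm s
  have h0 : ¬ m = 0 := by omega
  rw [TodaData.scalarM, if_neg h0, zero_add]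
  exact mul_eq_zero_of_right _ h

/-- The scalar `n₀ - ν_a` commutes with the dressing, so it can be moved to the bare operator. -/
theorem actsAs_scalarM (v s : Idx N → ℤ) (a : Idx N) :
    ActsAs v s (A.κ n₀ t a) (A.scalarM n₀ t v a) (scalarVac n₀ t a) := by
  intro r d m hr hu
  set V0 : Op (Idx N → ℤ) ℂ := fun m' s' => (if m' = 0 then (s' a : ℂ) else 0) +
        ∑ j : Fin D, if m' = (j : ℤ) + 1 then ((j : ℂ) + 1) * t a j else 0 with hV0
  have uV0 : UB V0 D := UB_vacuum (fun s' : Idx N → ℤ => (s' a : ℂ)) _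
  set c : ℂ := (n₀ : ℂ) - ν a with hc
  have uX : UB (dress v (A.K n₀ t a) (A.Kinv n₀ t v a) V0) D := uV0.dress
  have e1 : act v s r (A.scalarM n₀ t v a) = fun m => c * r m +
      (sg a : ℂ) * act v s r (dress v (A.K n₀ t a) (A.Kinv n₀ t v a) V0) m := by
    funext m'
    rw [act_eq_sum hr (UB_scalarM v a) (Finset.Subset.refl _),
      act_eq_sum hr uX (Finset.Subset.refl _), Finset.mul_sum]
    have : ∀ i ∈ Finset.Icc (m' - (D : ℤ)) d, r i * A.scalarM n₀ t v a (m' - i) (s + i • v) =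
        (r i * if m' - i = 0 then c else 0) +
        (sg a : ℂ) * (r i * dress v (A.K n₀ t a) (A.Kinv n₀ t v a) V0 (m' - i) (s + i • v)) := by
      intro i _
      rw [TodaData.scalarM]
      ring
    rw [Finset.sum_congr rfl this, Finset.sum_add_distrib]
    congr 1
    rw [Finset.sum_eq_single m']
    · simp [mul_comm]
    · intro i _ hi
      rw [if_neg (by omega), mul_zero]
    · intro h
      rw [hr m' (by rw [Finset.mem_Icc] at h; omega), zero_mul]
  have hrX := hr.act (v := v) (x := s) uX
  have hr1 : URow (fun m => c * r m) (d + D) := fun j hj => by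
    simp only [hr j (by omega), mul_zero]
  have hr2 : URow (fun m => (sg a : ℂ) *
      act v s r (dress v (A.K n₀ t a) (A.Kinv n₀ t v a) V0) m) (d + D) := fun j hj => by
    simp only [hrX j hj, mul_zero]
  rw [e1, act_add_left hr1 hr2 (UB_down _), act_left_mul hr (UB_down _),
    act_left_mul hrX (UB_down _)]
  simp only
  rw [show act v s (act v s r (dress v (A.K n₀ t a) (A.Kinv n₀ t v a) V0))
    (down (A.κ n₀ t a)) m = _ from act_dress hr uV0 hu]
  rw [hV0, act_vacuum v s _ (fun s' : Idx N → ℤ => (s' a : ℂ))]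
  unfold scalarVac
  rw [act_vacuum v s _ (fun s' : Idx N → ℤ => (n₀ : ℂ) - ν a + sg a * s' a), mul_add,
    Finset.mul_sum, ← add_assoc]
  congr 1
  · ring
  · refine Finset.sum_congr rfl fun j _ => ?_
    ring

theorem act_scalarVac (v s : Idx N → ℤ) (r : ℤ → ℂ) (a : Idx N) (m : ℤ) :
    act v s r (scalarVac n₀ t a) m =
      r m * ((n₀ : ℂ) - ν a + sg a * (s + m • v) a) +
        ∑ j : Fin D, r (m - ((j : ℤ) + 1)) * (sg a * (((j : ℂ) + 1) * t a j)) :=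
  act_vacuum v s r (fun s' : Idx N → ℤ => (n₀ : ℂ) - ν a + sg a * s' a) _ m

/-- Because `v_a = 1`, the value of `s_a` grows by one per column and plays the part of `n`. The
outcome is the same series as for the matrix operators, which links the string equation with `F(ℳ_a,
ℒ_a)`. -/
theorem iterRow_scalarVac {v : Idx N → ℤ} {a : Idx N} (hv : v a = 1) (s : Idx N → ℤ) (i : ℕ)
    (m : ℤ) : iterRow v s (A.κ n₀ t a) (scalarVac n₀ t a) i m =
      ((orlov a ((n₀ : ℂ) - ν a + sg a * s a) (t a))^[i]
        (ofPS (PowerSeries.mk fun i => A.κ n₀ t a i s))).coeff (-m) := by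
  induction i generalizing m with
  | zero =>
    change down (A.κ n₀ t a) m s = _
    rw [Function.iterate_zero, id, coeff_ofPS, down]
    simp only [neg_nonneg, PowerSeries.coeff_mk]
  | succ i ih =>
    rw [iterRow_succ, Function.iterate_succ_apply', coeff_orlov]
    rw [act_scalarVac]
    simp only [ih]
    congr 1
    · simp only [Pi.add_apply, Pi.smul_apply, hv, smul_eq_mul, mul_one]; push_cast; ring
    · refine Finset.sum_congr rfl fun j _ => ?_
      rw [show -(m - ((j : ℤ) + 1)) = -m + (j + 1) by ring]
      ring

theorem UB_scalarF (v : Idx N → ℤ) (a : Idx N) {F : ℕ → ℤ → ℂ} {d : ℤ}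
    (hd : ∀ i j, F i j ≠ 0 → (D : ℤ) * i + j ≤ d) : UB (A.scalarF n₀ t v F a) d :=
  UB_eval₂ (UB_scalarM v a) hd

/-- `F(ℳ_a, ℒ_a)` acts on `Ψ_a` as expected, for coefficients whose columns lie in the domain. -/
theorem act_scalarF {v : Idx N → ℤ} {a : Idx N} (hv : v a = 1) {F : ℕ → ℤ → ℂ}
    (hF : FiniteAbove D F) (s : Idx N → ℤ) {lo hi : ℤ}
    (hu : ∀ m, lo ≤ m → m ≤ hi → A.κ n₀ t a 0 (s + m • v) ≠ 0) (m : ℤ)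
    (hm : ∀ i j, F i j ≠ 0 → m ≤ D * i + j → lo + D * i + |j| ≤ m ∧ m ≤ hi - |j|) :
    act v s (row (A.scalarF n₀ t v F a) s) (A.K n₀ t a) m =
      (stringWave A n₀ t F s a).coeff (-m) := by
  have := act_eval₂ (UB_scalarM v a) (actsAs_scalarM v s a) (UB_scalarVac (n₀ := n₀) (t := t) a)
    (fun j hj x => vacuum_of_neg (fun s : Idx N → ℤ => (n₀ : ℂ) - ν a + sg a * s a) _ j hj x)
    hF (fun m h1 h2 => (hu m h1 h2).isUnit) m hm
  refine this.trans ?_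
  rw [coeff_stringWave hF]
  refine finsum_congr fun ij => ?_
  rw [coeff_orlovWave, iterRow_scalarVac hv, smul_eq_mul]
  congr 2
  ring

theorem UB_scalarL_pow (v : Idx N → ℤ) (a : Idx N) (n : ℕ) :
    UB (Op.pow v (A.scalarL n₀ t v a) n) n := by
  have h : UB (A.scalarL n₀ t v a) 1 := (UB_shift 1).dress
  simpa using h.pow n

theorem act_scalarL_pow (v : Idx N → ℤ) (a : Idx N) (s : Idx N → ℤ) {lo hi : ℤ}
    (hu : ∀ m, lo ≤ m → m ≤ hi → A.κ n₀ t a 0 (s + m • v) ≠ 0) (n : ℕ) (m : ℤ)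
    (h1 : lo + n ≤ m) (h2 : m ≤ hi - n) :
    act v s (row (Op.pow v (A.scalarL n₀ t v a) n) s) (A.K n₀ t a) m =
      (mono (-n) 1 * ofPS (PowerSeries.mk fun i => A.κ n₀ t a i s)).coeff (-m) := by
  have h0 : URow (row (shift 0 : Op (Idx N → ℤ) ℂ) s) 0 := (UB_shift 0).row s
  have h3 := act_pow_shift (v := v) (k := A.κ n₀ t a) h0 1 (by simp)
    (fun m h1 h2 => (hu m h1 h2).isUnit) n m h1 h2
  have h4 : act v s (row (shift 0) s) (Op.pow v (A.scalarL n₀ t v a) n) =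
      row (Op.pow v (A.scalarL n₀ t v a) n) s := by
    funext j
    exact act_row_one _ _
  rw [← h4]
  refine h3.trans ?_
  rw [act_row_one, coeff_mono_mul_mk, down, one_mul, mul_one]
  split_ifs with h5 h6 h6
  · congr 1; congr 1; omega
  · omega
  · omega
  · rfl

/-! ## The ratio of wave functions -/

/-- The numerator of `waveRatio`. -/
noncomputable def waveNum (v : Idx N → ℤ) (X : Op (Idx N → ℤ) ℂ) (κ : ℕ → (Idx N → ℤ) → ℂ)
    (s : Idx N → ℤ) : LaurentSeries ℂ := toLaurent fun r => act v s (row X s) (down κ) (-r)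

theorem waveRatio_eq {v : Idx N → ℤ} {b : Idx N} (hv : v b = 1) (X : Op (Idx N → ℤ) ℂ)
    (κ : ℕ → (Idx N → ℤ) → ℂ) (s : Idx N → ℤ) :
    waveRatio v X κ b s = waveNum v X κ s / ofPS (PowerSeries.mk fun i => κ i s) := by
  rw [waveRatio, waveNum]
  congr 2
  funext r
  refine finsum_congr fun j => ?_
  rw [hv, mul_one, row, down]
  congr 1
  split_ifs with h1 h2 h2
  · congr 1; congr 1; omega
  · omega
  · omega
  · rfl

theorem coeff_waveNum {v : Idx N → ℤ} {X : Op (Idx N → ℤ) ℂ} {κ : ℕ → (Idx N → ℤ) → ℂ}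
    {s : Idx N → ℤ} {d : ℤ} (hX : URow (row X s) d) (r : ℤ) :
    (waveNum v X κ s).coeff r = act v s (row X s) (down κ) (-r) := by
  rw [waveNum, toLaurent_coeff (a := -d)]
  intro i hi
  have := hX.act (v := v) (x := s) (UB_down κ) (-i) (by omega)
  exact this

/-- Multiplication by a series without poles only uses coefficients up to the same degree. Agreement
of numerators up to degree `r`, which is all that a finite window provides, is therefore enough. -/
theorem coeff_mul_congr {f f' g : LaurentSeries ℂ} {r : ℤ} (hg : Below g 0)
    (h : ∀ i ≤ r, f.coeff i = f'.coeff i) : (f * g).coeff r = (f' * g).coeff r := by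
  have hf := (below_order f).mono_le (min_le_left f.order f'.order)
  have hf' := (below_order f').mono_le (min_le_right f.order f'.order)
  rw [coeff_mul_Icc hf hg, coeff_mul_Icc hf' hg]
  refine Finset.sum_congr rfl fun i hi => ?_
  rw [Finset.mem_Icc] at hi
  rw [h i (by omega)]

theorem coeff_shiftedWave (v s : Idx N → ℤ) (c : Idx N) (r : ℤ) :
    (shiftedWave A n₀ t v s c).coeff r =
      if -v c ≤ r then A.κ n₀ t c (r + v c).toNat (s + v) else 0 := by
  rw [shiftedWave, coeff_mono_mul_mk, one_mul, sub_neg_eq_add]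

theorem below_shiftedWave (v s : Idx N → ℤ) (c : Idx N) :
    Below (shiftedWave A n₀ t v s c) (-v c) := fun r hr => by
  rw [coeff_shiftedWave, if_neg (by omega)]

theorem act_K_eq_sum {v : Idx N → ℤ} {a : Idx N} (hv : v a = 1) {X : ℤ → ℂ} {d : ℤ}
    (hX : URow X d) (s : Idx N → ℤ) {r b : ℤ} (hb : b ≤ -r) :
    act v s X (A.K n₀ t a) (-r) =
      ∑ j ∈ Finset.Icc b d, X j * (shiftedWave A n₀ t (j • v) s a).coeff r := by
  rw [TodaData.K, act_eq_sum hX (UB_down _) (s := Finset.Icc b d) (Finset.Icc_subset_Icc (by omega) le_rfl)]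
  refine Finset.sum_congr rfl fun j _ => ?_
  rw [coeff_shiftedWave, down]
  simp only [Pi.smul_apply, hv, smul_eq_mul, mul_one]
  congr 1
  split_ifs with h1 h2 h2
  · congr 1; congr 1; omega
  · omega
  · omega
  · rfl

/-- The coefficients of `X(Ψ_a) / Ψ_a` for an operator that is bounded above. -/
theorem coeff_waveRatio {v : Idx N → ℤ} {a : Idx N} (hv : v a = 1) {X : Op (Idx N → ℤ) ℂ} {d : ℤ}
    {s : Idx N → ℤ} (hX : URow (row X s) d)
    (hκ : Below (ofPS (PowerSeries.mk fun i => A.κ n₀ t a i s))⁻¹ 0) (r : ℤ) :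
    (waveRatio v X (A.κ n₀ t a) a s).coeff r = ∑ j ∈ Finset.Icc (-r) d, X j s *
      (shiftedWave A n₀ t (j • v) s a * (ofPS (PowerSeries.mk fun i => A.κ n₀ t a i s))⁻¹).coeff r
      := by
  rw [waveRatio_eq hv, div_eq_mul_inv]
  rw [coeff_mul_congr (f' := ∑ j ∈ Finset.Icc (-r) d, X j s • shiftedWave A n₀ t (j • v) s a) hκ]
  · rw [Finset.sum_mul, HahnSeries.coeff_sum]
    refine Finset.sum_congr rfl fun j _ => ?_
    rw [smul_eq_mono_mul, mul_assoc, coeff_mono_mul, sub_zero]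
  · intro i hi
    rw [coeff_waveNum hX, HahnSeries.coeff_sum]
    refine (act_K_eq_sum hv hX s (b := -r) (by omega)).trans ?_
    rfl

theorem coeff_waveRatio_of_agree {v : Idx N → ℤ} {a : Idx N} (hv : v a = 1)
    {X : Op (Idx N → ℤ) ℂ} {d : ℤ} {s : Idx N → ℤ} (hX : URow (row X s) d)
    (hκ : Below (ofPS (PowerSeries.mk fun i => A.κ n₀ t a i s))⁻¹ 0) {r : ℤ}
    {G : LaurentSeries ℂ}
    (hG : ∀ i ≤ r, act v s (row X s) (A.K n₀ t a) (-i) = G.coeff i) :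
    (waveRatio v X (A.κ n₀ t a) a s).coeff r =
      (G * (ofPS (PowerSeries.mk fun i => A.κ n₀ t a i s))⁻¹).coeff r := by
  rw [waveRatio_eq hv, div_eq_mul_inv]
  refine coeff_mul_congr hκ fun i hi => ?_
  rw [coeff_waveNum hX]
  exact hG i hi

/-! ## The decomposition into projections -/

/-- The coefficients of the projection `X_+`. -/
noncomputable def plusC (pic : Picture) (a : Idx N) (X : ℤ → ℂ) (j : ℤ) : ℂ :=
  if a = Sum.inl 0 then (if 0 ≤ j then X j else 0)
  else if 0 < j then X j
  else if j = 0 ∧ pic = Picture.altToda ∧ a ≠ Sum.inr 0 then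
    -∑ᶠ i : ℤ, if 0 < i then X i else 0
  else 0

theorem plusC_of_neg {pic : Picture} {a : Idx N} {X : ℤ → ℂ} {j : ℤ} (hj : j < 0) :
    plusC pic a X j = 0 := by
  rw [plusC]
  simp only [not_le.2 hj, not_lt.2 hj.le, hj.ne, if_false, false_and, ite_self]

theorem URow_plusC {pic : Picture} {a : Idx N} {X : ℤ → ℂ} {d : ℤ} (hd : 0 ≤ d)
    (hX : URow X d) : URow (plusC pic a X) d := fun j hj => by
  have h1 : ¬ j = 0 := by omega
  rw [plusC, hX j hj]
  simp [h1]

theorem finsum_ite_pos {M : Type*} [AddCommMonoid M] {g : ℤ → M} {d : ℤ}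
    (hg : ∀ j > d, g j = 0) : (∑ᶠ j : ℤ, if 0 < j then g j else 0) = ∑ j ∈ Finset.Ioc 0 d, g j := by
  rw [finsum_eq_sum_of_support_subset (s := Finset.Ioc 0 d)]
  · refine Finset.sum_congr rfl fun j hj => ?_
    rw [Finset.mem_Ioc] at hj
    rw [if_pos hj.1]
  · intro j hj
    rw [Function.mem_support] at hj
    rw [Finset.coe_Ioc, Set.mem_Ioc]
    by_cases h0 : 0 < j
    · refine ⟨h0, ?_⟩
      by_contra h1
      exact hj (by rw [hg j (by omega), ite_self])
    · exact absurd (if_neg h0) hj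

/-- The constant term of `X_+` is chosen as minus the sum of the other coefficients. Thus `X_+` does
not change the constant term of component `1` in the case where its shift fixes `s_1`. -/
theorem sum_plusC {pic : Picture} {a : Idx N} {X : ℤ → ℂ} {d : ℤ} (hd : 0 ≤ d)
    (hX : URow X d) (ha : a ≠ Sum.inl 0) (h : pic = Picture.altToda ∧ a ≠ Sum.inr 0) :
    ∑ j ∈ Finset.Icc 0 d, plusC pic a X j = 0 := by
  rw [← Finset.Ioc_insert_left hd, Finset.sum_insert (by simp)]
  have h1 : plusC pic a X 0 = -∑ i ∈ Finset.Ioc 0 d, X i := by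
    rw [plusC, if_neg ha, if_neg (lt_irrefl _), if_pos ⟨rfl, h⟩]
    rw [finsum_ite_pos hX]
  rw [h1, neg_add_eq_zero]
  refine Finset.sum_congr rfl fun i hi => ?_
  rw [Finset.mem_Ioc] at hi
  rw [plusC, if_neg ha, if_pos hi.1]

theorem vec_self (pic : Picture) {a₀ : Idx N} (ha₀ : a₀ ≠ Sum.inl 0) (a : Idx N) :
    vec pic a₀ a a = 1 := by
  cases pic <;> simp only [vec, shiftVec] <;> split_ifs with h <;>
    simp [h, Ne.symm ha₀]

/-- Positive powers of `𝒯_a` can thus raise the order of the pole only in component `a`. -/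
theorem vec_nonpos (pic : Picture) (a₀ : Idx N) {a c : Idx N} (h : c ≠ a) :
    vec pic a₀ a c ≤ 0 := by
  cases pic <;> simp only [vec, shiftVec] <;> split_ifs with h1 <;> try subst h1
  all_goals
    simp only [Pi.sub_apply, Pi.single_apply, h, if_false]
    split_ifs <;> simp

theorem vec_inl_zero (pic : Picture) (a₀ : Idx N) {a : Idx N} (h : a ≠ Sum.inl 0)
    (h' : ¬ (pic = Picture.altToda ∧ a ≠ Sum.inr 0)) : vec pic a₀ a (Sum.inl 0) = -1 := by
  cases pic <;> simp_all [vec, shiftVec, Ne.symm h]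

theorem sum_vec (pic : Picture) (a₀ a : Idx N) : ∑ c, vec pic a₀ a c = 0 := by
  cases pic <;> simp only [vec] <;> split_ifs <;> simp [shiftVec, Finset.sum_sub_distrib]

/-- The difference of the two sides is a member of the subspace. Its coefficients of negative degree
and the constant term of its component `1` vanish, so transversality makes it zero. The sums stop at
`d`, so only finitely many shifted points need to lie in the domain. -/
theorem eq_sum_plus {dom : Set ((Idx N → ℤ) × Times N D)} (hA : SolvesFactorization A dom)
    {pic : Picture} {a₀ : Idx N} {s : Idx N → ℤ} {d : ℤ} (hd : 0 ≤ d)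
    (hs : (s, t) ∈ dom) (hdom : ∀ b j, 0 ≤ j → j ≤ d → (s + j • vec pic a₀ b, t) ∈ dom)
    {Φ : Idx N → LaurentSeries ℂ} (hΦ : InGr A n₀ s t Φ) {X : Idx N → ℤ → ℂ}
    (hX : ∀ b, URow (X b) d)
    (hXΦ : ∀ b r, r < 0 ∨ (r = 0 ∧ b = Sum.inl 0) → (Φ b).coeff r = ∑ j ∈ Finset.Icc 0 d,
      X b j * (shiftedWave A n₀ t (j • vec pic a₀ b) s b).coeff r) (c : Idx N) :
    Φ c = ∑ b, ∑ j ∈ Finset.Icc 0 d, plusC pic b (X b) j •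
      shiftedWave A n₀ t (j • vec pic a₀ b) s c := by
  have hin : InGr A n₀ s t fun c => Φ c - ∑ b, ∑ j ∈ Finset.Icc 0 d, plusC pic b (X b) j •
      shiftedWave A n₀ t (j • vec pic a₀ b) s c := by
    refine hΦ.sub (InGr.sum _ fun b _ => InGr.sum _ fun j hj => ?_)
    rw [Finset.mem_Icc] at hj
    exact (inGr_shiftedWave hA hs (hdom b j hj.1 hj.2)).smul _
  have key : ∀ c r, r < 0 ∨ (r = 0 ∧ c = Sum.inl 0) →
      (Φ c - ∑ b, ∑ j ∈ Finset.Icc 0 d, plusC pic b (X b) j •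
        shiftedWave A n₀ t (j • vec pic a₀ b) s c).coeff r = 0 := by
    intro c r hr
    have hr0 : r ≤ 0 := by omega
    rw [HahnSeries.coeff_sub, HahnSeries.coeff_sum, hXΦ c r hr, sub_eq_zero,
      Finset.sum_eq_single c]
    · rw [HahnSeries.coeff_sum]
      refine Finset.sum_congr rfl fun j hj => ?_
      rw [Finset.mem_Icc] at hj
      rw [HahnSeries.coeff_smul, smul_eq_mul]
      by_cases hc : c = Sum.inl 0
      · rw [plusC, if_pos hc, if_pos hj.1]
      -- For `j = 0` the projection may alter the coefficient, but the unshifted wave function has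
      -- no terms of negative degree.
      · rcases hj.1.eq_or_lt with h0 | h0
        · have hr' : r < 0 := by
            rcases hr with h | h
            · exact h
            · exact absurd h.2 hc
          rw [below_shiftedWave _ _ _ r (by rw [← h0]; simpa using hr'), mul_zero, mul_zero]
        · rw [plusC, if_neg hc, if_pos h0]
    · intro b _ hbc
      rw [HahnSeries.coeff_sum]
      have hv := vec_nonpos pic a₀ (Ne.symm hbc)
      by_cases hc : c = Sum.inl 0
      · subst hc
        by_cases hp : pic = Picture.altToda ∧ b ≠ Sum.inr 0
        · rcases hr0.eq_or_lt with h0 | h0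
          · subst h0
            -- The shift leaves `s_1` fixed, so every shifted wave function contributes its leading
            -- coefficient `1` in component `1`, and the total is the sum of the projected
            -- coefficients.
            rw [← sum_plusC hd (hX b) hbc hp]
            refine Finset.sum_congr rfl fun j hj => ?_
            rw [Finset.mem_Icc] at hj
            have h1 : vec pic a₀ b (Sum.inl 0) = 0 := by
              obtain ⟨rfl, h⟩ := hp
              simp [vec, shiftVec, h, Ne.symm hbc]
            rw [HahnSeries.coeff_smul, smul_eq_mul, coeff_shiftedWave]
            simp only [Pi.smul_apply, h1, smul_zero, neg_zero, le_refl, if_true, add_zero,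
              Int.toNat_zero]
            have h2 : A.κ n₀ t (Sum.inl 0) 0 (s + j • vec pic a₀ b) = 1 := by
              simp only [TodaData.κ, if_true]
              rw [hA.lead _ _ (hdom b j hj.1 hj.2), Matrix.one_apply_eq]
            rw [h2, mul_one]
          · refine Finset.sum_eq_zero fun j hj => ?_
            rw [Finset.mem_Icc] at hj
            rw [HahnSeries.coeff_smul, below_shiftedWave _ _ _ r, smul_zero]
            simp only [Pi.smul_apply, smul_eq_mul]
            nlinarith
        · refine Finset.sum_eq_zero fun j hj => ?_
          rw [Finset.mem_Icc] at hj
          -- Here `X_+` has no term with `j = 0`, and `𝒯_b^j` lowers `s_1` by `j`, so component `1`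
          -- vanishes at `y = 0`.
          rcases hj.1.eq_or_lt with h0 | h0
          · have : plusC pic b (X b) j = 0 := by
              rw [plusC, if_neg hbc, ← h0, if_neg (lt_irrefl _),
                if_neg (fun h => hp h.2)]
            rw [HahnSeries.coeff_smul, this, smul_eq_mul, zero_mul]
          · rw [HahnSeries.coeff_smul, below_shiftedWave _ _ _ r, smul_zero]
            simp only [Pi.smul_apply, vec_inl_zero pic a₀ hbc hp, smul_eq_mul]
            omega
      · have hr' : r < 0 := by
          rcases hr with h | h
          · exact h
          · exact absurd h.2 hc
        refine Finset.sum_eq_zero fun j hj => ?_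
        rw [Finset.mem_Icc] at hj
        rw [HahnSeries.coeff_smul, below_shiftedWave _ _ _ r, smul_zero]
        simp only [Pi.smul_apply, smul_eq_mul]
        nlinarith
    · intro h; exact absurd (Finset.mem_univ c) h
  have := hin.eq_zero (hA.lead s t hs) (hA.lead_bar s t hs)
    (fun r hr => key _ r (by have : r ≤ 0 := by omega
                             rcases this.eq_or_lt with h | h
                             · exact Or.inr ⟨h, rfl⟩
                             · exact Or.inl h)) (fun c r hr => key c r (Or.inl hr)) c
  exact sub_eq_zero.1 this

end Scalar

/-! ## The filter of the dispersionless limit -/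

section SlowLim

variable {N D : ℕ}

theorem tendsto_slowLim_eps (s : Idx N → ℝ) :
    Tendsto (fun p : ℝ × (Idx N → ℤ) => p.1) (slowLim s) (𝓝[>] 0) :=
  tendsto_fst.mono_left inf_le_left

theorem tendsto_slowLim_slow (s : Idx N → ℝ) :
    Tendsto (fun p : ℝ × (Idx N → ℤ) => fun a => p.1 * (p.2 a : ℝ)) (slowLim s) (𝓝 s) :=
  tendsto_comap.mono_left inf_le_right

theorem eventually_slowLim_sum (s : Idx N → ℝ) : ∀ᶠ p in slowLim s, ∑ a, p.2 a = 0 :=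
  (tendsto_snd.mono_left inf_le_left).eventually (mem_principal_self _)

theorem tendsto_mul_floor (u : ℝ) : Tendsto (fun ε : ℝ => ε * ⌊u / ε⌋) (𝓝[>] 0) (𝓝 u) := by
  have h1 : Tendsto (fun ε : ℝ => u - ε) (𝓝[>] 0) (𝓝 u) := by
    have : Tendsto (fun ε : ℝ => u - ε) (𝓝 0) (𝓝 (u - 0)) := tendsto_const_nhds.sub tendsto_id
    rw [sub_zero] at this
    exact this.mono_left nhdsWithin_le_nhds
  refine tendsto_of_tendsto_of_tendsto_of_le_of_le' h1 tendsto_const_nhds ?_ ?_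
  · filter_upwards [self_mem_nhdsWithin] with ε hε
    have hε : 0 < ε := hε
    have := (Int.sub_one_lt_floor (u / ε)).le
    have h2 := mul_le_mul_of_nonneg_left this hε.le
    rwa [mul_sub, mul_div_cancel₀ _ hε.ne', mul_one] at h2
  · filter_upwards [self_mem_nhdsWithin] with ε hε
    have hε : 0 < ε := hε
    have h2 := mul_le_mul_of_nonneg_left (Int.floor_le (u / ε)) hε.le
    rwa [mul_div_cancel₀ _ hε.ne'] at h2

/-- Nontriviality of the filter is what makes limits along it unique. Zero charge lattice points are
obtained by rounding down and correcting a single coordinate. -/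
theorem slowLim_neBot [NeZero N] {s : Idx N → ℝ} (hs : ∑ a, s a = 0) : (slowLim s).NeBot := by
  -- The correction in coordinate `1` is the total charge of the rounded point. Multiplied by `ε` it
  -- tends to the charge of `s`, which is zero.
  have h : Tendsto (fun ε : ℝ => (ε, fun a : Idx N => ⌊s a / ε⌋ -
      if a = Sum.inl 0 then ∑ b, ⌊s b / ε⌋ else 0)) (𝓝[>] 0) (slowLim s) := by
    rw [slowLim, tendsto_inf, tendsto_comap_iff]
    refine ⟨tendsto_id.prodMk (tendsto_principal.2 (Eventually.of_forall fun ε => ?_)), ?_⟩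
    · change ∑ a : Idx N, (⌊s a / ε⌋ - if a = Sum.inl 0 then ∑ b, ⌊s b / ε⌋ else 0) = 0
      rw [Finset.sum_sub_distrib, Finset.sum_ite_eq' Finset.univ, if_pos (Finset.mem_univ _),
        sub_self]
    · rw [tendsto_pi_nhds]
      intro a
      have h1 : Tendsto (fun ε : ℝ => ε * ⌊s a / ε⌋ -
          if a = Sum.inl 0 then ∑ b, ε * ⌊s b / ε⌋ else 0) (𝓝[>] 0)
          (𝓝 (s a - if a = Sum.inl 0 then ∑ b, s b else 0)) := by
        refine (tendsto_mul_floor _).sub ?_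
        split_ifs
        · exact tendsto_finsetSum _ fun b _ => tendsto_mul_floor _
        · exact tendsto_const_nhds
      rw [hs, ite_self, sub_zero] at h1
      refine h1.congr fun ε => ?_
      simp only [Function.comp]
      split_ifs
      · push_cast; rw [mul_sub, Finset.mul_sum]
      · push_cast; ring
  exact h.neBot

/-- The slow variables of a lattice point at the slow times `x.2`. -/
noncomputable def slowPt (x : Slow N D) (p : ℝ × (Idx N → ℤ)) : Slow N D := toSlow p.1 p.2 ((p.1 : ℂ)⁻¹ • x.2)

theorem slowPt_eq (x : Slow N D) {p : ℝ × (Idx N → ℤ)} (hp : p.1 ≠ 0) :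
    slowPt x p = (fun a => p.1 * (p.2 a : ℝ), x.2) := by
  have : (p.1 : ℂ) ≠ 0 := by exact_mod_cast hp
  rw [slowPt, toSlow, smul_smul, mul_inv_cancel₀ this, one_smul]

theorem eventually_slowLim_pos (s : Idx N → ℝ) : ∀ᶠ p in slowLim s, 0 < p.1 :=
  (tendsto_slowLim_eps s).eventually self_mem_nhdsWithin

theorem tendsto_slowPt (x : Slow N D) : Tendsto (slowPt x) (slowLim x.1) (𝓝 x) := by
  have h : Tendsto (fun p : ℝ × (Idx N → ℤ) => ((fun a => p.1 * (p.2 a : ℝ), x.2) : Slow N D))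
      (slowLim x.1) (𝓝 (x.1, x.2)) :=
    (tendsto_slowLim_slow x.1).prodMk_nhds tendsto_const_nhds
  refine h.congr' ?_
  filter_upwards [eventually_slowLim_pos x.1] with p hp
  rw [slowPt_eq x hp.ne']

theorem toSlow_add (ε : ℝ) (s v : Idx N → ℤ) (t : Times N D) :
    toSlow ε (s + v) t = toSlow ε s t + ε • dirS v := by
  refine Prod.ext (funext fun a => ?_) ?_
  · simp [toSlow, dirS, mul_add]
  · simp [toSlow, dirS]

theorem tendsto_slowPt_add (x : Slow N D) (dir : Slow N D) :
    Tendsto (fun p => slowPt x p + p.1 • dir) (slowLim x.1) (𝓝 x) := by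
  have h1 : Tendsto (fun p : ℝ × (Idx N → ℤ) => p.1 • dir) (slowLim x.1) (𝓝 ((0 : ℝ) • dir)) :=
    (tendsto_nhds_of_tendsto_nhdsWithin (tendsto_slowLim_eps x.1)).smul_const dir
  simpa using (tendsto_slowPt x).add h1

/-- A fixed integer shift moves the slow point by `O(ε)`, and `U` is open. -/
theorem eventually_slowLim_mem {U : Set (Slow N D)} (hU : IsOpen U) {x : Slow N D} (hx : x ∈ U)
    {v : Idx N → ℤ} (hv : ∑ a, v a = 0) :
    ∀ᶠ p in slowLim x.1, (p.2 + v, ((p.1 : ℂ)⁻¹ • x.2)) ∈ fastDom U p.1 := by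
  filter_upwards [(tendsto_slowPt_add x (dirS v)).eventually (hU.mem_nhds hx),
    eventually_slowLim_sum x.1] with p h1 h2
  refine ⟨?_, ?_⟩
  · simp only [Pi.add_apply, Finset.sum_add_distrib, h2, hv, add_zero]
  · simp only [toSlow_add]
    exact h1

theorem eventually_slowLim_Ioo (s : Idx N → ℝ) {ε₀ : ℝ} (hε₀ : 0 < ε₀) :
    ∀ᶠ p in slowLim s, p.1 ∈ Set.Ioo 0 ε₀ :=
  (tendsto_slowLim_eps s).eventually (Ioo_mem_nhdsGT hε₀)

end SlowLim

/-! ## Limits of difference quotients -/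

section Smooth

variable {N D : ℕ} [NeZero N] {U : Set (Slow N D)} {ε₀ : ℝ} {f : ℝ → Slow N D → ℂ}

/-- The derivative in the slow variables, jointly in `ε` and the slow variables. -/
noncomputable def slowDeriv (U : Set (Slow N D)) (ε₀ : ℝ) (f : ℝ → Slow N D → ℂ)
    (z : ℝ × Slow N D) : Slow N D →L[ℝ] ℂ :=
  (fderivWithin ℝ (fun x : ℝ × Slow N D => f x.1 x.2) (Set.Ico 0 ε₀ ×ˢ U) z).comp
    (ContinuousLinearMap.inr ℝ ℝ (Slow N D))

theorem hasFDerivAt_slow (hU : IsOpen U)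
    (hf : ContDiffOn ℝ ∞ (fun x : ℝ × Slow N D => f x.1 x.2) (Set.Ico 0 ε₀ ×ˢ U))
    {ε : ℝ} (hε : ε ∈ Set.Ico 0 ε₀) {x : Slow N D} (hx : x ∈ U) :
    HasFDerivAt (f ε) (slowDeriv U ε₀ f (ε, x)) x := by
  have h1 := (hf.differentiableOn (by simp) (ε, x) ⟨hε, hx⟩).hasFDerivWithinAt
  have h2 : HasFDerivAt (fun x' : Slow N D => (ε, x')) (ContinuousLinearMap.inr ℝ ℝ (Slow N D)) x :=
    hasFDerivAt_prodMk_right ε x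
  exact HasFDerivWithinAt.comp_hasFDerivAt x h1 h2
    (Filter.mem_of_superset (hU.mem_nhds hx) fun x' hx' => ⟨hε, hx'⟩)

theorem continuousOn_slowDeriv (hU : IsOpen U)
    (hf : ContDiffOn ℝ ∞ (fun x : ℝ × Slow N D => f x.1 x.2) (Set.Ico 0 ε₀ ×ˢ U)) :
    ContinuousOn (slowDeriv U ε₀ f) (Set.Ico 0 ε₀ ×ˢ U) := by
  have h := hf.continuousOn_fderivWithin ((uniqueDiffOn_Ico 0 ε₀).prod hU.uniqueDiffOn)
    (by exact_mod_cast le_top)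
  exact h.clm_comp continuousOn_const

variable {ι : Type*} {l : Filter ι} {ε : ι → ℝ} {X : ι → Slow N D} {x : Slow N D}

theorem tendsto_slow_within (hU : IsOpen U) (hε₀ : 0 < ε₀) (hx : x ∈ U)
    (hε : Tendsto ε l (𝓝[>] 0)) (hX : Tendsto X l (𝓝 x)) :
    Tendsto (fun p => (ε p, X p)) l (𝓝[Set.Ico 0 ε₀ ×ˢ U] (0, x)) := by
  rw [tendsto_nhdsWithin_iff]
  refine ⟨(tendsto_nhds_of_tendsto_nhdsWithin hε).prodMk_nhds hX, ?_⟩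
  filter_upwards [hε.eventually (Ioo_mem_nhdsGT hε₀), hX.eventually (hU.mem_nhds hx)] with p h1 h2
  exact ⟨⟨h1.1.le, h1.2⟩, h2⟩

theorem tendsto_slow (hU : IsOpen U) (hε₀ : 0 < ε₀)
    (hf : ContDiffOn ℝ ∞ (fun x : ℝ × Slow N D => f x.1 x.2) (Set.Ico 0 ε₀ ×ˢ U)) (hx : x ∈ U)
    (hε : Tendsto ε l (𝓝[>] 0)) (hX : Tendsto X l (𝓝 x)) :
    Tendsto (fun p => f (ε p) (X p)) l (𝓝 (f 0 x)) :=
  (hf.continuousOn (0, x) ⟨⟨le_rfl, hε₀⟩, hx⟩).tendsto.comp (tendsto_slow_within hU hε₀ hx hε hX)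

theorem tendsto_fderiv_slow (hU : IsOpen U) (hε₀ : 0 < ε₀)
    (hf : ContDiffOn ℝ ∞ (fun x : ℝ × Slow N D => f x.1 x.2) (Set.Ico 0 ε₀ ×ˢ U)) (hx : x ∈ U)
    (hε : Tendsto ε l (𝓝[>] 0)) (hX : Tendsto X l (𝓝 x)) (dir : Slow N D) :
    Tendsto (fun p => fderiv ℝ (f (ε p)) (X p) dir) l (𝓝 (fderiv ℝ (f 0) x dir)) := by
  have h0 : (0 : ℝ) ∈ Set.Ico 0 ε₀ := ⟨le_rfl, hε₀⟩
  have h := (continuousOn_slowDeriv hU hf (0, x) ⟨h0, hx⟩).tendsto.comp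
    (tendsto_slow_within hU hε₀ hx hε hX)
  rw [(hasFDerivAt_slow hU hf h0 hx).fderiv]
  have h' := ((ContinuousLinearMap.apply ℝ ℂ dir).continuous.tendsto _).comp h
  refine h'.congr' ?_
  filter_upwards [hε.eventually (Ioo_mem_nhdsGT hε₀), hX.eventually (hU.mem_nhds hx)] with p h1 h2
  rw [(hasFDerivAt_slow hU hf ⟨h1.1.le, h1.2⟩ h2).fderiv]
  rfl

/-- The function, its base point and the step all depend on the parameter. Continuity of the slow
derivative up to `ε = 0` makes it uniformly close to its value at `(0, x)`, and the mean value
inequality on a ball does the rest. -/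
theorem tendsto_slope_slow (hU : IsOpen U) (hε₀ : 0 < ε₀)
    (hf : ContDiffOn ℝ ∞ (fun x : ℝ × Slow N D => f x.1 x.2) (Set.Ico 0 ε₀ ×ˢ U)) (hx : x ∈ U)
    (hε : Tendsto ε l (𝓝[>] 0)) (hX : Tendsto X l (𝓝 x)) (dir : Slow N D) :
    Tendsto (fun p => (f (ε p) (X p + ε p • dir) - f (ε p) (X p)) / (ε p : ℂ)) l
      (𝓝 (fderiv ℝ (f 0) x dir)) := by
  have h0 : (0 : ℝ) ∈ Set.Ico 0 ε₀ := ⟨le_rfl, hε₀⟩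
  rw [(hasFDerivAt_slow hU hf h0 hx).fderiv, Metric.tendsto_nhds]
  intro η hη
  -- The summand `1` covers `dir = 0`, and the factor `2` leaves room for the strict inequality at
  -- the end.
  set C : ℝ := η / (2 * (‖dir‖ + 1)) with hC
  have hd : 0 < ‖dir‖ + 1 := by positivity
  have hCpos : 0 < C := by positivity
  have hc := Metric.continuousWithinAt_iff.1 (continuousOn_slowDeriv hU hf (0, x) ⟨h0, hx⟩) C hCpos
  obtain ⟨δ, hδ, hcδ⟩ := hc
  obtain ⟨δ', hδ', hball⟩ := Metric.isOpen_iff.1 hU x hx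
  set r := min δ δ' with hr
  have hrpos : 0 < r := lt_min hδ hδ'
  have hX' : Tendsto (fun p => X p + ε p • dir) l (𝓝 x) := by
    have : Tendsto (fun p => ε p • dir) l (𝓝 ((0 : ℝ) • dir)) :=
      (tendsto_nhds_of_tendsto_nhdsWithin hε).smul_const dir
    simpa using hX.add this
  filter_upwards [hX.eventually (Metric.ball_mem_nhds x hrpos),
    hX'.eventually (Metric.ball_mem_nhds x hrpos),
    hε.eventually (Ioo_mem_nhdsGT hε₀), hε.eventually (Ioo_mem_nhdsGT hδ)] with p h1 h2 h3 h4
  have hεp : 0 < ε p := h3.1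
  have key := Convex.norm_image_sub_le_of_norm_hasFDerivWithin_le' (f := f (ε p))
    (f' := fun y => slowDeriv U ε₀ f (ε p, y)) (φ := slowDeriv U ε₀ f (0, x)) (C := C)
    (s := Metric.ball x r) (x := X p) (y := X p + ε p • dir)
    (fun y hy => (hasFDerivAt_slow hU hf ⟨h3.1.le, h3.2⟩
      (hball (Metric.ball_subset_ball (min_le_right _ _) hy))).hasFDerivWithinAt)
    (fun y hy => by
      rw [← dist_eq_norm]
      refine (hcδ (x := (ε p, y)) ⟨⟨h3.1.le, h3.2⟩,
        hball (Metric.ball_subset_ball (min_le_right _ _) hy)⟩ ?_).le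
      rw [Prod.dist_eq]
      refine max_lt ?_ (lt_of_lt_of_le hy (min_le_left _ _))
      simpa [abs_of_pos h4.1] using h4.2)
    (convex_ball x r) h1 h2
  rw [add_sub_cancel_left, map_smul, norm_smul, Real.norm_of_nonneg hεp.le] at key
  have hεc : (ε p : ℂ) ≠ 0 := by exact_mod_cast hεp.ne'
  have e : (f (ε p) (X p + ε p • dir) - f (ε p) (X p)) / (ε p : ℂ) - slowDeriv U ε₀ f (0, x) dir =
      (f (ε p) (X p + ε p • dir) - f (ε p) (X p) - ε p • slowDeriv U ε₀ f (0, x) dir) / (ε p : ℂ) := by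
    rw [Complex.real_smul]
    field_simp
  rw [dist_eq_norm, e, norm_div, Complex.norm_real, Real.norm_of_nonneg hεp.le, div_lt_iff₀ hεp]
  calc _ ≤ C * (ε p * ‖dir‖) := key
    _ ≤ C * (ε p * (‖dir‖ + 1)) := by gcongr; linarith
    _ = (η / 2) * ε p := by rw [hC]; field_simp
    _ < η * ε p := by nlinarith

end Smooth

/-! ## Limits of the wave functions -/

section WaveLimits

variable {N D : ℕ} [NeZero N] {U : Set (Slow N D)} {ε₀ : ℝ} {n₀ : ℤ} {A : ℝ → TodaData N D}
  {σ : Idx N → ℕ → ℝ → Slow N D → ℂ}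

/-- The series `∑ κ_{c,i} y^i` of a wave function without its elementary factor. -/
noncomputable def waveSer (A : TodaData N D) (n₀ : ℤ) (t : Times N D) (s : Idx N → ℤ) (c : Idx N) :
    LaurentSeries ℂ := ofPS (PowerSeries.mk fun i => A.κ n₀ t c i s)

theorem inv_ofPS_expSeries (f : PowerSeries ℂ) :
    (ofPS (expSeries f))⁻¹ = ofPS (expSeries (-f)) := by
  refine inv_eq_of_mul_eq_one_right ?_
  rw [← ofPS_mul, expSeries_mul_neg, ofPS_one]

theorem QuasiClassical.waveSer_eq (hσ : QuasiClassical U ε₀ n₀ A σ) {ε : ℝ}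
    (hε : ε ∈ Set.Ioo 0 ε₀) {s : Idx N → ℤ} {t : Times N D} (h : (s, t) ∈ fastDom U ε)
    (c : Idx N) : waveSer (A ε) n₀ t s c =
      ofPS (expSeries (PowerSeries.mk fun i => σ c i ε (toSlow ε s t) / ε)) := by
  rw [waveSer, hσ.wave ε hε s t h c]

theorem QuasiClassical.κ_zero_ne_zero (hσ : QuasiClassical U ε₀ n₀ A σ) {ε : ℝ}
    (hε : ε ∈ Set.Ioo 0 ε₀) {s : Idx N → ℤ} {t : Times N D} (h : (s, t) ∈ fastDom U ε)
    (c : Idx N) : (A ε).κ n₀ t c 0 s ≠ 0 := by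
  have := congrArg (PowerSeries.coeff 0) (hσ.wave ε hε s t h c)
  rw [PowerSeries.coeff_mk, coeff_zero_expSeries] at this
  rw [this]
  exact Complex.exp_ne_zero _

theorem QuasiClassical.waveSer_ne_zero (hσ : QuasiClassical U ε₀ n₀ A σ) {ε : ℝ}
    (hε : ε ∈ Set.Ioo 0 ε₀) {s : Idx N → ℤ} {t : Times N D} (h : (s, t) ∈ fastDom U ε)
    (c : Idx N) : waveSer (A ε) n₀ t s c ≠ 0 := by
  rw [hσ.waveSer_eq hε h]
  exact (hasOrd_expSeries _).ne_zero

theorem QuasiClassical.below_waveSer_inv (hσ : QuasiClassical U ε₀ n₀ A σ) {ε : ℝ}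
    (hε : ε ∈ Set.Ioo 0 ε₀) {s : Idx N → ℤ} {t : Times N D} (h : (s, t) ∈ fastDom U ε)
    (c : Idx N) : Below (waveSer (A ε) n₀ t s c)⁻¹ 0 := by
  rw [hσ.waveSer_eq hε h, inv_ofPS_expSeries]
  exact below_ofPS _

/-- The exponent of the quotient is a difference quotient with step `ε`, because a unit shift of `s`
is a shift by `ε` of the slow variable. -/
theorem QuasiClassical.shiftedWave_div (hσ : QuasiClassical U ε₀ n₀ A σ) {ε : ℝ}
    (hε : ε ∈ Set.Ioo 0 ε₀) {s v : Idx N → ℤ} {t : Times N D} (h : (s, t) ∈ fastDom U ε)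
    (hv : (s + v, t) ∈ fastDom U ε) (c : Idx N) :
    shiftedWave (A ε) n₀ t v s c * (waveSer (A ε) n₀ t s c)⁻¹ = mono (-v c) 1 *
      ofPS (expSeries (PowerSeries.mk fun i =>
        (σ c i ε (toSlow ε s t + ε • dirS v) - σ c i ε (toSlow ε s t)) / ε)) := by
  rw [hσ.waveSer_eq hε h, inv_ofPS_expSeries, shiftedWave, hσ.wave ε hε _ t hv c, mul_assoc,
    ← ofPS_mul, ← expSeries_add, toSlow_add]
  congr 3
  ext i
  rw [map_add, map_neg, PowerSeries.coeff_mk, PowerSeries.coeff_mk, PowerSeries.coeff_mk]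
  ring

variable {x : Slow N D}

theorem eventually_good (hU : IsOpen U) (hε₀ : 0 < ε₀) (hx : x ∈ U) :
    ∀ᶠ p in slowLim x.1, p.1 ∈ Set.Ioo 0 ε₀ ∧ (p.2, ((p.1 : ℂ)⁻¹ • x.2)) ∈ fastDom U p.1 := by
  filter_upwards [eventually_slowLim_Ioo x.1 hε₀, eventually_slowLim_mem hU hx (v := 0) (by simp)]
    with p h1 h2
  rw [add_zero] at h2
  exact ⟨h1, h2⟩

theorem lTendsto_shiftedWave (hU : IsOpen U) (hε₀ : 0 < ε₀)
    (hσ : QuasiClassical U ε₀ n₀ A σ) (hx : x ∈ U) {v : Idx N → ℤ} (hv : ∑ a, v a = 0) (c : Idx N) :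
    LTendsto (fun p : ℝ × (Idx N → ℤ) =>
      shiftedWave (A p.1) n₀ ((p.1 : ℂ)⁻¹ • x.2) v p.2 c *
        (waveSer (A p.1) n₀ ((p.1 : ℂ)⁻¹ • x.2) p.2 c)⁻¹) (slowLim x.1) (expdsS σ x v c) := by
  have h : LTendsto (fun p : ℝ × (Idx N → ℤ) => mono (-v c) 1 *
      ofPS (expSeries (PowerSeries.mk fun i =>
        (σ c i p.1 (slowPt x p + p.1 • dirS v) - σ c i p.1 (slowPt x p)) / (p.1 : ℂ))))
      (slowLim x.1) (expdsS σ x v c) := by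
    refine (lTendsto_const _).mul (lTendsto_ofPS (tendsto_expSeries fun m => ?_))
    simp only [PowerSeries.coeff_mk]
    exact tendsto_slope_slow hU hε₀ (hσ.smooth c m) hx (tendsto_slowLim_eps x.1)
      (tendsto_slowPt x) (dirS v)
  refine h.congr' ?_
  filter_upwards [eventually_good hU hε₀ hx, eventually_slowLim_mem hU hx hv] with p h1 h2
  exact (hσ.shiftedWave_div h1.1 h1.2 h2 c).symm

theorem eventually_time_mem (hU : IsOpen U) (hε₀ : 0 < ε₀) (hx : x ∈ U) :
    ∀ᶠ p : ℝ × (Idx N → ℤ) in slowLim x.1,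
    ∀ᶠ t' in 𝓝 ((p.1 : ℂ)⁻¹ • x.2), (p.2, t') ∈ fastDom U p.1 := by
  filter_upwards [eventually_good hU hε₀ hx] with p h
  have hc : Continuous fun t' : Times N D => toSlow p.1 p.2 t' :=
    continuous_const.prodMk (continuous_const_smul _)
  filter_upwards [hc.continuousAt.eventually (hU.mem_nhds h.2.2)] with t' ht'
  exact ⟨h.2.1, ht'⟩

/-- The factor `ε` from passing to slow times cancels the `1/ε` in the exponent, so the logarithmic
derivative of the wave function is the slow derivative of the action. -/
theorem lTendsto_timeWave (hU : IsOpen U) (hε₀ : 0 < ε₀)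
    (hσ : QuasiClassical U ε₀ n₀ A σ) (hx : x ∈ U)
    (hA : ∀ ε ∈ Set.Ioo 0 ε₀, SolvesFactorization (A ε) (fastDom U ε))
    (a : Idx N) (j : Fin D) (c : Idx N) :
    LTendsto (fun p : ℝ × (Idx N → ℤ) =>
      timeWave (A p.1) n₀ ((p.1 : ℂ)⁻¹ • x.2) a j p.2 c *
        (waveSer (A p.1) n₀ ((p.1 : ℂ)⁻¹ • x.2) p.2 c)⁻¹) (slowLim x.1) (dtS σ x a j c) := by
  have h : LTendsto (fun p : ℝ × (Idx N → ℤ) =>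
      (if a = c then mono (-((j : ℤ) + 1)) 1 else 0) + ofPS (PowerSeries.mk fun i =>
        fderiv ℝ (σ c i p.1) (slowPt x p) (0, timeDir a j))) (slowLim x.1) (dtS σ x a j c) := by
    refine (lTendsto_const _).add (lTendsto_ofPS fun m => ?_)
    simp only [PowerSeries.coeff_mk]
    exact tendsto_fderiv_slow hU hε₀ (hσ.smooth c m) hx (tendsto_slowLim_eps x.1)
      (tendsto_slowPt x) _
  refine h.congr' ?_
  filter_upwards [eventually_good hU hε₀ hx, eventually_time_mem hU hε₀ hx] with p h1 h2
  obtain ⟨hε, hmem⟩ := h1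
  set ε := p.1 with hεdef
  set t : Times N D := (ε : ℂ)⁻¹ • x.2 with ht
  have hε0 : (ε : ℂ) ≠ 0 := by exact_mod_cast hε.1.ne'
  set f' : PowerSeries ℂ := PowerSeries.mk fun i =>
    fderiv ℝ (σ c i ε) (slowPt x p) (0, timeDir a j) with hf'
  have key : PowerSeries.mk (dκ (A ε) n₀ t a j p.2 c) =
      f' * expSeries (PowerSeries.mk fun i => σ c i ε (toSlow ε p.2 t) / ε) := by
    ext i
    rw [PowerSeries.coeff_mk]
    -- The coefficients are holomorphic in `t` while `σ` is only known to be smooth over the reals.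
    -- Both derivatives are compared along a real line in the direction of the time.
    have hcurve : HasDerivAt (fun u : ℝ => t + u • (timeDir a j : Times N D)) (timeDir a j) 0 := by
      simpa using ((hasDerivAt_id (0 : ℝ)).smul_const (timeDir a j : Times N D)).const_add t
    have h0 : t + (0 : ℝ) • (timeDir a j : Times N D) = t := by simp
    have d1 : HasDerivAt (fun u : ℝ => (A ε).κ n₀ (t + u • timeDir a j) c i p.2)
        (dκ (A ε) n₀ t a j p.2 c i) 0 := by
      have hd : DifferentiableAt ℂ (fun t' => (A ε).κ n₀ t' c i p.2) t := by
        rcases c with k | k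
        · simp only [TodaData.κ]
          split_ifs
          · exact (hA ε hε).diff _ _ hmem _ _ _ _
          · exact (hA ε hε).diff _ _ hmem _ _ _ _
        · exact (hA ε hε).diff_bar _ _ hmem _ _ _ _
      have hd' := hd.hasFDerivAt.restrictScalars ℝ
      rw [← h0] at hd'
      have := hd'.comp_hasDerivAt (0 : ℝ) hcurve
      rw [h0] at this
      exact this
    have d2 : HasDerivAt (fun u : ℝ => PowerSeries.coeff i (expSeries (PowerSeries.mk fun i =>
        σ c i ε (toSlow ε p.2 (t + u • timeDir a j)) / ε)))
        (PowerSeries.coeff i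
          (f' * expSeries (PowerSeries.mk fun i => σ c i ε (toSlow ε p.2 t) / ε))) 0 := by
      have := hasDerivAt_expSeries (τ := (0 : ℝ)) (f' := f') (f := fun u : ℝ =>
        PowerSeries.mk fun i => σ c i ε (toSlow ε p.2 (t + u • timeDir a j)) / ε) (fun m => ?_) i
      · rw [h0] at this
        exact this
      · simp only [PowerSeries.coeff_mk, hf']
        have e : ∀ u : ℝ, toSlow ε p.2 (t + u • timeDir a j) = slowPt x p +
            u • ((ε : ℝ) • ((0, timeDir a j) : Slow N D)) := by
          intro u
          refine Prod.ext (funext fun b => ?_) ?_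
          · simp [toSlow, slowPt, ← hεdef]
          · funext b k
            simp [toSlow, slowPt, ← ht, ← hεdef]
            ring
        have hc2 : HasDerivAt (fun u : ℝ => toSlow ε p.2 (t + u • timeDir a j))
            ((ε : ℝ) • ((0, timeDir a j) : Slow N D)) 0 := by
          simp only [e]
          simpa using ((hasDerivAt_id (0 : ℝ)).smul_const
            ((ε : ℝ) • ((0, timeDir a j) : Slow N D))).const_add (slowPt x p)
        have hd : HasFDerivAt (σ c m ε) (fderiv ℝ (σ c m ε) (slowPt x p))
            (toSlow ε p.2 (t + (0 : ℝ) • timeDir a j)) := by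
          rw [h0]
          exact (hasFDerivAt_slow hU (hσ.smooth c m) ⟨hε.1.le, hε.2⟩
            hmem.2).differentiableAt.hasFDerivAt
        have := (hd.comp_hasDerivAt (0 : ℝ) hc2).div_const (ε : ℂ)
        rw [map_smul, Complex.real_smul, mul_div_cancel_left₀ _ hε0] at this
        exact this
    -- The quasi-classical form holds at all nearby times, so the two functions of `u` agree near
    -- `0` and have the same derivative.
    refine d1.unique (d2.congr_of_eventuallyEq ?_)
    have := hcurve.continuousAt.eventually (p := fun t' => (p.2, t') ∈ fastDom U ε)
      (by simp only [h0]; exact h2)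
    filter_upwards [this] with u hu
    have := congrArg (PowerSeries.coeff i) (hσ.wave ε hε _ _ hu c)
    rwa [PowerSeries.coeff_mk] at this
  have hne := hσ.waveSer_ne_zero hε hmem c
  rw [timeWave, key, ofPS_mul, ← hσ.waveSer_eq hε hmem c, ← waveSer, add_mul, mul_assoc,
    mul_assoc, mul_inv_cancel₀ hne, mul_one, mul_one]

end WaveLimits

/-! ### Quasi-classical limit of the Orlov–Schulman operators -/

section OrlovLimits

open Op

theorem theta_ofPS (f : PowerSeries ℂ) :
    theta (ofPS f) = mono 1 1 * ofPS (PowerSeries.derivative ℂ f) := by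
  ext r
  rw [coeff_theta, coeff_mono_mul, coeff_ofPS, coeff_ofPS, one_mul]
  rcases lt_trichotomy r 0 with h | h | h
  · rw [if_neg (by omega), if_neg (by omega), mul_zero]
  · subst h
    simp
  · rw [if_pos h.le, if_pos (by omega), PowerSeries.coeff_derivative]
    have e : (r - 1).toNat + 1 = r.toNat := by omega
    have e2 : (((r - 1).toNat : ℕ) : ℂ) + 1 = (r : ℂ) := by
      have : (((r - 1).toNat : ℤ)) + 1 = r := by omega
      exact_mod_cast congrArg (Int.cast : ℤ → ℂ) this
    rw [e, e2, mul_comm]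

theorem theta_ofPS_expSeries (f : PowerSeries ℂ) :
    theta (ofPS (expSeries f)) = theta (ofPS f) * ofPS (expSeries f) := by
  rw [theta_ofPS, theta_ofPS, derivative_expSeries, ofPS_mul, mul_assoc]

theorem theta_mono_zero_mul (c : ℂ) (f : LaurentSeries ℂ) :
    theta (mono 0 c * f) = mono 0 c * theta f := by
  ext r
  rw [coeff_theta, coeff_mono_mul, coeff_mono_mul, coeff_theta, sub_zero]
  ring

theorem LTendsto.theta {ι : Type*} {l : Filter ι} {u : ι → LaurentSeries ℂ} {G : LaurentSeries ℂ}
    (h : LTendsto u l G) : LTendsto (fun p => Whitham.theta (u p)) l (Whitham.theta G) := by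
  obtain ⟨⟨a, ha, hu⟩, h2⟩ := h
  refine ⟨⟨a, ha.theta, hu.mono fun p hp => hp.theta⟩, fun r => ?_⟩
  simp only [coeff_theta]
  exact (h2 r).const_mul _

theorem LTendsto.sub {ι : Type*} {l : Filter ι} {u v : ι → LaurentSeries ℂ}
    {G H : LaurentSeries ℂ} (h : LTendsto u l G) (h' : LTendsto v l H) :
    LTendsto (fun p => u p - v p) l (G - H) := by
  obtain ⟨⟨a, ha, hu⟩, h2⟩ := h
  obtain ⟨⟨b, hb, hv⟩, h3⟩ := h'
  refine ⟨⟨min a b, (ha.mono_le (min_le_left _ _)).sub (hb.mono_le (min_le_right _ _)), ?_⟩,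
    fun r => by simpa using (h2 r).sub (h3 r)⟩
  filter_upwards [hu, hv] with p h1 h2
  exact (h1.mono_le (min_le_left _ _)).sub (h2.mono_le (min_le_right _ _))

variable {N D : ℕ}

/-- The conjugate of `ε • orlov` by the exponential of a series `f`. -/
noncomputable def orlovConj (ε : ℂ) (a : Idx N) (c : ℂ) (τ : Fin D → ℂ) (f : PowerSeries ℂ)
    (w : LaurentSeries ℂ) : LaurentSeries ℂ :=
  (mono 0 (ε * c) + ∑ j : Fin D, mono (-((j : ℤ) + 1)) (ε * (sg a * (((j : ℂ) + 1) * τ j))) -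
    mono 0 (ε * sg a) * theta (ofPS f)) * w - mono 0 (ε * sg a) * theta w

/-- The derivation falls either on the exponential, producing a multiplication operator, or on `w`.
Only the latter keeps a free factor `ε` in the limit. -/
theorem orlov_mul_expSeries (ε : ℂ) (a : Idx N) (c : ℂ) (τ : Fin D → ℂ) (f : PowerSeries ℂ)
    (w : LaurentSeries ℂ) : mono 0 ε * orlov a c τ (w * ofPS (expSeries f)) =
      orlovConj ε a c τ f w * ofPS (expSeries f) := by
  have e1 : ∀ j : Fin D, mono (-((j : ℤ) + 1)) (ε * (sg a * (((j : ℂ) + 1) * τ j))) =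
      mono 0 ε * mono (-((j : ℤ) + 1)) (sg a * (((j : ℂ) + 1) * τ j)) := fun j => by
    rw [mono_mul, zero_add]
  rw [orlov, orlovConj, theta_mul, theta_ofPS_expSeries, ← mono_zero_mul_mono_zero,
    ← mono_zero_mul_mono_zero, Finset.sum_congr rfl fun j _ => e1 j, ← Finset.mul_sum]
  ring

theorem orlov_mono_zero_mul (a : Idx N) (c : ℂ) (τ : Fin D → ℂ) (e : ℂ) (u : LaurentSeries ℂ) :
    orlov a c τ (mono 0 e * u) = mono 0 e * orlov a c τ u := by
  rw [orlov, orlov, theta_mono_zero_mul]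
  ring

theorem orlov_iterate_expSeries (ε : ℂ) (a : Idx N) (c : ℂ) (τ : Fin D → ℂ) (f : PowerSeries ℂ)
    (i : ℕ) : mono 0 (ε ^ i) * (orlov a c τ)^[i] (ofPS (expSeries f)) =
      (orlovConj ε a c τ f)^[i] 1 * ofPS (expSeries f) := by
  induction i with
  | zero => simp [mono_zero_one]
  | succ i ih =>
    rw [Function.iterate_succ_apply', Function.iterate_succ_apply', ← orlov_mul_expSeries, ← ih,
      orlov_mono_zero_mul, ← mul_assoc, mono_zero_mul_mono_zero, pow_succ']

variable [NeZero N] {U : Set (Slow N D)} {ε₀ : ℝ} {n₀ : ℤ} {A : ℝ → TodaData N D}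
  {σ : Idx N → ℕ → ℝ → Slow N D → ℂ} {x : Slow N D}

theorem below_zdzS (a : Idx N) : Below (zdzS σ x a) (-D) := by
  rw [zdzS, ← Int.cast_smul_eq_zsmul ℂ]
  refine Below.smul _ (((((below_mono 0 _).mono_le (by omega)).add (below_sum _ fun j _ =>
    (below_mono _ _).mono_le ?_)).sub ((below_ofPS _).mono_le (by omega))))
  have := j.2
  omega

/-- With `f = σ/ε` the multiplication part converges to `z ∂_z 𝒮_{a,0}` and the remaining derivation
tends to zero. Hence iterates tend to powers. -/
theorem lTendsto_orlovConj (hU : IsOpen U) (hε₀ : 0 < ε₀) (hσ : QuasiClassical U ε₀ n₀ A σ)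
    (hx : x ∈ U) (a : Idx N) {w : ℝ × (Idx N → ℤ) → LaurentSeries ℂ} {G : LaurentSeries ℂ}
    (hw : LTendsto w (slowLim x.1) G) :
    LTendsto (fun p : ℝ × (Idx N → ℤ) => orlovConj (p.1 : ℂ) a ((n₀ : ℂ) - ν a + sg a * p.2 a)
      (((p.1 : ℂ)⁻¹ • x.2) a)
      (PowerSeries.mk fun i => σ a i p.1 (toSlow p.1 p.2 ((p.1 : ℂ)⁻¹ • x.2)) / p.1) (w p))
      (slowLim x.1) (zdzS σ x a * G) := by
  have hε : Tendsto (fun p : ℝ × (Idx N → ℤ) => (p.1 : ℂ)) (slowLim x.1) (𝓝 0) := by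
    have := (Complex.continuous_ofReal.tendsto 0).comp
      (tendsto_nhds_of_tendsto_nhdsWithin (tendsto_slowLim_eps x.1))
    simpa [Function.comp_def] using this
  have h1 : LTendsto (fun p : ℝ × (Idx N → ℤ) =>
      mono 0 ((p.1 : ℂ) * ((n₀ : ℂ) - ν a + sg a * p.2 a))) (slowLim x.1)
      (mono 0 (sg a * (x.1 a : ℂ))) := by
    refine lTendsto_mono 0 ?_
    have h2 : Tendsto (fun p : ℝ × (Idx N → ℤ) => ((p.1 * (p.2 a : ℝ) : ℝ) : ℂ)) (slowLim x.1)
        (𝓝 (x.1 a : ℂ)) := (Complex.continuous_ofReal.tendsto _).comp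
      (tendsto_pi_nhds.1 (tendsto_slowLim_slow x.1) a)
    have h3 := (hε.mul_const ((n₀ : ℂ) - ν a)).add (h2.const_mul (sg a : ℂ))
    rw [zero_mul, zero_add] at h3
    refine h3.congr fun p => ?_
    push_cast
    ring
  have h2 : LTendsto (fun p : ℝ × (Idx N → ℤ) => ∑ j : Fin D, mono (-((j : ℤ) + 1))
      ((p.1 : ℂ) * (sg a * (((j : ℂ) + 1) * ((p.1 : ℂ)⁻¹ • x.2) a j)))) (slowLim x.1)
      (∑ j : Fin D, mono (-((j : ℤ) + 1)) (sg a * (((j : ℂ) + 1) * x.2 a j))) := by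
    refine (lTendsto_const _).congr' ?_
    filter_upwards [eventually_slowLim_pos x.1] with p hp
    have hp0 : (p.1 : ℂ) ≠ 0 := by exact_mod_cast hp.ne'
    refine Finset.sum_congr rfl fun j _ => ?_
    congr 1
    simp only [Pi.smul_apply, smul_eq_mul]
    field_simp
  have h3 : LTendsto (fun p : ℝ × (Idx N → ℤ) => mono 0 ((p.1 : ℂ) * sg a) *
      theta (ofPS (PowerSeries.mk fun i =>
        σ a i p.1 (toSlow p.1 p.2 ((p.1 : ℂ)⁻¹ • x.2)) / p.1))) (slowLim x.1)
      (mono 0 (sg a : ℂ) * ofPS (PowerSeries.mk fun i => (i : ℂ) * σ a i 0 x)) := by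
    have : LTendsto (fun p : ℝ × (Idx N → ℤ) => mono 0 (sg a : ℂ) *
        ofPS (PowerSeries.mk fun i => (i : ℂ) * σ a i p.1 (slowPt x p))) (slowLim x.1)
        (mono 0 (sg a : ℂ) * ofPS (PowerSeries.mk fun i => (i : ℂ) * σ a i 0 x)) := by
      refine (lTendsto_const _).mul (lTendsto_ofPS fun m => ?_)
      simp only [PowerSeries.coeff_mk]
      exact (tendsto_slow hU hε₀ (hσ.smooth a m) hx (tendsto_slowLim_eps x.1)
        (tendsto_slowPt x)).const_mul _
    refine this.congr' ?_
    filter_upwards [eventually_slowLim_pos x.1] with p hp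
    have hp0 : (p.1 : ℂ) ≠ 0 := by exact_mod_cast hp.ne'
    ext r
    rw [coeff_mono_mul, coeff_mono_mul, coeff_theta, coeff_ofPS, coeff_ofPS, sub_zero]
    split_ifs with h
    · rw [PowerSeries.coeff_mk, PowerSeries.coeff_mk]
      have e : ((r.toNat : ℕ) : ℂ) = (r : ℂ) := by
        exact_mod_cast congrArg (Int.cast : ℤ → ℂ) (Int.toNat_of_nonneg h)
      rw [e, slowPt]
      field_simp
    · simp
  -- The derivative of a convergent family converges coefficientwise, and the prefactor `ε` sends
  -- the term to zero.
  have h4 : LTendsto (fun p : ℝ × (Idx N → ℤ) => mono 0 ((p.1 : ℂ) * sg a) * theta (w p))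
      (slowLim x.1) 0 := by
    have := (lTendsto_mono 0 (hε.mul_const (sg a : ℂ))).mul hw.theta
    simpa [mono] using this
  have h5 := (((h1.add h2).sub h3).mul hw).sub h4
  have e : zdzS σ x a = mono 0 (sg a * (x.1 a : ℂ)) +
      (∑ j : Fin D, mono (-((j : ℤ) + 1)) (sg a * (((j : ℂ) + 1) * x.2 a j))) -
      mono 0 (sg a : ℂ) * ofPS (PowerSeries.mk fun i => (i : ℂ) * σ a i 0 x) := by
    rw [zdzS, ← Int.cast_smul_eq_zsmul ℂ, smul_eq_mono_mul, mul_sub, mul_add, mono_mul,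
      Finset.mul_sum, add_zero]
    congr 2
    refine Finset.sum_congr rfl fun j _ => ?_
    rw [mono_mul, zero_add]
  rw [sub_zero, ← e] at h5
  exact h5

theorem lTendsto_orlovWave (hU : IsOpen U) (hε₀ : 0 < ε₀) (hσ : QuasiClassical U ε₀ n₀ A σ)
    (hx : x ∈ U) (a : Idx N) (i : ℕ) (j : ℤ) :
    LTendsto (fun p : ℝ × (Idx N → ℤ) => mono 0 ((p.1 : ℂ) ^ i) *
      (orlovWave (A p.1) n₀ ((p.1 : ℂ)⁻¹ • x.2) p.2 a i j *
        (waveSer (A p.1) n₀ ((p.1 : ℂ)⁻¹ • x.2) p.2 a)⁻¹)) (slowLim x.1)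
      (mono (-j) 1 * zdzS σ x a ^ i) := by
  have h : ∀ i : ℕ, LTendsto (fun p : ℝ × (Idx N → ℤ) =>
      (orlovConj (p.1 : ℂ) a ((n₀ : ℂ) - ν a + sg a * p.2 a) (((p.1 : ℂ)⁻¹ • x.2) a)
      (PowerSeries.mk fun i => σ a i p.1 (toSlow p.1 p.2 ((p.1 : ℂ)⁻¹ • x.2)) / p.1))^[i] 1)
      (slowLim x.1) (zdzS σ x a ^ i) := by
    intro i
    induction i with
    | zero => simpa using lTendsto_const 1
    | succ i ih =>
      simp only [Function.iterate_succ_apply', pow_succ']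
      exact lTendsto_orlovConj hU hε₀ hσ hx a ih
  refine ((lTendsto_const (mono (-j) 1)).mul (h i)).congr' ?_
  filter_upwards [eventually_good hU hε₀ hx] with p hp
  have hw := hσ.waveSer_eq hp.1 hp.2 a
  have hne := hσ.waveSer_ne_zero hp.1 hp.2 a
  have key := orlov_iterate_expSeries (p.1 : ℂ) a ((n₀ : ℂ) - ν a + sg a * p.2 a)
    (((p.1 : ℂ)⁻¹ • x.2) a)
    (PowerSeries.mk fun i => σ a i p.1 (toSlow p.1 p.2 ((p.1 : ℂ)⁻¹ • x.2)) / p.1) i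
  rw [← hw] at key
  rw [orlovWave, ← waveSer]
  calc _ = mono (-j) 1 * (((orlovConj (p.1 : ℂ) a ((n₀ : ℂ) - ν a + sg a * p.2 a)
        (((p.1 : ℂ)⁻¹ • x.2) a) (PowerSeries.mk fun i =>
          σ a i p.1 (toSlow p.1 p.2 ((p.1 : ℂ)⁻¹ • x.2)) / p.1))^[i] 1 *
          waveSer (A p.1) n₀ ((p.1 : ℂ)⁻¹ • x.2) p.2 a) *
          (waveSer (A p.1) n₀ ((p.1 : ℂ)⁻¹ • x.2) p.2 a)⁻¹) := by
        rw [mul_assoc _ _ (_)⁻¹, mul_inv_cancel₀ hne, mul_one]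
    _ = _ := by rw [← key]; ring

/-! ## Admissible families of coefficients -/

variable {F : ℝ → Idx N → ℕ → ℤ → ℂ} {F₀ : Idx N → ℕ → ℤ → ℂ}

theorem Admissible.finiteAbove (hF : Admissible D ε₀ F F₀) {ε : ℝ} (hε : ε ∈ Set.Ioo 0 ε₀)
    (a : Idx N) : FiniteAbove D (F ε a) := fun m =>
  (hF.finite a m).subset fun _ h => ⟨⟨ε, hε, h.1⟩, h.2⟩

theorem Admissible.tendsto (hF : Admissible D ε₀ F F₀) (a : Idx N) (i : ℕ) (j : ℤ) :
    Tendsto (fun ε : ℝ => F ε a i j * ((ε : ℂ) ^ i)⁻¹) (𝓝[>] 0) (𝓝 (F₀ a i j)) := by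
  have h1 : (fun ε : ℝ => (F ε a i j - F₀ a i j * (ε : ℂ) ^ i) * ((ε : ℂ) ^ i)⁻¹) =O[𝓝[>] 0]
      fun ε : ℝ => ε := by
    have h2 : (fun ε : ℝ => ((ε : ℂ) ^ i)⁻¹) =O[𝓝[>] 0] fun ε : ℝ => (ε ^ i)⁻¹ :=
      Asymptotics.isBigO_of_le _ fun ε => by simp
    refine ((hF.expansion a i j).mul h2).congr' EventuallyEq.rfl ?_
    filter_upwards [self_mem_nhdsWithin] with ε hε
    have hε : 0 < ε := hε
    have : ε ^ i ≠ 0 := pow_ne_zero _ hε.ne'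
    rw [pow_succ']
    field_simp
  have h3 := h1.trans_tendsto (tendsto_nhdsWithin_of_tendsto_nhds tendsto_id)
  have h4 := h3.add_const (F₀ a i j)
  rw [zero_add] at h4
  refine h4.congr' ?_
  filter_upwards [self_mem_nhdsWithin] with ε hε
  have hε : 0 < ε := hε
  have : (ε : ℂ) ^ i ≠ 0 := pow_ne_zero _ (by exact_mod_cast hε.ne')
  field_simp
  ring

/-- It transfers the finiteness condition and the bounds from `F` to the limit coefficients `F₀`. -/
theorem Admissible.exists_ne_zero (hε₀ : 0 < ε₀) (hF : Admissible D ε₀ F F₀) {a : Idx N} {i : ℕ}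
    {j : ℤ} (h : F₀ a i j ≠ 0) : ∃ ε ∈ Set.Ioo 0 ε₀, F ε a i j ≠ 0 := by
  by_contra! hc
  refine h (tendsto_nhds_unique (hF.tendsto a i j) (tendsto_const_nhds.congr' ?_))
  filter_upwards [Ioo_mem_nhdsGT hε₀] with ε hε
  rw [hc ε hε, zero_mul]

theorem Admissible.finiteAbove_limit (hε₀ : 0 < ε₀) (hF : Admissible D ε₀ F F₀) (a : Idx N) :
    FiniteAbove D (F₀ a) := fun m =>
  (hF.finite a m).subset fun _ h => ⟨hF.exists_ne_zero hε₀ h.1, h.2⟩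

/-- A common bound for all `ε`. -/
theorem Admissible.exists_bound (hF : Admissible D ε₀ F F₀) :
    ∃ d : ℤ, 0 ≤ d ∧ ∀ a i j, (∃ ε ∈ Set.Ioo 0 ε₀, F ε a i j ≠ 0) → (D : ℤ) * i + j ≤ d := by
  have h : ∀ a, ∃ d : ℤ, ∀ i j, (∃ ε ∈ Set.Ioo 0 ε₀, F ε a i j ≠ 0) → (D : ℤ) * i + j ≤ d := by
    intro a
    obtain ⟨d, hd⟩ := ((hF.finite a 0).image fun ij => (D : ℤ) * ij.1 + ij.2).bddAbove
    refine ⟨max d 0, fun i j hij => ?_⟩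
    by_cases h0 : 0 ≤ (D : ℤ) * i + j
    · exact le_max_of_le_left (hd ⟨(i, j), ⟨hij, h0⟩, rfl⟩)
    · exact le_max_of_le_right (by omega)
  choose d hd using h
  obtain ⟨e, he⟩ := (Set.finite_range d).bddAbove
  exact ⟨max e 0, le_max_right _ _, fun a i j hij =>
    (hd a i j hij).trans (le_max_of_le_left (he ⟨a, rfl⟩))⟩

/-- The series `∑ F_{ij} y^(-j) (z ∂𝒮_{a,0}/∂z)^i`. -/
noncomputable def symbolSer (σ : Idx N → ℕ → ℝ → Slow N D → ℂ) (x : Slow N D) (F : ℕ → ℤ → ℂ)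
    (a : Idx N) : LaurentSeries ℂ :=
  toLaurent fun r => ∑ᶠ ij : ℕ × ℤ, (F ij.1 ij.2 • (mono (-ij.2) 1 * zdzS σ x a ^ ij.1)).coeff r

theorem below_symbol_term (a : Idx N) (i : ℕ) (j : ℤ) :
    Below (mono (-j) 1 * zdzS σ x a ^ i) (-(D * i + j)) :=
  ((below_mono (-j) 1).mul ((below_zdzS a).pow i)).mono_le (by linarith)

theorem hasLSum_symbolSer {F : ℕ → ℤ → ℂ} (hF : FiniteAbove D F) (a : Idx N) :
    HasLSum (fun ij : ℕ × ℤ => F ij.1 ij.2 • (mono (-ij.2) 1 * zdzS σ x a ^ ij.1))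
      (symbolSer σ x F a) :=
  hasLSum_of_finiteAbove hF (u := fun i j => mono (-j) 1 * zdzS σ x a ^ i) (below_symbol_term a)

theorem below_stringWave {F : ℕ → ℤ → ℂ} (hF : FiniteAbove D F) {d : ℤ}
    (hd : ∀ i j, F i j ≠ 0 → (D : ℤ) * i + j ≤ d) {A : TodaData N D} (t : Times N D)
    (s : Idx N → ℤ) (a : Idx N) : Below (stringWave A n₀ t F s a) (-d) :=
  (hasLSum_of_finiteAbove hF (below_orlovWave s a)).below fun ij r hr => by
    by_cases h : F ij.1 ij.2 = 0
    · rw [HahnSeries.coeff_smul, h, smul_eq_mul, zero_mul]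
    · rw [HahnSeries.coeff_smul, below_orlovWave _ _ _ _ r (by have := hd _ _ h; omega), smul_zero]

/-- Write `F_{ij} ℳ^i = (F_{ij} ε^(-i)) (ε ℳ)^i`: both factors converge. In each degree only
finitely many pairs `(i, j)` occur. -/
theorem lTendsto_stringWave (hU : IsOpen U) (hε₀ : 0 < ε₀) (hσ : QuasiClassical U ε₀ n₀ A σ)
    (hx : x ∈ U) (hF : Admissible D ε₀ F F₀) (a : Idx N) :
    LTendsto (fun p : ℝ × (Idx N → ℤ) =>
      stringWave (A p.1) n₀ ((p.1 : ℂ)⁻¹ • x.2) (F p.1 a) p.2 a *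
        (waveSer (A p.1) n₀ ((p.1 : ℂ)⁻¹ • x.2) p.2 a)⁻¹) (slowLim x.1)
      (symbolSer σ x (F₀ a) a) := by
  obtain ⟨d, -, hd⟩ := hF.exists_bound
  have hF₀ := hF.finiteAbove_limit hε₀ a
  have hsum := hasLSum_symbolSer (σ := σ) (x := x) hF₀ a
  refine ⟨⟨-d, hsum.below fun ij r hr => ?_, ?_⟩, fun r => ?_⟩
  · by_cases h : F₀ a ij.1 ij.2 = 0
    · rw [HahnSeries.coeff_smul, h, smul_eq_mul, zero_mul]
    · have := hd a _ _ (hF.exists_ne_zero hε₀ h)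
      rw [HahnSeries.coeff_smul, below_symbol_term _ _ _ r (by omega), smul_zero]
  · filter_upwards [eventually_good hU hε₀ hx] with p hp
    have := (below_stringWave (n₀ := n₀) (hF.finiteAbove hp.1 a)
      (fun i j h => hd a i j ⟨_, hp.1, h⟩) (A := A p.1) ((p.1 : ℂ)⁻¹ • x.2) p.2 a).mul
      (hσ.below_waveSer_inv hp.1 hp.2 a)
    simpa using this
  -- This finite set works for all `ε` at once, which is why finiteness is required uniformly in
  -- `ε`.
  · set S := (hF.finite a (-r)).toFinset with hS
    have e1 : (symbolSer σ x (F₀ a) a).coeff r = ∑ ij ∈ S,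
        F₀ a ij.1 ij.2 * (mono (-ij.2) 1 * zdzS σ x a ^ ij.1).coeff r := by
      rw [(hsum.2 r).2, finsum_eq_sum_of_support_subset (s := S)]
      · exact Finset.sum_congr rfl fun ij _ => by rw [HahnSeries.coeff_smul, smul_eq_mul]
      · intro ij hij
        rw [Function.mem_support, HahnSeries.coeff_smul] at hij
        rw [hS, Set.Finite.coe_toFinset]
        refine ⟨hF.exists_ne_zero hε₀ fun h => hij (by rw [h, zero_smul]), ?_⟩
        by_contra h
        exact hij (by rw [below_symbol_term _ _ _ r (by omega), smul_zero])
    rw [e1]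
    have h2 := tendsto_finsetSum S fun ij _ =>
      ((hF.tendsto a ij.1 ij.2).comp (tendsto_slowLim_eps x.1)).mul
        ((lTendsto_orlovWave hU hε₀ hσ hx a ij.1 ij.2).2 r)
    refine h2.congr' ?_
    filter_upwards [eventually_good hU hε₀ hx] with p hp
    have hε : (p.1 : ℂ) ≠ 0 := by exact_mod_cast hp.1.1.ne'
    have hs := (hasLSum_of_finiteAbove (hF.finiteAbove hp.1 a)
      (below_orlovWave (A := A p.1) (n₀ := n₀) (t := (p.1 : ℂ)⁻¹ • x.2) p.2 a)).mul_left
        (waveSer (A p.1) n₀ ((p.1 : ℂ)⁻¹ • x.2) p.2 a)⁻¹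
    rw [mul_comm, stringWave, (hs.2 r).2, finsum_eq_sum_of_support_subset (s := S)]
    · refine Finset.sum_congr rfl fun ij _ => ?_
      beta_reduce
      rw [coeff_mono_mul, sub_zero, smul_eq_mono_mul,
        mul_left_comm (waveSer _ _ _ _ _)⁻¹, coeff_mono_mul, sub_zero, mul_comm (waveSer _ _ _ _ _)⁻¹]
      simp only [Function.comp]
      field_simp
    · intro ij hij
      rw [Function.mem_support] at hij
      beta_reduce at hij
      rw [smul_eq_mono_mul, mul_left_comm, coeff_mono_mul] at hij
      rw [hS, Set.Finite.coe_toFinset]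
      refine ⟨⟨_, hp.1, fun h => hij (by rw [h, zero_mul])⟩, ?_⟩
      by_contra h
      refine hij ?_
      have := (hσ.below_waveSer_inv hp.1 hp.2 a).mul
        (below_orlovWave (A := A p.1) (n₀ := n₀) (t := (p.1 : ℂ)⁻¹ • x.2) p.2 a ij.1 ij.2)
      rw [this _ (by omega), mul_zero]

end OrlovLimits

/-! ## Exponentials of derivatives of the action -/

section Exponentials

variable {N D : ℕ} (σ : Idx N → ℕ → ℝ → Slow N D → ℂ) (x : Slow N D)

theorem dirS_add (v w : Idx N → ℤ) : (dirS (v + w) : Slow N D) = dirS v + dirS w :=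
  Prod.ext (funext fun a => by simp [dirS]) (by simp [dirS])

theorem dirS_neg (v : Idx N → ℤ) : (dirS (-v) : Slow N D) = -dirS v :=
  Prod.ext (funext fun a => by simp [dirS]) (by simp [dirS])

theorem dσ_dirS_neg (a : Idx N) (i : ℕ) (v : Idx N → ℤ) :
    dσ σ x a i (dirS (-v)) = -dσ σ x a i (dirS v) := by
  rw [dσ, dirS_neg, map_neg, dσ]

theorem expdsS_add (v w : Idx N → ℤ) (c : Idx N) :
    expdsS σ x (v + w) c = expdsS σ x v c * expdsS σ x w c := by
  have h : (PowerSeries.mk fun i => dσ σ x c i (dirS (v + w))) =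
      (PowerSeries.mk fun i => dσ σ x c i (dirS v)) +
        PowerSeries.mk fun i => dσ σ x c i (dirS w) := by
    ext i
    simp only [map_add, PowerSeries.coeff_mk, dσ, dirS_add]
  have e : mono (-(v + w) c) 1 = mono (-v c) 1 * mono (-w c) 1 := by
    rw [mono_mul, mul_one, Pi.add_apply, neg_add]
  rw [expdsS, h, expSeries_add, ofPS_mul, e, expdsS, expdsS]
  ring

theorem hasOrd_expdsS (v : Idx N → ℤ) (c : Idx N) : HasOrd (expdsS σ x v c) (-v c) := by
  have h1 : HasOrd (mono (-v c) 1) (-v c) := ⟨below_mono _ _, by simp [coeff_mono]⟩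
  have := h1.mul (hasOrd_expSeries (PowerSeries.mk fun i => dσ σ x c i (dirS v)))
  rwa [add_zero] at this

theorem expdsS_zero (c : Idx N) : expdsS σ x 0 c = 1 := by
  have h := expdsS_add σ x 0 0 c
  rw [add_zero] at h
  exact (mul_eq_left₀ (hasOrd_expdsS σ x 0 c).ne_zero).1 h.symm

theorem expdsS_neg (v : Idx N → ℤ) (c : Idx N) : expdsS σ x (-v) c = (expdsS σ x v c)⁻¹ := by
  refine (inv_eq_of_mul_eq_one_right ?_).symm
  rw [← expdsS_add, add_neg_cancel, expdsS_zero]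

theorem expdsS_nsmul (v : Idx N → ℤ) (c : Idx N) (n : ℕ) :
    expdsS σ x (n • v) c = expdsS σ x v c ^ n := by
  induction n with
  | zero => rw [zero_smul, expdsS_zero, pow_zero]
  | succ n ih => rw [succ_nsmul, expdsS_add, ih, pow_succ]

theorem expdsS_zsmul (v : Idx N → ℤ) (c : Idx N) (j : ℤ) :
    expdsS σ x (j • v) c = expdsS σ x v c ^ j := by
  obtain ⟨n, rfl | rfl⟩ := j.eq_nat_or_neg
  · rw [natCast_zsmul, expdsS_nsmul, zpow_natCast]
  · rw [neg_smul, natCast_zsmul, expdsS_neg, expdsS_nsmul, zpow_neg, zpow_natCast]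

end Exponentials

/-! ## The relation between shifts and the first time -/

section FirstTime

variable {N D : ℕ} [NeZero N] [NeZero D]

theorem sum_shiftVec (a b : Idx N) : ∑ c, shiftVec a b c = 0 := by
  simp [shiftVec, Finset.sum_sub_distrib]

theorem shiftVec_self_left {a b : Idx N} (h : a ≠ b) : shiftVec a b a = 1 := by
  simp [shiftVec, h]

theorem shiftVec_nonpos {a b c : Idx N} (h : c ≠ a) : shiftVec a b c ≤ 0 := by
  simp only [shiftVec, Pi.sub_apply, Pi.single_apply, h, if_false]
  split_ifs <;> simp

theorem neg_shiftVec (a b : Idx N) : -shiftVec a b = shiftVec b a := neg_sub _ _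

theorem dκ_inl_zero {A : TodaData N D} {dom : Set ((Idx N → ℤ) × Times N D)}
    (hA : SolvesFactorization A dom) {n₀ : ℤ} {s : Idx N → ℤ} {t : Times N D}
    (hs : ∀ᶠ t' in 𝓝 t, (s, t') ∈ dom) (a : Idx N) (j : Fin D) :
    dκ A n₀ t a j s (Sum.inl 0) 0 = 0 := by
  have : (fun t' => A.κ n₀ t' (Sum.inl 0) 0 s) =ᶠ[𝓝 t] fun _ => (1 : ℂ) := hs.mono fun t' h => by
    simp only [TodaData.κ, if_true]
    rw [hA.lead _ _ h, Matrix.one_apply_eq]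
  rw [dκ, this.fderiv_eq]
  simp

/-- Apply transversality to `T_(1,b)Ψ - ∂_{t_{11}}Ψ - kΨ`. Only component `1` can have a pole, the
simple poles there cancel since both have leading coefficient `1`, and `k` is the value that removes
the constant term. -/
theorem shiftedWave_first {A : TodaData N D} {dom : Set ((Idx N → ℤ) × Times N D)}
    (hA : SolvesFactorization A dom) {n₀ : ℤ} {s : Idx N → ℤ} {t : Times N D}
    (hs : ∀ᶠ t' in 𝓝 t, (s, t') ∈ dom) {b : Idx N} (hb : b ≠ Sum.inl 0)
    (hv : (s + shiftVec (Sum.inl 0) b, t) ∈ dom) (c : Idx N) :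
    shiftedWave A n₀ t (shiftVec (Sum.inl 0) b) s c = timeWave A n₀ t (Sum.inl 0) 0 s c +
      (A.κ n₀ t (Sum.inl 0) 1 (s + shiftVec (Sum.inl 0) b) - A.κ n₀ t (Sum.inl 0) 1 s) •
        shiftedWave A n₀ t 0 s c := by
  have hst := hs.self_of_nhds
  set k := A.κ n₀ t (Sum.inl 0) 1 (s + shiftVec (Sum.inl 0) b) - A.κ n₀ t (Sum.inl 0) 1 s with hk
  set v := shiftVec (Sum.inl 0) b with hvdef
  have hin := ((inGr_shiftedWave (n₀ := n₀) hA hst hv).sub (inGr_timeWave hA hs (Sum.inl 0) 0)).sub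
    ((inGr_shiftedWave (n₀ := n₀) (v := 0) hA hst (by rwa [add_zero])).smul k)
  have hone : ∀ s' t', (s', t') ∈ dom → A.κ n₀ t' (Sum.inl 0) 0 s' = 1 := fun s' t' h => by
    simp only [TodaData.κ, if_true]
    rw [hA.lead _ _ h, Matrix.one_apply_eq]
  have hd := dκ_inl_zero hA (n₀ := n₀) hs (Sum.inl 0) 0
  have hv1 : v (Sum.inl 0) = 1 := shiftVec_self_left hb.symm
  have h00 : (((0 : Fin D) : ℕ) : ℤ) = 0 := by simp
  have := hin.eq_zero (hA.lead s t hst) (hA.lead_bar s t hst) (fun r hr => ?_) (fun c' r hr => ?_) c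
  · rw [sub_sub, sub_eq_zero] at this
    exact this
  · simp only [HahnSeries.coeff_sub, HahnSeries.coeff_smul, smul_eq_mul, coeff_shiftedWave,
      coeff_timeWave, if_true, hv1, Pi.zero_apply, neg_zero, add_zero, h00, zero_add]
    rcases lt_trichotomy r (-1) with h | h | h
    · rw [if_neg (by omega), if_neg (by omega), if_neg (by omega), if_neg (by omega)]
      ring
    · subst h
      simp [hone _ _ hst, hone _ _ hv]
    · have h0 : r = 0 := by omega
      subst h0
      simp [hone _ _ hst, hd, hk]
  · by_cases hc : c' = Sum.inl 0
    · subst hc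
      simp only [HahnSeries.coeff_sub, HahnSeries.coeff_smul, smul_eq_mul, coeff_shiftedWave,
        coeff_timeWave, if_true, hv1, Pi.zero_apply, neg_zero, add_zero, h00, zero_add]
      rcases lt_trichotomy r (-1) with h | h | h
      · rw [if_neg (by omega), if_neg (by omega), if_neg (by omega), if_neg (by omega)]
        ring
      · subst h
        simp [hone _ _ hst, hone _ _ hv]
      · omega
    · have : v c' ≤ 0 := shiftVec_nonpos (b := b) hc
      simp only [HahnSeries.coeff_sub, HahnSeries.coeff_smul, smul_eq_mul, coeff_shiftedWave,
        coeff_timeWave, Pi.zero_apply, neg_zero]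
      rw [if_neg (by omega), if_neg (Ne.symm hc), if_neg (by omega), if_neg (by omega)]
      ring

variable {U : Set (Slow N D)} {ε₀ : ℝ} {n₀ : ℤ} {A : ℝ → TodaData N D}
  {σ : Idx N → ℕ → ℝ → Slow N D → ℂ} {x : Slow N D}

/-- Since `σ_{1,0} = 0`, the exponential agrees with its exponent in degree one. -/
theorem κ_first_coeff (hσ : QuasiClassical U ε₀ n₀ A σ) {ε : ℝ} (hε : ε ∈ Set.Ioo 0 ε₀)
    {s : Idx N → ℤ} {t : Times N D} (h : (s, t) ∈ fastDom U ε) :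
    (A ε).κ n₀ t (Sum.inl 0) 1 s = σ (Sum.inl 0) 1 ε (toSlow ε s t) / ε := by
  have := congrArg (PowerSeries.coeff 1) (hσ.wave ε hε s t h (Sum.inl 0))
  rw [PowerSeries.coeff_mk, coeff_one_expSeries, PowerSeries.coeff_mk] at this
  · exact this
  · rw [PowerSeries.coeff_mk, hσ.lead ε ⟨hε.1.le, hε.2⟩ _ h.2, zero_div]

/-- The implicit relation between the shifts and `∂/∂t_{11}`. -/
theorem expdsS_first (hU : IsOpen U) (hε₀ : 0 < ε₀)
    (hA : ∀ ε ∈ Set.Ioo 0 ε₀, SolvesFactorization (A ε) (fastDom U ε))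
    (hσ : QuasiClassical U ε₀ n₀ A σ) (hx : x ∈ U) (hx₀ : ∑ a, x.1 a = 0) {b : Idx N}
    (hb : b ≠ Sum.inl 0) (c : Idx N) :
    expdsS σ x (shiftVec (Sum.inl 0) b) c = dtS σ x (Sum.inl 0) 0 c - mono 0 (q σ x b) := by
  have := slowLim_neBot hx₀
  set v := shiftVec (Sum.inl 0) b with hvdef
  have hv : ∑ a, v a = 0 := sum_shiftVec _ _
  have hk : Tendsto (fun p : ℝ × (Idx N → ℤ) =>
      (A p.1).κ n₀ ((p.1 : ℂ)⁻¹ • x.2) (Sum.inl 0) 1 (p.2 + v) -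
        (A p.1).κ n₀ ((p.1 : ℂ)⁻¹ • x.2) (Sum.inl 0) 1 p.2) (slowLim x.1) (𝓝 (-q σ x b)) := by
    have h1 := tendsto_slope_slow hU hε₀ (hσ.smooth (Sum.inl 0) 1) hx (tendsto_slowLim_eps x.1)
      (tendsto_slowPt x) (dirS v)
    have e : fderiv ℝ (σ (Sum.inl 0) 1 0) x (dirS v) = -q σ x b := by
      rw [q, ← neg_shiftVec, dσ_dirS_neg, neg_neg, dσ]
    rw [e] at h1
    refine h1.congr' ?_
    filter_upwards [eventually_good hU hε₀ hx, eventually_slowLim_mem hU hx hv] with p h1 h2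
    rw [κ_first_coeff hσ h1.1 h1.2, κ_first_coeff hσ h1.1 h2, toSlow_add, sub_div]
    rfl
  have h0 := lTendsto_shiftedWave hU hε₀ hσ hx (v := 0) (by simp) c
  rw [expdsS_zero] at h0
  have h1 := (lTendsto_timeWave hU hε₀ hσ hx hA (Sum.inl 0) 0 c).add (LTendsto.smul hk h0)
  have e : dtS σ x (Sum.inl 0) 0 c + (-q σ x b) • (1 : LaurentSeries ℂ) =
      dtS σ x (Sum.inl 0) 0 c - mono 0 (q σ x b) := by
    rw [sub_eq_add_neg, smul_eq_mono_mul, mul_one]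
    congr 1
    ext r
    simp only [HahnSeries.coeff_neg, coeff_mono]
    split_ifs <;> simp
  rw [e] at h1
  refine (lTendsto_shiftedWave hU hε₀ hσ hx hv c).unique (h1.congr' ?_)
  filter_upwards [eventually_good hU hε₀ hx, eventually_slowLim_mem hU hx hv,
    eventually_time_mem hU hε₀ hx] with p h1 h2 h3
  rw [shiftedWave_first (hA _ h1.1) h3 hb h2 c, add_mul, ← hvdef, smul_eq_mono_mul,
    smul_eq_mono_mul, mul_assoc]

end FirstTime

/-! ## Expansions of rational functions -/

section Expand

variable {N D : ℕ} [NeZero N] [NeZero D] (σ : Idx N → ℕ → ℝ → Slow N D → ℂ) (x : Slow N D)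
  (pic : Picture) (a₀ : Idx N)

theorem mono_sub (k : ℤ) (c d : ℂ) : mono k (c - d) = mono k c - mono k d := by
  ext r
  simp only [HahnSeries.coeff_sub, coeff_mono]
  split_ifs <;> simp

theorem pLoc_ne_C (a : Idx N) (u : ℂ) : pLoc σ x pic a₀ a - HahnSeries.C u ≠ 0 := by
  change pLoc σ x pic a₀ a - mono 0 u ≠ 0
  intro h
  rw [pLoc] at h
  split_ifs at h with ha
  · have := congrArg (fun f => HahnSeries.coeff f (-1)) h
    simp [coeff_mono] at this
  · have := congrArg (fun f => HahnSeries.coeff f 1) h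
    simp [coeff_mono] at this

/-- A polynomial over `ℂ` is a product of linear factors, and none of them vanishes because `p` is
not constant in the local parameter. Denominators thus stay nonzero, and expansion at a puncture is
a ring homomorphism. -/
theorem eval₂_pLoc_ne_zero (a : Idx N) {f : Polynomial ℂ} (hf : f ≠ 0) :
    f.eval₂ HahnSeries.C (pLoc σ x pic a₀ a) ≠ 0 := by
  rw [(IsAlgClosed.splits f).eq_prod_roots, Polynomial.eval₂_mul, Polynomial.eval₂_C,
    Polynomial.eval₂_multiset_prod, Multiset.map_map]
  refine mul_ne_zero ?_ (Multiset.prod_ne_zero ?_)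
  · rw [Ne, map_eq_zero]
    exact Polynomial.leadingCoeff_ne_zero.2 hf
  · rw [Multiset.mem_map]
    rintro ⟨u, -, hu⟩
    rw [Function.comp, Polynomial.eval₂_sub, Polynomial.eval₂_X, Polynomial.eval₂_C] at hu
    exact pLoc_ne_C σ x pic a₀ a u hu

/-- The expansion at a puncture as a ring homomorphism. -/
noncomputable def expandHom (a : Idx N) : RatFunc ℂ →+* LaurentSeries ℂ where
  toFun := expand σ x pic a₀ a
  map_one' := RatFunc.eval_one _ _
  map_zero' := RatFunc.eval_zero _ _
  map_add' f g := RatFunc.eval_add _ _ (eval₂_pLoc_ne_zero σ x pic a₀ a f.denom_ne_zero)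
    (eval₂_pLoc_ne_zero σ x pic a₀ a g.denom_ne_zero)
  map_mul' f g := RatFunc.eval_mul _ _ (eval₂_pLoc_ne_zero σ x pic a₀ a f.denom_ne_zero)
    (eval₂_pLoc_ne_zero σ x pic a₀ a g.denom_ne_zero)

theorem expandHom_apply (a : Idx N) (R : RatFunc ℂ) :
    expandHom σ x pic a₀ a R = expand σ x pic a₀ a R := rfl

theorem expandHom_X (a : Idx N) : expandHom σ x pic a₀ a RatFunc.X = pLoc σ x pic a₀ a :=
  RatFunc.eval_X _ _

theorem expandHom_C (a : Idx N) (c : ℂ) : expandHom σ x pic a₀ a (RatFunc.C c) = mono 0 c :=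
  RatFunc.eval_C _ _

end Expand

/-! ## The dispersionless Lax functions -/

section Lax

variable {N D : ℕ} [NeZero N] [NeZero D] {σ : Idx N → ℕ → ℝ → Slow N D → ℂ} {x : Slow N D}

/-- The relation between the shifts and `∂/∂t_{11}`. -/
def FirstTimeRelation (σ : Idx N → ℕ → ℝ → Slow N D → ℂ) (x : Slow N D) : Prop :=
  ∀ b, b ≠ Sum.inl 0 → ∀ c, expdsS σ x (shiftVec (Sum.inl 0) b) c =
    dtS σ x (Sum.inl 0) 0 c - mono 0 (q σ x b)

/-- The origin of `p` with respect to `∂𝒮/∂t_{11}`. -/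
noncomputable def pShift (σ : Idx N → ℕ → ℝ → Slow N D → ℂ) (x : Slow N D) (pic : Picture)
    (a₀ : Idx N) : ℂ :=
  match pic with
  | Picture.kp => 0
  | Picture.toda => q σ x a₀
  | Picture.altToda => q σ x (Sum.inr 0)

variable {pic : Picture} {a₀ : Idx N}

theorem FirstTimeRelation.pSeries_eq (hE : FirstTimeRelation σ x) (ha₀ : a₀ ≠ Sum.inl 0)
    (b : Idx N) : pSeries σ x pic a₀ b =
      dtS σ x (Sum.inl 0) 0 b - mono 0 (pShift σ x pic a₀) := by
  cases pic with
  | kp =>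
    change dtS σ x (Sum.inl 0) 0 b = dtS σ x (Sum.inl 0) 0 b - mono 0 0
    simp [mono]
  | toda => exact hE a₀ ha₀ b
  | altToda => exact hE _ (by simp) b

/-- Two instances of the relation are compared at the puncture `1̄`, in degree zero of `y`. -/
theorem FirstTimeRelation.ρ_eq (hE : FirstTimeRelation σ x) {a : Idx N} (ha : a ≠ Sum.inl 0)
    (ha' : a ≠ Sum.inr 0) : ρ σ x a = q σ x (Sum.inr 0) - q σ x a := by
  have h1 := congrArg (fun f => HahnSeries.coeff f 0) (hE a ha (Sum.inr 0))
  have h2 := congrArg (fun f => HahnSeries.coeff f 0) (hE (Sum.inr 0) (by simp) (Sum.inr 0))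
  have e1 : shiftVec (Sum.inl 0) a (Sum.inr 0) = 0 := by
    simp [shiftVec, Ne.symm ha']
  have e2 : (expdsS σ x (shiftVec (Sum.inl 0) a) (Sum.inr 0)).coeff 0 = ρ σ x a := by
    rw [expdsS, e1, neg_zero, mono_zero_one, one_mul, coeff_ofPS, if_pos le_rfl, Int.toNat_zero,
      coeff_zero_expSeries, PowerSeries.coeff_mk, ρ]
  -- The shift `T_(1,1̄)` lowers `s_1̄`, so its symbol vanishes at the puncture `1̄`.
  have e3 : (expdsS σ x (shiftVec (Sum.inl 0) (Sum.inr 0)) (Sum.inr 0)).coeff 0 = 0 := by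
    refine (hasOrd_expdsS σ x (shiftVec (Sum.inl 0) (Sum.inr 0)) (Sum.inr 0)).1 0 ?_
    simp [shiftVec]
  simp only [HahnSeries.coeff_sub, coeff_mono, if_true] at h1 h2
  rw [e2] at h1
  rw [e3] at h2
  rw [h1, sub_eq_zero.1 h2.symm]

/-- In all pictures `p` is `∂_{t_{11}} 𝒮` up to a translation, and the puncture `a` is the translate
of `q_a`. -/
theorem FirstTimeRelation.puncture_eq (hE : FirstTimeRelation σ x) {a : Idx N}
    (ha : a ≠ Sum.inl 0) : puncture σ x pic a₀ a = q σ x a - pShift σ x pic a₀ := by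
  cases pic with
  | kp => exact (sub_zero _).symm
  | toda =>
    change (if a = a₀ then 0 else q σ x a - q σ x a₀) = q σ x a - q σ x a₀
    split_ifs with h
    · rw [h, sub_self]
    · rfl
  | altToda =>
    change (if a = Sum.inr 0 then 0 else -ρ σ x a) = q σ x a - q σ x (Sum.inr 0)
    split_ifs with h
    · rw [h, sub_self]
    · rw [hE.ρ_eq ha h, neg_sub]

/-- The local parameter at a puncture as a series in `y`. -/
noncomputable def localSer (σ : Idx N → ℕ → ℝ → Slow N D → ℂ) (x : Slow N D) (pic : Picture)
    (a₀ a : Idx N) : LaurentSeries ℂ :=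
  if a = Sum.inl 0 then (pSeries σ x pic a₀ a)⁻¹
  else pSeries σ x pic a₀ a - mono 0 (puncture σ x pic a₀ a)

/-- At `a ≠ 1` the relation identifies `p` minus the puncture with `exp((∂_{s_1} - ∂_{s_a})
𝒮_{a,0})`, which has a simple zero as the shift lowers `s_a` by one. At `1` the exponential for `a₀`
has a simple pole and differs from `p` by a constant. -/
theorem FirstTimeRelation.hasOrd_localSer (hE : FirstTimeRelation σ x) (ha₀ : a₀ ≠ Sum.inl 0)
    (a : Idx N) : HasOrd (localSer σ x pic a₀ a) 1 := by
  rw [localSer]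
  split_ifs with ha
  · subst ha
    rw [show (1 : ℤ) = -(-1) by norm_num]
    refine HasOrd.inv ?_
    have h := hasOrd_expdsS σ x (shiftVec (Sum.inl 0) a₀) (Sum.inl 0)
    rw [shiftVec_self_left ha₀.symm] at h
    have e : pSeries σ x pic a₀ (Sum.inl 0) = expdsS σ x (shiftVec (Sum.inl 0) a₀) (Sum.inl 0) +
        mono 0 (q σ x a₀ - pShift σ x pic a₀) := by
      rw [hE.pSeries_eq ha₀, hE a₀ ha₀, mono_sub]
      ring
    rw [e]
    refine ⟨h.1.add ((below_mono 0 _).mono_le (by omega)), ?_⟩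
    rw [HahnSeries.coeff_add, coeff_mono, if_neg (by omega), add_zero]
    exact h.2
  · rw [hE.pSeries_eq ha₀, hE.puncture_eq ha, mono_sub, sub_sub, add_sub_cancel, ← hE a ha]
    have h := hasOrd_expdsS σ x (shiftVec (Sum.inl 0) a) a
    rwa [show shiftVec (Sum.inl 0) a a = -1 by simp [shiftVec, ha], neg_neg] at h

theorem isLaxFamily_iff (y : Idx N → LaurentSeries ℂ) : IsLaxFamily σ x pic a₀ y ↔
    ∀ a, 0 < (y a).order ∧ lsubst (localSer σ x pic a₀ a) (y a) = mono 1 1 := by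
  refine forall_congr' fun a => and_congr_right fun hy => ?_
  rw [localSer, pLoc]
  split_ifs with ha
  · rw [lsubst_inv hy, inv_eq_iff_eq_inv, mono_inv]
  · have e : lsubst (pSeries σ x pic a₀ a - mono 0 (puncture σ x pic a₀ a)) (y a) =
        lsubst (pSeries σ x pic a₀ a) (y a) - mono 0 (puncture σ x pic a₀ a) := by
      rw [← lsubstHom_apply hy, map_sub, lsubstHom_apply, lsubstHom_apply, lsubst_C hy]
    rw [e, sub_eq_iff_eq_add, add_comm]

theorem FirstTimeRelation.existsUnique_isLaxFamily (hE : FirstTimeRelation σ x)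
    (ha₀ : a₀ ≠ Sum.inl 0) : ∃! y : Idx N → LaurentSeries ℂ, IsLaxFamily σ x pic a₀ y := by
  choose y hy huniq using fun a => existsUnique_right_inverse (hE.hasOrd_localSer (pic := pic) ha₀ a)
  exact ⟨y, (isLaxFamily_iff y).2 hy, fun z hz => funext fun a =>
    huniq a (z a) ((isLaxFamily_iff z).1 hz a)⟩

/-- The symbol of the shift `𝒯_b` at the puncture `c` is `Z_b`. -/
theorem FirstTimeRelation.lsubst_expdsS (hE : FirstTimeRelation σ x) (ha₀ : a₀ ≠ Sum.inl 0)
    {y : Idx N → LaurentSeries ℂ} (hy : IsLaxFamily σ x pic a₀ y) (b c : Idx N) :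
    lsubst (expdsS σ x (vec pic a₀ b) c) (y c) = expandHom σ x pic a₀ c (Zfun σ x pic a₀ b) := by
  have hyc := (hy c).1
  have key : ∀ b, b ≠ Sum.inl 0 → lsubst (expdsS σ x (shiftVec (Sum.inl 0) b) c) (y c) =
      expandHom σ x pic a₀ c (RatFunc.X - RatFunc.C (q σ x b - pShift σ x pic a₀)) := by
    intro b hb
    have e : expdsS σ x (shiftVec (Sum.inl 0) b) c = pSeries σ x pic a₀ c -
        mono 0 (q σ x b - pShift σ x pic a₀) := by
      rw [hE b hb, hE.pSeries_eq ha₀, mono_sub]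
      ring
    rw [e, ← lsubstHom_apply hyc, map_sub, lsubstHom_apply, lsubstHom_apply, (hy c).2,
      lsubst_C hyc, map_sub, expandHom_X, expandHom_C]
  have key' : ∀ b, b ≠ Sum.inl 0 → lsubst (expdsS σ x (shiftVec b (Sum.inl 0)) c) (y c) =
      expandHom σ x pic a₀ c (1 / (RatFunc.X - RatFunc.C (q σ x b - pShift σ x pic a₀))) := by
    intro b hb
    rw [← neg_shiftVec, expdsS_neg, lsubst_inv hyc, key b hb, one_div, map_inv₀]
  cases pic with
  | kp =>
    simp only [pShift, sub_zero] at key key'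
    simp only [vec, Zfun]
    split_ifs with h
    · exact key a₀ ha₀
    · exact key' b h
  | toda =>
    simp only [pShift] at key key'
    simp only [vec, Zfun]
    split_ifs with h h'
    · rw [key a₀ ha₀, sub_self, map_zero, sub_zero]
    · rw [key' b h, h', sub_self, map_zero, sub_zero]
    · exact key' b h
  | altToda =>
    simp only [pShift] at key key'
    have h1 := key (Sum.inr 0) (by simp)
    rw [sub_self, map_zero, sub_zero] at h1
    simp only [vec, Zfun]
    by_cases h : b = Sum.inl 0
    · subst h
      rw [if_neg (by simp), if_pos rfl]
      exact h1
    · by_cases h' : b = Sum.inr 0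
      · subst h'
        rw [if_pos rfl, if_neg (by simp), if_pos rfl, key' _ (by simp), sub_self, map_zero,
          sub_zero]
      -- Factor `T_(b,1̄) = T_(b,1) T_(1,1̄)`: the first factor has symbol `1/(p + ρ_b)` and the
      -- second has symbol `p`.
      · rw [if_neg h', if_neg h, if_neg h', hE.ρ_eq h h',
          show shiftVec b (Sum.inr 0) = shiftVec b (Sum.inl 0) + shiftVec (Sum.inl 0) (Sum.inr 0) by
            simp [shiftVec], expdsS_add, lsubst_mul hyc, key' b h, h1, ← map_mul]
        congr 1
        rw [show q σ x (Sum.inr 0) - q σ x b = -(q σ x b - q σ x (Sum.inr 0)) by ring, map_neg,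
          ← sub_eq_add_neg, one_div, div_eq_inv_mul]

end Lax

/-! ## Series in descending powers -/

section Descending

theorem hasLSum_laurentSum_descending {Z : LaurentSeries ℂ} (hZ : 0 < Z⁻¹.order) {c : ℤ → ℂ}
    {d : ℤ} (hc : ∀ j > d, c j = 0) : HasLSum (fun j : ℤ => c j • Z ^ j) (laurentSum c Z) := by
  rw [laurentSum_inv]
  have := (hasLSum_laurentSum hZ (c := fun j => c (-j)) (a := -d)
    (fun j hj => hc _ (by omega))).comp_equiv (Equiv.neg ℤ)
  simpa using this

theorem lsubst_laurentSum {E y : LaurentSeries ℂ} (hE : HasOrd E (-1)) (hy : 0 < y.order)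
    {c : ℤ → ℂ} {d : ℤ} (hc : ∀ j > d, c j = 0) :
    lsubst (laurentSum c E) y = laurentSum c (lsubst E y) := by
  have h1 : 0 < E⁻¹.order := by rw [hE.inv.order_eq]; norm_num
  have h2 : 0 < (lsubst E y)⁻¹.order := by
    rw [(hE.lsubst hy).inv.order_eq]
    omega
  have h3 := (hasLSum_laurentSum_descending h1 hc).lsubst hy
  simp only [lsubst_smul hy, lsubst_zpow hy] at h3
  exact h3.unique (hasLSum_laurentSum_descending h2 hc)

/-- A simple pole of `E` makes `E ^ j` start in degree `-j`, so degree `r` involves only `-r ≤ j ≤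
d`. -/
theorem coeff_laurentSum {E : LaurentSeries ℂ} (hE : HasOrd E (-1)) {c : ℤ → ℂ} {d : ℤ}
    (hc : ∀ j > d, c j = 0) (r : ℤ) :
    (laurentSum c E).coeff r = ∑ j ∈ Finset.Icc (-r) d, c j * (E ^ j).coeff r := by
  have h1 : 0 < E⁻¹.order := by rw [hE.inv.order_eq]; norm_num
  rw [((hasLSum_laurentSum_descending h1 hc).2 r).2, finsum_eq_sum_of_support_subset
    (s := Finset.Icc (-r) d)]
  · refine Finset.sum_congr rfl fun j _ => ?_
    rw [HahnSeries.coeff_smul, smul_eq_mul]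
  · intro j hj
    rw [Function.mem_support, HahnSeries.coeff_smul, smul_eq_mul] at hj
    rw [Finset.coe_Icc, Set.mem_Icc]
    constructor
    · by_contra h
      exact right_ne_zero_of_mul hj ((hE.zpow j).1 r (by omega))
    · by_contra h
      exact left_ne_zero_of_mul hj (hc j (by omega))

theorem laurentSum_of_finite {Z : LaurentSeries ℂ} (hZ : 0 < Z⁻¹.order) {c : ℤ → ℂ} {d : ℤ}
    (hc : ∀ j > d, c j = 0) (hc' : ∀ j < 0, c j = 0) :
    laurentSum c Z = ∑ j ∈ Finset.Icc 0 d, c j • Z ^ j := by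
  ext r
  rw [((hasLSum_laurentSum_descending hZ hc).2 r).2, HahnSeries.coeff_sum,
    finsum_eq_sum_of_support_subset]
  intro j hj
  rw [Function.mem_support, HahnSeries.coeff_smul, smul_eq_mul] at hj
  rw [Finset.coe_Icc, Set.mem_Icc]
  constructor
  · by_contra h
    exact left_ne_zero_of_mul hj (hc' j (by omega))
  · by_contra h
    exact left_ne_zero_of_mul hj (hc j (by omega))

end Descending

/-! ### Projections as rational functions -/

section PlusSum

variable {N D : ℕ} [NeZero N] [NeZero D] (σ : Idx N → ℕ → ℝ → Slow N D → ℂ) (x : Slow N D)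
  (pic : Picture) (a₀ : Idx N)

/-- The three forms of the projection become one by collecting the constants `-1` of the alternative
Toda picture into the coefficient of `Z_a⁰`. -/
theorem plusSum_eq (a : Idx N) {c : ℤ → ℂ} {d : ℤ} (hd : 0 ≤ d) (hc : ∀ j > d, c j = 0) :
    plusSum σ x pic a₀ a c =
      ∑ j ∈ Finset.Icc 0 d, RatFunc.C (plusC pic a c j) * Zfun σ x pic a₀ a ^ j := by
  have hpos : ∀ j ∈ Finset.Ioc 0 d, a ≠ Sum.inl 0 → plusC pic a c j = c j := by
    intro j hj ha
    rw [Finset.mem_Ioc] at hj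
    rw [plusC, if_neg ha, if_pos hj.1]
  rw [plusSum]
  split_ifs with ha hp
  · subst ha
    rw [finsum_eq_sum_of_support_subset (s := Finset.Icc 0 d)]
    · refine Finset.sum_congr rfl fun j hj => ?_
      rw [Finset.mem_Icc] at hj
      rw [if_pos hj.1, plusC, if_pos rfl, if_pos hj.1]
    · intro j hj
      rw [Function.mem_support] at hj
      rw [Finset.coe_Icc, Set.mem_Icc]
      by_cases h0 : 0 ≤ j
      · refine ⟨h0, ?_⟩
        by_contra h1
        exact hj (by rw [hc j (by omega), map_zero, zero_mul, ite_self])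
      · exact absurd (if_neg h0) hj
  · rw [finsum_ite_pos (g := fun j => RatFunc.C (c j) * (Zfun σ x pic a₀ a ^ j - 1))
      (fun j hj => by rw [hc j hj, map_zero, zero_mul])]
    have hz := sum_plusC (pic := pic) hd hc ha hp
    rw [← Finset.Ioc_insert_left hd, Finset.sum_insert (by simp)] at hz ⊢
    rw [eq_neg_of_add_eq_zero_left hz, zpow_zero, mul_one, map_neg, map_sum, add_comm,
      ← sub_eq_add_neg, ← Finset.sum_sub_distrib]
    refine Finset.sum_congr rfl fun j hj => ?_
    rw [hpos j hj ha]
    ring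
  · rw [finsum_ite_pos (g := fun j => RatFunc.C (c j) * Zfun σ x pic a₀ a ^ j)
      (fun j hj => by rw [hc j hj, map_zero, zero_mul]), ← Finset.Ioc_insert_left hd,
      Finset.sum_insert (by simp)]
    have h0 : plusC pic a c 0 = 0 := by
      rw [plusC, if_neg ha, if_neg (lt_irrefl _), if_neg fun h => hp h.2]
    rw [h0, map_zero, zero_mul, zero_add]
    exact Finset.sum_congr rfl fun j hj => by rw [hpos j hj ha]

theorem expand_plusSum (a c : Idx N) {f : ℤ → ℂ} {d : ℤ} (hd : 0 ≤ d) (hf : ∀ j > d, f j = 0) :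
    expand σ x pic a₀ c (plusSum σ x pic a₀ a f) = ∑ j ∈ Finset.Icc 0 d,
      plusC pic a f j • expandHom σ x pic a₀ c (Zfun σ x pic a₀ a) ^ j := by
  rw [← expandHom_apply, plusSum_eq σ x pic a₀ a hd hf, map_sum]
  refine Finset.sum_congr rfl fun j _ => ?_
  rw [map_mul, expandHom_C, map_zpow₀, smul_eq_mono_mul]

theorem tendsto_plusC {ι : Type*} {l : Filter ι} {X : ι → ℤ → ℂ} {f : ℤ → ℂ} {d : ℤ}
    (hd : ∀ᶠ p in l, ∀ j > d, X p j = 0) (hf : ∀ j > d, f j = 0)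
    (h : ∀ j, Tendsto (fun p => X p j) l (𝓝 (f j))) (a : Idx N) (j : ℤ) :
    Tendsto (fun p => plusC pic a (X p) j) l (𝓝 (plusC pic a f j)) := by
  simp only [plusC]
  split_ifs
  · exact h j
  · exact tendsto_const_nhds
  · exact h j
  · rw [finsum_ite_pos hf]
    refine (tendsto_finsetSum (Finset.Ioc 0 d) fun i _ => h i).neg.congr' ?_
    filter_upwards [hd] with p hp
    rw [finsum_ite_pos hp]
  · exact tendsto_const_nhds

end PlusSum

/-! ## Limits of symbols -/

section Ratio

open Op

variable {N D : ℕ} [NeZero N] [NeZero D] {U : Set (Slow N D)} {ε₀ : ℝ} {n₀ : ℤ}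
  {A : ℝ → TodaData N D} {σ : Idx N → ℕ → ℝ → Slow N D → ℂ} {x : Slow N D} {pic : Picture}
  {a₀ : Idx N}

theorem hasOrd_expdsS_vec (ha₀ : a₀ ≠ Sum.inl 0) (a : Idx N) :
    HasOrd (expdsS σ x (vec pic a₀ a) a) (-1) := by
  have := hasOrd_expdsS σ x (vec pic a₀ a) a
  rwa [vec_self pic ha₀ a] at this

theorem lTendsto_shiftedWave_zsmul (hU : IsOpen U) (hε₀ : 0 < ε₀)
    (hσ : QuasiClassical U ε₀ n₀ A σ) (hx : x ∈ U) (b c : Idx N) (j : ℤ) :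
    LTendsto (fun p : ℝ × (Idx N → ℤ) =>
      shiftedWave (A p.1) n₀ ((p.1 : ℂ)⁻¹ • x.2) (j • vec pic a₀ b) p.2 c *
        (waveSer (A p.1) n₀ ((p.1 : ℂ)⁻¹ • x.2) p.2 c)⁻¹) (slowLim x.1)
      (expdsS σ x (vec pic a₀ b) c ^ j) := by
  rw [← expdsS_zsmul]
  refine lTendsto_shiftedWave hU hε₀ hσ hx ?_ c
  simp only [Pi.smul_apply, ← Finset.smul_sum, sum_vec, smul_zero]

theorem eventually_coeff_waveRatio (hU : IsOpen U) (hε₀ : 0 < ε₀)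
    (hσ : QuasiClassical U ε₀ n₀ A σ) (hx : x ∈ U) (ha₀ : a₀ ≠ Sum.inl 0)
    {X : ℝ → Op (Idx N → ℤ) ℂ} {d : ℤ}
    (hd : ∀ᶠ p : ℝ × (Idx N → ℤ) in slowLim x.1, ∀ j > d, X p.1 j p.2 = 0) (a : Idx N) (r : ℤ) :
    ∀ᶠ p : ℝ × (Idx N → ℤ) in slowLim x.1,
      (waveRatio (vec pic a₀ a) (X p.1) ((A p.1).κ n₀ ((p.1 : ℂ)⁻¹ • x.2) a) a p.2).coeff r =
        ∑ j ∈ Finset.Icc (-r) d, X p.1 j p.2 *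
          (shiftedWave (A p.1) n₀ ((p.1 : ℂ)⁻¹ • x.2) (j • vec pic a₀ a) p.2 a *
            (waveSer (A p.1) n₀ ((p.1 : ℂ)⁻¹ • x.2) p.2 a)⁻¹).coeff r := by
  filter_upwards [hd, eventually_good hU hε₀ hx] with p h1 h2
  exact coeff_waveRatio (vec_self pic ha₀ a) (X := X p.1) (d := d) h1
    (hσ.below_waveSer_inv h2.1 h2.2 a) r

theorem eq_zero_of_tendsto (hx₀ : ∑ a, x.1 a = 0) {X : ℝ → Op (Idx N → ℤ) ℂ} {d : ℤ}
    (hd : ∀ᶠ p : ℝ × (Idx N → ℤ) in slowLim x.1, ∀ j > d, X p.1 j p.2 = 0) {f : ℤ → ℂ}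
    (hf : ∀ j, Tendsto (fun p : ℝ × (Idx N → ℤ) => X p.1 j p.2) (slowLim x.1) (𝓝 (f j))) :
    ∀ j > d, f j = 0 := fun j hj => by
  have := slowLim_neBot hx₀
  refine tendsto_nhds_unique (hf j) (tendsto_const_nhds.congr' ?_)
  filter_upwards [hd] with p hp
  exact (hp j hj).symm

theorem tendstoRatio_laurentSum (hU : IsOpen U) (hε₀ : 0 < ε₀)
    (hσ : QuasiClassical U ε₀ n₀ A σ) (hx : x ∈ U) (hx₀ : ∑ a, x.1 a = 0)
    (ha₀ : a₀ ≠ Sum.inl 0) {X : ℝ → Op (Idx N → ℤ) ℂ} {d : ℤ}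
    (hd : ∀ᶠ p : ℝ × (Idx N → ℤ) in slowLim x.1, ∀ j > d, X p.1 j p.2 = 0) {f : ℤ → ℂ}
    (hf : ∀ j, Tendsto (fun p : ℝ × (Idx N → ℤ) => X p.1 j p.2) (slowLim x.1) (𝓝 (f j)))
    (a : Idx N) :
    TendstoRatio A n₀ x pic a₀ X a (laurentSum f (expdsS σ x (vec pic a₀ a) a)) := by
  intro r
  rw [coeff_laurentSum (hasOrd_expdsS_vec ha₀ a) (eq_zero_of_tendsto hx₀ hd hf)]
  refine (tendsto_finsetSum (Finset.Icc (-r) d) fun j _ => (hf j).mul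
    ((lTendsto_shiftedWave_zsmul hU hε₀ hσ hx a a j).2 r)).congr' ?_
  filter_upwards [eventually_coeff_waveRatio hU hε₀ hσ hx ha₀ hd a r] with p hp
  exact hp.symm

/-- The coefficients of an operator whose symbol converges have limits. -/
theorem TendstoRatio.exists_tendsto (hU : IsOpen U) (hε₀ : 0 < ε₀)
    (hσ : QuasiClassical U ε₀ n₀ A σ) (hx : x ∈ U) (ha₀ : a₀ ≠ Sum.inl 0)
    {X : ℝ → Op (Idx N → ℤ) ℂ} {d : ℤ}
    (hd : ∀ᶠ p : ℝ × (Idx N → ℤ) in slowLim x.1, ∀ j > d, X p.1 j p.2 = 0) {a : Idx N}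
    {G : LaurentSeries ℂ} (hG : TendstoRatio A n₀ x pic a₀ X a G) :
    ∃ f : ℤ → ℂ, ∀ j, Tendsto (fun p : ℝ × (Idx N → ℤ) => X p.1 j p.2) (slowLim x.1)
      (𝓝 (f j)) := by
  have key : ∀ n : ℕ, ∀ j : ℤ, d - n < j → ∃ l,
      Tendsto (fun p : ℝ × (Idx N → ℤ) => X p.1 j p.2) (slowLim x.1) (𝓝 l) := by
    intro n
    induction n with
    | zero =>
      intro j hj
      refine ⟨0, tendsto_const_nhds.congr' ?_⟩
      filter_upwards [hd] with p hp
      exact (hp j (by omega)).symm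
    | succ n ih =>
      intro j hj
      by_cases hjn : d - n < j
      · exact ih j hjn
      have hjd : j ≤ d := by omega
      choose! f hf using ih
      have hE := (hasOrd_expdsS_vec (σ := σ) (x := x) (pic := pic) ha₀ a).zpow j
      have hne : (expdsS σ x (vec pic a₀ a) a ^ j).coeff (-j) ≠ 0 := by
        have := hE.2
        rwa [show j * -1 = -j by ring] at this
      have hc := fun i : ℤ =>
        (lTendsto_shiftedWave_zsmul (pic := pic) (a₀ := a₀) hU hε₀ hσ hx a a i).2 (-j)
      -- Degree `-j` of the symbol contains `X_j` with a factor whose limit is nonzero; besides it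
      -- only the `X_i` with `i > j` occur, whose limits are already known.
      have h1 := ((hG (-j)).sub (tendsto_finsetSum (Finset.Ioc j d) fun i hi =>
        (hf i (by rw [Finset.mem_Ioc] at hi; omega)).mul (hc i))).div (hc j) hne
      refine ⟨_, h1.congr' ?_⟩
      filter_upwards [eventually_coeff_waveRatio (pic := pic) hU hε₀ hσ hx ha₀ hd a (-j),
        (hc j).eventually_ne hne] with p h2 h3
      rw [Pi.div_apply, h2, neg_neg, ← Finset.Ioc_insert_left hjd, Finset.sum_insert (by simp),
        add_sub_cancel_right, mul_div_cancel_right₀ _ h3]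
  choose f hf using fun j : ℤ => key (d - j + 1).toNat j (by omega)
  exact ⟨f, hf⟩

theorem TendstoRatio.unique (hx₀ : ∑ a, x.1 a = 0) {X : ℝ → Op (Idx N → ℤ) ℂ} {a : Idx N}
    {G H : LaurentSeries ℂ} (hG : TendstoRatio A n₀ x pic a₀ X a G)
    (hH : TendstoRatio A n₀ x pic a₀ X a H) : G = H := by
  have := slowLim_neBot hx₀
  ext r
  exact tendsto_nhds_unique (hG r) (hH r)

variable {y : Idx N → LaurentSeries ℂ}

theorem FirstTimeRelation.lsubst_laurentSum_expdsS (hE : FirstTimeRelation σ x)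
    (ha₀ : a₀ ≠ Sum.inl 0) (hy : IsLaxFamily σ x pic a₀ y) {f : ℤ → ℂ} {d : ℤ}
    (hf : ∀ j > d, f j = 0) (a : Idx N) :
    lsubst (laurentSum f (expdsS σ x (vec pic a₀ a) a)) (y a) = fullSum σ x pic a₀ a f := by
  rw [lsubst_laurentSum (hasOrd_expdsS_vec ha₀ a) (hy a).1 hf, hE.lsubst_expdsS ha₀ hy]
  rfl

/-- The limits of the symbols of `X` and `X_+` in terms of the limits of the coefficients. -/
theorem hasDispLimit_of_tendsto (hU : IsOpen U) (hε₀ : 0 < ε₀)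
    (hσ : QuasiClassical U ε₀ n₀ A σ) (hx : x ∈ U) (hx₀ : ∑ a, x.1 a = 0)
    (hE : FirstTimeRelation σ x) (ha₀ : a₀ ≠ Sum.inl 0) (hy : IsLaxFamily σ x pic a₀ y)
    {X : ℝ → Op (Idx N → ℤ) ℂ} {d : ℤ}
    (hd : ∀ᶠ p : ℝ × (Idx N → ℤ) in slowLim x.1, ∀ j > d, X p.1 j p.2 = 0) {f : ℤ → ℂ}
    (hf : ∀ j, Tendsto (fun p : ℝ × (Idx N → ℤ) => X p.1 j p.2) (slowLim x.1) (𝓝 (f j)))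
    (a : Idx N) :
    HasDispLimit A n₀ x pic a₀ y X a (fullSum σ x pic a₀ a f) ∧
      HasDispLimitPlus A n₀ σ x pic a₀ y X a (plusSum σ x pic a₀ a f) := by
  have hf0 := eq_zero_of_tendsto hx₀ hd hf
  refine ⟨⟨_, tendstoRatio_laurentSum hU hε₀ hσ hx hx₀ ha₀ hd hf a,
    (hE.lsubst_laurentSum_expdsS ha₀ hy hf0 a).symm⟩, ?_⟩
  have hd' : ∀ᶠ p : ℝ × (Idx N → ℤ) in slowLim x.1, ∀ j > max d 0, X p.1 j p.2 = 0 :=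
    hd.mono fun p hp j hj => hp j (lt_of_le_of_lt (le_max_left _ _) hj)
  have hf0' := eq_zero_of_tendsto hx₀ hd' hf
  have hp0 : ∀ j > max d 0, plusC pic a f j = 0 := URow_plusC (le_max_right _ _) hf0'
  refine ⟨_, tendstoRatio_laurentSum hU hε₀ hσ hx hx₀ ha₀ (d := max d 0)
    (f := plusC pic a f) ?_ (fun j => tendsto_plusC pic hd' hf0' hf a j) a, ?_⟩
  · filter_upwards [hd'] with p hp
    exact fun j hj => URow_plusC (le_max_right _ _) hp j hj
  · rw [lsubst_laurentSum (hasOrd_expdsS_vec ha₀ a) (hy a).1 hp0, hE.lsubst_expdsS ha₀ hy,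
      expand_plusSum σ x pic a₀ a a (le_max_right d 0) hf0', laurentSum_of_finite _ hp0]
    · exact fun j hj => plusC_of_neg hj
    · rw [← hE.lsubst_expdsS ha₀ hy,
        ((hasOrd_expdsS_vec ha₀ a).lsubst (hy a).1).inv.order_eq]
      have := (hy a).1
      omega

/-- The limit of a decomposition into projections. -/
theorem lsubst_eq_sum_expand (hU : IsOpen U) (hε₀ : 0 < ε₀)
    (hσ : QuasiClassical U ε₀ n₀ A σ) (hx : x ∈ U) (hx₀ : ∑ a, x.1 a = 0)
    (hE : FirstTimeRelation σ x) (ha₀ : a₀ ≠ Sum.inl 0) (hy : IsLaxFamily σ x pic a₀ y)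
    {X : Idx N → ℝ → Op (Idx N → ℤ) ℂ} {d : ℤ} (h0 : 0 ≤ d)
    (hd : ∀ b, ∀ᶠ p : ℝ × (Idx N → ℤ) in slowLim x.1, ∀ j > d, X b p.1 j p.2 = 0)
    {f : Idx N → ℤ → ℂ}
    (hf : ∀ b j, Tendsto (fun p : ℝ × (Idx N → ℤ) => X b p.1 j p.2) (slowLim x.1) (𝓝 (f b j)))
    {Φ : ℝ × (Idx N → ℤ) → LaurentSeries ℂ} {G : LaurentSeries ℂ} (c : Idx N)
    (hΦ : ∀ᶠ p : ℝ × (Idx N → ℤ) in slowLim x.1, Φ p = ∑ b, ∑ j ∈ Finset.Icc 0 d,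
      plusC pic b (fun i => X b p.1 i p.2) j •
        shiftedWave (A p.1) n₀ ((p.1 : ℂ)⁻¹ • x.2) (j • vec pic a₀ b) p.2 c)
    (hG : LTendsto (fun p => Φ p * (waveSer (A p.1) n₀ ((p.1 : ℂ)⁻¹ • x.2) p.2 c)⁻¹)
      (slowLim x.1) G) :
    lsubst G (y c) = ∑ b, expand σ x pic a₀ c (plusSum σ x pic a₀ b (f b)) := by
  have := slowLim_neBot hx₀
  have hlim : LTendsto (fun p : ℝ × (Idx N → ℤ) => ∑ b, ∑ j ∈ Finset.Icc 0 d,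
      plusC pic b (fun i => X b p.1 i p.2) j •
        (shiftedWave (A p.1) n₀ ((p.1 : ℂ)⁻¹ • x.2) (j • vec pic a₀ b) p.2 c *
          (waveSer (A p.1) n₀ ((p.1 : ℂ)⁻¹ • x.2) p.2 c)⁻¹)) (slowLim x.1)
      (∑ b, ∑ j ∈ Finset.Icc 0 d, plusC pic b (f b) j • expdsS σ x (vec pic a₀ b) c ^ j) :=
    lTendsto_sum _ fun b _ => lTendsto_sum _ fun j _ => LTendsto.smul
      (tendsto_plusC pic (hd b) (eq_zero_of_tendsto hx₀ (hd b) (hf b)) (hf b) b j)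
      (lTendsto_shiftedWave_zsmul hU hε₀ hσ hx b c j)
  have hGe : G = _ := hG.unique (hlim.congr' ?_)
  · have hyc := (hy c).1
    rw [hGe, ← lsubstHom_apply hyc, map_sum]
    refine Finset.sum_congr rfl fun b _ => ?_
    rw [map_sum, expand_plusSum σ x pic a₀ b c h0 (eq_zero_of_tendsto hx₀ (hd b) (hf b))]
    refine Finset.sum_congr rfl fun j _ => ?_
    rw [lsubstHom_apply, lsubst_smul hyc, lsubst_zpow hyc, hE.lsubst_expdsS ha₀ hy]
  · filter_upwards [hΦ] with p hp
    rw [hp, Finset.sum_mul]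
    refine Finset.sum_congr rfl fun b _ => ?_
    rw [Finset.sum_mul]
    refine Finset.sum_congr rfl fun j _ => ?_
    rw [smul_eq_mono_mul, smul_eq_mono_mul, mul_assoc]

end Ratio

/-! ### Limits of functions of the operators and the final statements -/

section Main

open Op

variable {N D : ℕ} [NeZero N] [NeZero D] {U : Set (Slow N D)} {ε₀ : ℝ} {n₀ : ℤ}
  {A : ℝ → TodaData N D} {σ : Idx N → ℕ → ℝ → Slow N D → ℂ} {x : Slow N D} {pic : Picture}
  {a₀ : Idx N} {y : Idx N → LaurentSeries ℂ}

theorem sg_mul_self (a : Idx N) : sg a * sg a = 1 := by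
  rcases a with k | k <;> simp [sg]

theorem zLax_zpow (a : Idx N) (j : ℤ) : zLax y a ^ (sg a * j) = y a ^ (-j) := by
  rw [zLax, ← zpow_mul]
  congr 1
  linear_combination -j * sg_mul_self a

/-- `F_{a,0}(z_a, m_a)` is the limit symbol at `z = z_a`. -/
theorem symbolF_eq {a : Idx N} (hy : 0 < (y a).order) {F : ℕ → ℤ → ℂ} (hF : FiniteAbove D F) : symbolF σ x pic F y a = lsubst (symbolSer σ x F a) (y a) := by
  have hy0 := (HasOrd.of_pos_order hy).ne_zero
  have h := (hasLSum_symbolSer (σ := σ) (x := x) hF a).lsubst hy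
  rw [← h.toLaurent_eq, symbolF]
  congr 1
  funext r
  refine finsum_congr fun ij => ?_
  rw [lsubst_smul hy, HahnSeries.coeff_smul, smul_eq_mul]
  congr 2
  have e1 : lsubst (mono (-ij.2) 1 * zdzS σ x a ^ ij.1) (y a) =
      y a ^ (-ij.2) * lsubst (zdzS σ x a) (y a) ^ ij.1 := by
    rw [lsubst_mul hy, lsubst_mono hy, one_smul, ← lsubstHom_apply hy (_ ^ _), map_pow,
      lsubstHom_apply]
  rw [e1, ← zLax_zpow]
  cases pic with
  | kp =>
    rw [if_pos rfl, mOrlov, lsubst_mul hy, lsubst_mono hy, one_smul, mul_pow, ← mul_assoc]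
    congr 1
    have hz : zLax y a ≠ 0 := zpow_ne_zero _ hy0
    -- In the KP picture `m_a` is `z⁻¹` times `z ∂_z 𝒮`, which the extra power `z_a^i` compensates.
    have e2 : (y a ^ sg a) ^ ij.1 = zLax y a ^ (-(ij.1 : ℤ)) := by
      rw [zLax, ← zpow_natCast, ← zpow_mul, ← zpow_mul]
      congr 1
      ring
    rw [e2, ← zpow_add₀ hz]
    congr 1
    ring
  | toda => rw [if_neg (by simp), zero_add]; rfl
  | altToda => rw [if_neg (by simp), zero_add]; rfl

theorem eventually_κ_ne_zero (hU : IsOpen U) (hε₀ : 0 < ε₀) (hσ : QuasiClassical U ε₀ n₀ A σ)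
    (hx : x ∈ U) (a b : Idx N) (lo hi : ℤ) : ∀ᶠ p : ℝ × (Idx N → ℤ) in slowLim x.1,
      ∀ m, lo ≤ m → m ≤ hi →
        (A p.1).κ n₀ ((p.1 : ℂ)⁻¹ • x.2) a 0 (p.2 + m • vec pic a₀ b) ≠ 0 := by
  have h := (Finset.eventually_all (Finset.Icc lo hi) (l := slowLim x.1)
    (p := fun m (p : ℝ × (Idx N → ℤ)) =>
      (p.2 + m • vec pic a₀ b, (p.1 : ℂ)⁻¹ • x.2) ∈ fastDom U p.1)).2 fun m _ =>
    eventually_slowLim_mem hU hx (by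
      simp only [Pi.smul_apply, ← Finset.smul_sum, sum_vec, smul_zero])
  filter_upwards [h, eventually_slowLim_Ioo x.1 hε₀] with p h1 h2 m h3 h4
  exact hσ.κ_zero_ne_zero h2 (h1 m (Finset.mem_Icc.2 ⟨h3, h4⟩)) a

theorem eventually_mem_zsmul (hU : IsOpen U) (hx : x ∈ U) (d : ℤ) :
    ∀ᶠ p : ℝ × (Idx N → ℤ) in slowLim x.1, ∀ (b : Idx N) (j : ℤ), 0 ≤ j → j ≤ d →
      (p.2 + j • vec pic a₀ b, (p.1 : ℂ)⁻¹ • x.2) ∈ fastDom U p.1 := by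
  have h := fun b : Idx N => (Finset.eventually_all (Finset.Icc 0 d) (l := slowLim x.1)
    (p := fun m (p : ℝ × (Idx N → ℤ)) =>
      (p.2 + m • vec pic a₀ b, (p.1 : ℂ)⁻¹ • x.2) ∈ fastDom U p.1)).2 fun m _ =>
    eventually_slowLim_mem hU hx (by
      simp only [Pi.smul_apply, ← Finset.smul_sum, sum_vec, smul_zero])
  filter_upwards [eventually_all.2 h] with p h1 b j h3 h4
  exact h1 b j (Finset.mem_Icc.2 ⟨h3, h4⟩)

/-! ## Functions of the Lax and Orlov–Schulman operators -/

section OpF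

variable {F : ℝ → Idx N → ℕ → ℤ → ℂ} {F₀ : Idx N → ℕ → ℤ → ℂ}

theorem eventually_opF_eq_zero (hε₀ : 0 < ε₀) {d : ℤ}
    (hd : ∀ a i j, (∃ ε ∈ Set.Ioo 0 ε₀, F ε a i j ≠ 0) → (D : ℤ) * i + j ≤ d) (a : Idx N) :
    ∀ᶠ p : ℝ × (Idx N → ℤ) in slowLim x.1, ∀ j > d, opF A n₀ x pic a₀ F a p.1 j p.2 = 0 := by
  filter_upwards [eventually_slowLim_Ioo x.1 hε₀] with p hp j hj
  exact UB_scalarF _ _ (fun i j h => hd a i j ⟨_, hp, h⟩) j hj p.2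

theorem eventually_act_opF (hU : IsOpen U) (hε₀ : 0 < ε₀) (hσ : QuasiClassical U ε₀ n₀ A σ)
    (hx : x ∈ U) (ha₀ : a₀ ≠ Sum.inl 0) (hF : Admissible D ε₀ F F₀) (a : Idx N) (r : ℤ) :
    ∀ᶠ p : ℝ × (Idx N → ℤ) in slowLim x.1, ∀ i ≤ r,
      act (vec pic a₀ a) p.2 (row (opF A n₀ x pic a₀ F a p.1) p.2)
        ((A p.1).K n₀ ((p.1 : ℂ)⁻¹ • x.2) a) (-i) =
      (stringWave (A p.1) n₀ ((p.1 : ℂ)⁻¹ • x.2) (F p.1 a) p.2 a).coeff i := by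
  obtain ⟨d, -, hd⟩ := hF.exists_bound
  -- These bound the columns lost below and above by the terms reaching degree at most `r`. The
  -- window is `[-r - e, d + e']`, as no term reaches a column beyond `d`.
  obtain ⟨e, he⟩ := ((hF.finite a (-r)).image fun ij => (D : ℤ) * ij.1 + |ij.2|).bddAbove
  obtain ⟨e', he'⟩ := ((hF.finite a (-r)).image fun ij => |ij.2|).bddAbove
  filter_upwards [eventually_κ_ne_zero (pic := pic) (a₀ := a₀) hU hε₀ hσ hx a a (-r - e) (d + e'),
    eventually_slowLim_Ioo x.1 hε₀] with p h1 h2 i hi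
  have := act_scalarF (vec_self pic ha₀ a) (hF.finiteAbove h2 a) p.2 h1 (-i) fun i' j' h3 h4 => by
    have hmem : (i', j') ∈ {ij : ℕ × ℤ |
        (∃ ε ∈ Set.Ioo 0 ε₀, F ε a ij.1 ij.2 ≠ 0) ∧ -r ≤ D * ij.1 + ij.2} :=
      ⟨⟨_, h2, h3⟩, by simp only; omega⟩
    have b1 := hd a i' j' ⟨_, h2, h3⟩
    have b2 := he ⟨_, hmem, rfl⟩
    have b3 := he' ⟨_, hmem, rfl⟩
    simp only at b2 b3
    constructor <;> omega
  rw [neg_neg] at this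
  exact this

theorem tendstoRatio_opF (hU : IsOpen U) (hε₀ : 0 < ε₀) (hσ : QuasiClassical U ε₀ n₀ A σ)
    (hx : x ∈ U) (ha₀ : a₀ ≠ Sum.inl 0) (hF : Admissible D ε₀ F F₀) (a : Idx N) :
    TendstoRatio A n₀ x pic a₀ (opF A n₀ x pic a₀ F a) a (symbolSer σ x (F₀ a) a) := by
  intro r
  obtain ⟨d, -, hd⟩ := hF.exists_bound
  refine ((lTendsto_stringWave hU hε₀ hσ hx hF a).2 r).congr' ?_
  filter_upwards [eventually_act_opF (pic := pic) hU hε₀ hσ hx ha₀ hF a r,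
    eventually_good hU hε₀ hx, eventually_opF_eq_zero hε₀ hd a] with p h1 h2 h3
  exact (coeff_waveRatio_of_agree (vec_self pic ha₀ a) h3
    (hσ.below_waveSer_inv h2.1 h2.2 a) h1).symm

end OpF

/-- Convergence of the symbol forces convergence of the coefficients, hence of the symbol of the
projection. The string equation makes the exact decomposition available at each `ε`, and its limit
in component `c` is the identity at the puncture `c`. -/
theorem hasDispLimit_opF (hU : IsOpen U) (hε₀ : 0 < ε₀)
    (hA : ∀ ε ∈ Set.Ioo 0 ε₀, SolvesFactorization (A ε) (fastDom U ε))
    (hσ : QuasiClassical U ε₀ n₀ A σ) (hx : x ∈ U) (hx₀ : ∑ a, x.1 a = 0)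
    (hE : FirstTimeRelation σ x) (ha₀ : a₀ ≠ Sum.inl 0) (hy : IsLaxFamily σ x pic a₀ y)
    {F : ℝ → Idx N → ℕ → ℤ → ℂ} {F₀ : Idx N → ℕ → ℤ → ℂ} (hF : Admissible D ε₀ F F₀) :
    (∀ a, HasDispLimit A n₀ x pic a₀ y (opF A n₀ x pic a₀ F a) a
      (symbolF σ x pic (F₀ a) y a)) ∧
    (∀ a, ∃ f₀ : ℤ → ℂ, ∀ j, Tendsto
      (fun p : ℝ × (Idx N → ℤ) => opF A n₀ x pic a₀ F a p.1 j p.2) (slowLim x.1) (𝓝 (f₀ j))) ∧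
    ∃ R : Idx N → RatFunc ℂ,
      (∀ b, HasDispLimitPlus A n₀ σ x pic a₀ y (opF A n₀ x pic a₀ F b) b (R b)) ∧
      ((∀ ε ∈ Set.Ioo 0 ε₀, ∀ s t, (s, t) ∈ fastDom U ε → (A ε).StringEq s t (F ε)) →
        ∀ a, symbolF σ x pic (F₀ a) y a = ∑ b, expand σ x pic a₀ a (R b)) := by
  obtain ⟨d, h0, hd⟩ := hF.exists_bound
  have hT := tendstoRatio_opF (pic := pic) hU hε₀ hσ hx ha₀ hF
  have hbd := fun a => eventually_opF_eq_zero (A := A) (n₀ := n₀) (x := x) (pic := pic)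
    (a₀ := a₀) hε₀ hd a
  have hlim := fun a => (hT a).exists_tendsto hU hε₀ hσ hx ha₀ (hbd a)
  have hsym := fun a => symbolF_eq (σ := σ) (x := x) (pic := pic) (hy a).1
    (hF.finiteAbove_limit hε₀ a)
  refine ⟨fun a => ⟨_, hT a, hsym a⟩, hlim, ?_⟩
  choose f hf using hlim
  refine ⟨fun b => plusSum σ x pic a₀ b (f b), fun b =>
    (hasDispLimit_of_tendsto hU hε₀ hσ hx hx₀ hE ha₀ hy (hbd b) (hf b) b).2, fun hstr c => ?_⟩
  rw [hsym c]
  refine lsubst_eq_sum_expand hU hε₀ hσ hx hx₀ hE ha₀ hy h0 hbd hf c ?_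
    (lTendsto_stringWave hU hε₀ hσ hx hF c)
  filter_upwards [eventually_good hU hε₀ hx, eventually_mem_zsmul hU hx d, eventually_all.2 hbd,
    eventually_all.2 fun b => eventually_act_opF (pic := pic) hU hε₀ hσ hx ha₀ hF b 0]
    with p h1 h2 h3 h4
  refine eq_sum_plus (hA _ h1.1) h0 h1.2 h2 (inGr_stringWave (hA _ h1.1) h1.2
    (fun a => hF.finiteAbove h1.1 a) (hstr _ h1.1 _ _ h1.2)) (fun b j hj => h3 b j hj) ?_ c
  intro b r hr
  have hr0 : r ≤ 0 := by omega
  rw [← h4 b r hr0]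
  exact act_K_eq_sum (vec_self pic ha₀ b) (h3 b) p.2 (by omega)

/-! ## Powers of the Lax operators -/

theorem opLpow_eq_zero (a : Idx N) (n : ℕ) (p : ℝ × (Idx N → ℤ)) :
    ∀ j > (n : ℤ), opLpow A n₀ x pic a₀ a n p.1 j p.2 = 0 :=
  fun j hj => UB_scalarL_pow _ _ _ j hj _

theorem eventually_act_opLpow (hU : IsOpen U) (hε₀ : 0 < ε₀) (hσ : QuasiClassical U ε₀ n₀ A σ)
    (hx : x ∈ U) (a : Idx N) (n : ℕ) (r : ℤ) :
    ∀ᶠ p : ℝ × (Idx N → ℤ) in slowLim x.1, ∀ i ≤ r,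
      act (vec pic a₀ a) p.2 (row (opLpow A n₀ x pic a₀ a n p.1) p.2)
        ((A p.1).K n₀ ((p.1 : ℂ)⁻¹ • x.2) a) (-i) =
      (mono (-n) 1 * waveSer (A p.1) n₀ ((p.1 : ℂ)⁻¹ • x.2) p.2 a).coeff i := by
  filter_upwards [eventually_κ_ne_zero (pic := pic) (a₀ := a₀) hU hε₀ hσ hx a a (-r - n)
    (n + n)] with p h1 i hi
  by_cases hin : -i ≤ n
  · have := act_scalarL_pow (vec pic a₀ a) a p.2 h1 n (-i) (by omega) (by omega)
    rw [neg_neg] at this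
    exact this
  · have h2 := URow.act (v := vec pic a₀ a) (x := p.2)
      (show URow (row (opLpow A n₀ x pic a₀ a n p.1) p.2) n from opLpow_eq_zero a n p)
      (UB_down ((A p.1).κ n₀ ((p.1 : ℂ)⁻¹ • x.2) a)) (-i) (by omega)
    refine h2.trans ((((below_mono (-n) 1).mul (below_ofPS _)) i ?_).symm)
    omega

/-- The wave function is an eigenfunction, `ℒ_a Ψ_a = z^(sg a) Ψ_a`, so the ratio is eventually
constant in each degree. -/
theorem tendstoRatio_opLpow (hU : IsOpen U) (hε₀ : 0 < ε₀) (hσ : QuasiClassical U ε₀ n₀ A σ)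
    (hx : x ∈ U) (ha₀ : a₀ ≠ Sum.inl 0) (a : Idx N) (n : ℕ) :
    TendstoRatio A n₀ x pic a₀ (opLpow A n₀ x pic a₀ a n) a (mono (-n) 1) := by
  intro r
  refine tendsto_const_nhds.congr' ?_
  filter_upwards [eventually_act_opLpow (pic := pic) (a₀ := a₀) hU hε₀ hσ hx a n r,
    eventually_good hU hε₀ hx] with p h1 h2
  refine Eq.symm ((coeff_waveRatio_of_agree (vec_self pic ha₀ a) (opLpow_eq_zero a n p)
    (hσ.below_waveSer_inv h2.1 h2.2 a) h1).trans ?_)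
  rw [mul_assoc, ← waveSer, mul_inv_cancel₀ (hσ.waveSer_ne_zero h2.1 h2.2 a), mul_one]

/-- The derivative `∂_{t_{ja}} Ψ` is a member whose only poles are those of `ℒ_a^j Ψ_a` in component
`a`. The exact decomposition therefore reduces to the single projection of `ℒ_a^j`. -/
theorem exists_time_function (hU : IsOpen U) (hε₀ : 0 < ε₀)
    (hA : ∀ ε ∈ Set.Ioo 0 ε₀, SolvesFactorization (A ε) (fastDom U ε))
    (hσ : QuasiClassical U ε₀ n₀ A σ) (hx : x ∈ U) (hx₀ : ∑ a, x.1 a = 0)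
    (hE : FirstTimeRelation σ x) (ha₀ : a₀ ≠ Sum.inl 0) (hy : IsLaxFamily σ x pic a₀ y)
    (a : Idx N) (j : Fin D) : ∃ Ω : RatFunc ℂ,
      (∀ b, lsubst (dtS σ x a j b) (y b) = expand σ x pic a₀ b Ω) ∧
      HasDispLimitPlus A n₀ σ x pic a₀ y (opLpow A n₀ x pic a₀ a (j + 1)) a Ω ∧
      IsPlusPart σ x pic a₀ a (zLax y a ^ (sg a * ((j : ℤ) + 1))) Ω := by
  classical
  set n : ℕ := (j : ℕ) + 1 with hn
  have hnj : ((n : ℕ) : ℤ) = (j : ℤ) + 1 := by rw [hn]; push_cast; rfl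
  have hbd : ∀ᶠ p : ℝ × (Idx N → ℤ) in slowLim x.1, ∀ i > (n : ℤ),
      opLpow A n₀ x pic a₀ a n p.1 i p.2 = 0 := Eventually.of_forall (opLpow_eq_zero a n)
  have hT := tendstoRatio_opLpow (pic := pic) hU hε₀ hσ hx ha₀ a n
  obtain ⟨f, hf⟩ := hT.exists_tendsto hU hε₀ hσ hx ha₀ hbd
  have hf0 := eq_zero_of_tendsto hx₀ hbd hf
  refine ⟨plusSum σ x pic a₀ a f, fun c => ?_,
    (hasDispLimit_of_tendsto hU hε₀ hσ hx hx₀ hE ha₀ hy hbd hf a).2, f, ⟨n, hf0⟩, ?_, rfl⟩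
  -- The operators attached to all `b ≠ a` are zero, so only the projection at `a` survives in the
  -- sum.
  · have key := lsubst_eq_sum_expand hU hε₀ hσ hx hx₀ hE ha₀ hy (d := n) (Int.natCast_nonneg n)
      (X := fun b => if b = a then opLpow A n₀ x pic a₀ a n else fun _ _ _ => 0)
      (f := fun b => if b = a then f else fun _ => 0) (fun b => ?_) (fun b i => ?_)
      (Φ := fun p => timeWave (A p.1) n₀ ((p.1 : ℂ)⁻¹ • x.2) a j p.2 c) c ?_
      (lTendsto_timeWave hU hε₀ hσ hx hA a j c)
    · rw [key, Finset.sum_eq_single a]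
      · rw [if_pos rfl]
      · intro b _ hb
        rw [if_neg hb, plusSum_eq σ x pic a₀ b le_rfl (fun _ _ => rfl), ← expandHom_apply]
        simp [plusC]
      · intro h
        exact absurd (Finset.mem_univ a) h
    · split_ifs
      · exact hbd
      · exact Eventually.of_forall fun _ _ _ => rfl
    · split_ifs
      · exact hf i
      · exact tendsto_const_nhds
    · filter_upwards [eventually_good hU hε₀ hx, eventually_mem_zsmul hU hx n,
        eventually_time_mem hU hε₀ hx,
        eventually_act_opLpow (pic := pic) (a₀ := a₀) hU hε₀ hσ hx a n 0] with p h1 h2 h3 h4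
      have hX : ∀ b, URow (fun i => (if b = a then opLpow A n₀ x pic a₀ a n
          else fun _ _ _ => 0) p.1 i p.2) n := by
        intro b i hi
        beta_reduce
        split_ifs
        · exact opLpow_eq_zero a n p i hi
        · rfl
      refine eq_sum_plus (hA _ h1.1) (Int.natCast_nonneg n) h1.2 h2
        (inGr_timeWave (hA _ h1.1) h3 a j) hX ?_ c
      intro b r hr
      have hr0 : r ≤ 0 := by omega
      -- The regular part of the time derivative matters only in the constant term of component `1`,
      -- where the leading coefficient is constantly `1` and its derivative is zero.
      have hd : (if 0 ≤ r then dκ (A p.1) n₀ ((p.1 : ℂ)⁻¹ • x.2) a j p.2 b r.toNat else 0) = 0 := by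
        split_ifs with h
        · have hr' : r = 0 := by omega
          rcases hr with hr | ⟨-, hb⟩
          · omega
          · subst hb
            rw [hr', Int.toNat_zero]
            exact dκ_inl_zero (hA _ h1.1) h3 a j
        · rfl
      rw [coeff_timeWave, hd, add_zero]
      by_cases hb : a = b
      · subst hb
        simp only [if_true]
        have h5 := h4 r hr0
        rw [waveSer, coeff_mono_mul_mk, one_mul, hnj, sub_neg_eq_add] at h5
        rw [← h5]
        exact act_K_eq_sum (vec_self pic ha₀ a) (opLpow_eq_zero a n p) p.2 (by omega)
      · simp only [if_neg hb, if_neg (Ne.symm hb), zero_mul, Finset.sum_const_zero]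
  -- The symbol `y^(-n)` of the power is also the series in the symbol of `𝒯_a` with the limit
  -- coefficients; uniqueness of limits gives the expansion of `z_a^(sg(a) n)` in powers of `Z_a`.
  · rw [← hE.lsubst_laurentSum_expdsS ha₀ hy hf0, ← hT.unique hx₀
      (tendstoRatio_laurentSum hU hε₀ hσ hx hx₀ ha₀ hbd hf a), zLax_zpow,
      lsubst_mono (hy a).1, one_smul, hnj]

end Main

end Whitham

theorem mainTheorem11 {N D : ℕ} [NeZero N] [NeZero D]
    (U : Set (Slow N D)) (hU : IsOpen U) (ε₀ : ℝ) (hε₀ : 0 < ε₀) (n₀ : ℤ)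
    (A : ℝ → TodaData N D) (hA : ∀ ε ∈ Set.Ioo 0 ε₀, SolvesFactorization (A ε) (fastDom U ε))
    (σ : Idx N → ℕ → ℝ → Slow N D → ℂ) (hσ : QuasiClassical U ε₀ n₀ A σ)
    (pic : Picture) (a₀ : Idx N) (ha₀ : a₀ ≠ Sum.inl 0)
    (x : Slow N D) (hx : x ∈ U) (hx₀ : ∑ a, x.1 a = 0) :
    (∃! y : Idx N → LaurentSeries ℂ, IsLaxFamily σ x pic a₀ y) ∧
    ∀ y : Idx N → LaurentSeries ℂ, IsLaxFamily σ x pic a₀ y →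
      (∀ (F : ℝ → Idx N → ℕ → ℤ → ℂ) (F₀ : Idx N → ℕ → ℤ → ℂ), Admissible D ε₀ F F₀ →
        (∀ a, HasDispLimit A n₀ x pic a₀ y (opF A n₀ x pic a₀ F a) a
          (symbolF σ x pic (F₀ a) y a)) ∧
        (∀ a, ∃ f₀ : ℤ → ℂ, ∀ j, Filter.Tendsto
          (fun p : ℝ × (Idx N → ℤ) => opF A n₀ x pic a₀ F a p.1 j p.2) (slowLim x.1)
          (nhds (f₀ j))) ∧
        ∃ R : Idx N → RatFunc ℂ,
          (∀ b, HasDispLimitPlus A n₀ σ x pic a₀ y (opF A n₀ x pic a₀ F b) b (R b)) ∧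
          ((∀ ε ∈ Set.Ioo 0 ε₀, ∀ s t, (s, t) ∈ fastDom U ε → (A ε).StringEq s t (F ε)) →
            ∀ a, symbolF σ x pic (F₀ a) y a = ∑ b, expand σ x pic a₀ a (R b))) ∧
      (∀ (a : Idx N) (f : ℝ → Op (Idx N → ℤ) ℂ) (f₀ : ℤ → ℂ),
        (∃ d : ℤ, ∀ ε, ∀ j > d, f ε j = 0) →
        (∀ j, Filter.Tendsto (fun p : ℝ × (Idx N → ℤ) => f p.1 j p.2) (slowLim x.1)
          (nhds (f₀ j))) →
        HasDispLimit A n₀ x pic a₀ y f a (fullSum σ x pic a₀ a f₀) ∧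
        HasDispLimitPlus A n₀ σ x pic a₀ y f a (plusSum σ x pic a₀ a f₀)) ∧
      (∀ (a : Idx N) (j : Fin D), ∃ Ω : RatFunc ℂ,
        (∀ b, lsubst (dtS σ x a j b) (y b) = expand σ x pic a₀ b Ω) ∧
        HasDispLimitPlus A n₀ σ x pic a₀ y (opLpow A n₀ x pic a₀ a (j + 1)) a Ω ∧
        IsPlusPart σ x pic a₀ a (zLax y a ^ (sg a * ((j : ℤ) + 1))) Ω) := by
  have hE : FirstTimeRelation σ x := fun b hb c => expdsS_first hU hε₀ hA hσ hx hx₀ hb c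
  refine ⟨hE.existsUnique_isLaxFamily ha₀, fun y hy => ⟨fun F F₀ hF =>
    hasDispLimit_opF hU hε₀ hA hσ hx hx₀ hE ha₀ hy hF, fun a f f₀ hd hf => ?_,
    exists_time_function hU hε₀ hA hσ hx hx₀ hE ha₀ hy⟩⟩
  obtain ⟨d, hd⟩ := hd
  exact hasDispLimit_of_tendsto hU hε₀ hσ hx hx₀ hE ha₀ hy (d := d)
    (Eventually.of_forall fun p j hj => by rw [hd p.1 j hj]; rfl) hf a
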